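/- Let $\mathfrak g\supset\mathfrak b\supset\mathfrak h$ be a finite-dimensional semisimple complex Lie algebra, a Borel subalgebra and a Cartan subalgebra, and let $\bar{\mathfrak b}$ be the Borel subalgebra opposite to $\mathfrak b$ with respect to $\mathfrak h$, i.e. $\mathfrak b\cap\bar{\mathfrak b}=\mathfrak h$. Let $S=S(\mathfrak h)=\mathcal O(\mathfrak h^*)$ be the symmetric algebra of $\mathfrak h$. For a commutative ring $T$ with a ring homomorphism $\varphi:S\to T$, consider the $\mathfrak g$-$T$-bimodules $M$ on which the two actions of $\mathbb C$ coincide. For $\lambda\in\mathfrak h^*$ the deformed weight space of such a bimodule is $M^\lambda=\{m\in M : Hm=\lambda(H)m+m\varphi(H)\ \text{for all } H\in\mathfrak h\}$. Let $\mathbb C_\lambda\otimes_{\mathbb C} T$ be the bimodule over $\mathfrak b$ (resp. $\bar{\mathfrak b}$) and $T$ on which the Lie algebra acts through its canonical surjection onto $\mathfrak h$, with $H\in\mathfrak h$ acting by multiplication with $\lambda(H)+\varphi(H)$. Put $$\Delta_T(\lambda)=U(\mathfrak g)\otimes_{U(\mathfrak b)}(\mathbb C_\lambda\otimes T),$$ and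 let $\nabla_T(\lambda)\subset \operatorname{Hom}_{U(\bar{\mathfrak b})}(U(\mathfrak g),\mathbb C_\lambda\otimes T)$ be the sum of all deformed weight spaces. The canonical map $\Delta_T(\lambda)\to\nabla_T(\lambda)$ is the bimodule homomorphism that sends $1\otimes 1$ to an element $f$ with $f(1)=1$. Let $\mathcal K(T)$, the category of $T$-deformed tilting modules, be the smallest full subcategory of the category of these bimodules that (1) contains all $\Delta_T(\lambda)$ for which the canonical map $\Delta_T(\lambda)\to\nabla_T(\lambda)$ is an isomorphism, and is stable under (2) tensoring over $\mathbb C$ with finite-dimensional representations of $\mathfrak g$, (3) direct summands and (4) isomorphisms. Write $\mathcal K(\mathbb C)$ for the case in which $T=\mathbb C$ and $\varphi$ is the evaluation at $0\in\mathfrak h^*$. Now let $T$ be a complete local ring with a ring homomorphism $\varphi:S\to T$ such that the preimage in $S$ of the maximal ideal $\mathfrak m$ of $T$ is the vanishing ideal of the origin of $\mathfrak h^*$, and suppose that the residue field $T/\mathfrak m$ is $\mathbb C$, so that $\mathbb C$ is a $T$-algebra. (Here complete means that the canonical map $T\to\varprojlim_n T/\mathfrak m^n$ is bijective; $T$ need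 not be noetherian.) Then $M\mapsto M\otimes_T\mathbb C$ maps $\mathcal K(T)$ to $\mathcal K(\mathbb C)$ and induces a bijection between the isomorphism classes of objects of $\mathcal K(T)$ and the isomorphism classes of objects of $\mathcal K(\mathbb C)$. -/

import Mathlib

open scoped TensorProduct

universe u v w

noncomputable section

namespace DeformedO

/-! ### Bimodules -/

section Bimodules

variable (𝔤 : Type u) [LieRing 𝔤] [LieAlgebra ℂ 𝔤] (T : Type v) [CommRing T] [Algebra ℂ T]

/-- A `𝔤`-`T`-bimodule on which the two actions of `ℂ` agree: a `T`-module on which `𝔤` acts by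
`T`-linear endomorphisms, in such a way that scalars `c : ℂ` of `𝔤` act as `c : T`.
(As `T` is commutative, the `T`-action is written on the left.) -/
structure Bimod : Type (max u v (w + 1)) where
  carrier : Type w
  [addCommGroup : AddCommGroup carrier]
  [module : Module T carrier]
  act : 𝔤 →ₛₗ[algebraMap ℂ T] Module.End T carrier
  act_lie : ∀ x y : 𝔤, act ⁅x, y⁆ = act x * act y - act y * act x

attribute [instance] Bimod.addCommGroup Bimod.module

end Bimodules

namespace Bimod

variable {𝔤 : Type u} [LieRing 𝔤] [LieAlgebra ℂ 𝔤] {T : Type v} [CommRing T] [Algebra ℂ T]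

/-- Morphisms of bimodules. -/
def Hom (M N : Bimod.{u, v, w} 𝔤 T) : Type _ :=
  {f : M.carrier →ₗ[T] N.carrier // ∀ x m, f (M.act x m) = N.act x (f m)}

/-- Isomorphisms of bimodules. -/
def Iso (M N : Bimod.{u, v, w} 𝔤 T) : Type _ :=
  {e : M.carrier ≃ₗ[T] N.carrier // ∀ x m, e (M.act x m) = N.act x (e m)}

/-- `N` is (isomorphic to) a direct summand of `M`. -/
def IsSummand (N M : Bimod.{u, v, w} 𝔤 T) : Prop :=
  ∃ (i : Hom N M) (p : Hom M N), ∀ n, p.1 (i.1 n) = n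

/-- The sub-bimodule carried by a `𝔤`-stable `T`-submodule. -/
def sub (M : Bimod.{u, v, w} 𝔤 T) (P : Submodule T M.carrier)
    (hP : ∀ x, ∀ m ∈ P, M.act x m ∈ P) : Bimod.{u, v, w} 𝔤 T where
  carrier := P
  act :=
    { toFun := fun x => (M.act x).restrict (hP x)
      map_add' := fun x y => by ext m; simp
      map_smul' := fun c x => by ext m; simp }
  act_lie x y := by ext m; simp [M.act_lie]

/-- Extension of scalars `A ⊗_T M` along `T → A`; the Lie algebra acts on the factor `M`. -/
def baseChange (A : Type*) [CommRing A] [Algebra ℂ A] [Algebra T A] [IsScalarTower ℂ T A]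
    (M : Bimod.{u, v, w} 𝔤 T) : Bimod 𝔤 A where
  carrier := A ⊗[T] M.carrier
  act :=
    { toFun := fun x => (M.act x).baseChange A
      map_add' := fun x y => by simp [LinearMap.baseChange_add]
      map_smul' := fun c x => by
        rw [LinearMap.map_smulₛₗ, LinearMap.baseChange_smul, ← algebraMap_smul A,
          ← IsScalarTower.algebraMap_apply] }
  act_lie x y := by
    simp only [M.act_lie, Module.End.mul_eq_comp, LinearMap.baseChange_sub,
      LinearMap.baseChange_comp, LinearMap.coe_mk, AddHom.coe_mk]

/-- The action of `ℂ` on a bimodule, through `ℂ → T`. -/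
abbrev complexModule (M : Bimod.{u, v, w} 𝔤 T) : Module ℂ M.carrier :=
  Module.compHom M.carrier (algebraMap ℂ T)

section Tensor

attribute [local instance] complexModule

/-- Compatibility of the actions of `ℂ` and `T`. -/
lemma complexModule_isScalarTower (M : Bimod.{u, v, w} 𝔤 T) : IsScalarTower ℂ T M.carrier :=
  ⟨fun c t m => by rw [Algebra.smul_def, mul_smul]; rfl⟩

attribute [local instance] complexModule_isScalarTower

/-- The tensor product over `ℂ` of a bimodule `M` with a representation `E` of `𝔤`: the Lie algebra
acts by `x (m ⊗ e) = x m ⊗ e + m ⊗ x e`, and `T` acts on the factor `M`. -/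
def tensor (M : Bimod.{u, v, w} 𝔤 T) (E : Type w) [AddCommGroup E] [Module ℂ E]
    [LieRingModule 𝔤 E] [LieModule ℂ 𝔤 E] : Bimod.{u, v, w} 𝔤 T where
  carrier := M.carrier ⊗[ℂ] E
  act :=
    { toFun := fun x =>
        TensorProduct.AlgebraTensorModule.map (M.act x) (LinearMap.id : E →ₗ[ℂ] E) +
        TensorProduct.AlgebraTensorModule.map (LinearMap.id : M.carrier →ₗ[T] M.carrier)
          (LieModule.toEnd ℂ 𝔤 E x)
      map_add' := fun x y => by
        ext m e
        simp [TensorProduct.add_tmul, TensorProduct.tmul_add]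
        abel
      map_smul' := fun c x => by
        ext m e
        simp [TensorProduct.smul_tmul'] }
  act_lie x y := by
    ext m e
    simp [M.act_lie, TensorProduct.sub_tmul, TensorProduct.tmul_sub]
    abel

end Tensor

/-- Being isomorphic, as an equivalence relation on the bimodules with a given property. -/
def isoSetoid (P : Bimod.{u, v, w} 𝔤 T → Prop) : Setoid {M : Bimod.{u, v, w} 𝔤 T // P M} where
  r M N := Nonempty (Iso M.1 N.1)
  iseqv :=
    { refl := fun M => ⟨⟨LinearEquiv.refl T _, fun _ _ => rfl⟩⟩
      symm := fun {M N} ⟨e⟩ => ⟨⟨e.1.symm, fun x n => by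
        apply e.1.injective
        rw [e.2, e.1.apply_symm_apply, e.1.apply_symm_apply]⟩⟩
      trans := fun {M N P} ⟨e⟩ ⟨f⟩ => ⟨⟨e.1.trans f.1, fun x m => by
        simp [e.2, f.2]⟩⟩ }

/-- The isomorphism classes of the bimodules with a given property. -/
def IsoClass (P : Bimod.{u, v, w} 𝔤 T → Prop) : Type _ := Quotient (isoSetoid P)

/-- The isomorphism class of a bimodule. -/
def isoClass {P : Bimod.{u, v, w} 𝔤 T → Prop} (M : Bimod.{u, v, w} 𝔤 T) (hM : P M) : IsoClass P :=
  Quotient.mk (isoSetoid P) ⟨M, hM⟩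

end Bimod

/-! ### Subalgebras -/

section Subalgebras

variable {𝔤 : Type u} [LieRing 𝔤] [LieAlgebra ℂ 𝔤]

/-- A Borel subalgebra: a maximal solvable subalgebra. -/
def IsBorel (𝔟 : LieSubalgebra ℂ 𝔤) : Prop :=
  Maximal (fun 𝔠 : LieSubalgebra ℂ 𝔤 => LieAlgebra.IsSolvable 𝔠) 𝔟

/-- `𝔟'` is the Borel subalgebra opposite to `𝔟` with respect to `𝔥`. -/
def IsOppositeBorel (𝔥 𝔟 𝔟' : LieSubalgebra ℂ 𝔤) : Prop :=
  IsBorel 𝔟' ∧ 𝔟 ⊓ 𝔟' = 𝔥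

/-- The linear span `[𝔟, 𝔟]` of the brackets of elements of `𝔟`. -/
def commutant (𝔟 : LieSubalgebra ℂ 𝔤) : Submodule ℂ 𝔤 :=
  Submodule.span ℂ {z | ∃ x ∈ 𝔟, ∃ y ∈ 𝔟, ⁅x, y⁆ = z}

end Subalgebras

/-! ### Deformed weight spaces, Verma modules and nabla modules -/

section Deformed

variable {𝔤 : Type u} [LieRing 𝔤] [LieAlgebra ℂ 𝔤] {T : Type v} [CommRing T] [Algebra ℂ T]

/-- The scalar `μ(H) + φ(H)` by which `H ∈ 𝔥` acts on `ℂ_μ ⊗ T`. -/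
def weightScalar {𝔥 : LieSubalgebra ℂ 𝔤} (φ : SymmetricAlgebra ℂ 𝔥 →ₐ[ℂ] T)
    (μ : Module.Dual ℂ 𝔥) (H : 𝔥) : T :=
  algebraMap ℂ T (μ H) + φ (SymmetricAlgebra.ι ℂ 𝔥 H)

/-- The deformed weight space `M^μ`: the `m` with `H m = (μ(H) + φ(H)) m` for all `H ∈ 𝔥`. -/
def weightSpace {𝔥 : LieSubalgebra ℂ 𝔤} (φ : SymmetricAlgebra ℂ 𝔥 →ₐ[ℂ] T)
    (M : Bimod.{u, v, w} 𝔤 T) (μ : Module.Dual ℂ 𝔥) : Submodule T M.carrier where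
  carrier := {m | ∀ H : 𝔥, M.act (H : 𝔤) m = weightScalar φ μ H • m}
  add_mem' := fun {a b} ha hb H => by rw [map_add, ha H, hb H, smul_add]
  zero_mem' := fun H => by simp
  smul_mem' := fun t m hm H => by rw [map_smul, hm H, smul_comm]

/-- The sum of the deformed weight spaces is stable under `𝔤`. -/
lemma act_mem_iSup_weightSpace [FiniteDimensional ℂ 𝔤] [LieAlgebra.IsSemisimple ℂ 𝔤]
    {𝔥 : LieSubalgebra ℂ 𝔤} [𝔥.IsCartanSubalgebra]
    (φ : SymmetricAlgebra ℂ 𝔥 →ₐ[ℂ] T) (M : Bimod.{u, v, w} 𝔤 T) (x : 𝔤) :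
    ∀ m ∈ ⨆ μ, weightSpace φ M μ, M.act x m ∈ ⨆ μ, weightSpace φ M μ := by
  intro m hm
  have hx : x ∈ ⨆ α : LieModule.Weight ℂ 𝔥 𝔤, (LieAlgebra.rootSpace 𝔥 α).toSubmodule := by
    rw [← LieSubmodule.iSup_toSubmodule, LieModule.iSup_genWeightSpace_eq_top' ℂ 𝔥 𝔤]
    trivial
  induction hx using Submodule.iSup_induction' with
  | mem α x hx =>
    induction hm using Submodule.iSup_induction' with
    | mem μ m hm =>
      refine Submodule.mem_iSup_of_mem (μ + LieModule.Weight.toLinear ℂ 𝔥 𝔤 α) fun H => ?_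
      have h1 : ⁅(H : 𝔤), x⁆ = α H • x :=
        LieAlgebra.IsKilling.lie_eq_smul_of_mem_rootSpace hx H
      have h2 := congrArg (fun f => f m) (M.act_lie (H : 𝔤) x)
      simp only [h1, LinearMap.map_smulₛₗ, LinearMap.smul_apply, LinearMap.sub_apply,
        Module.End.mul_apply, hm H, map_smul] at h2
      rw [eq_sub_iff_add_eq] at h2
      rw [← h2, ← add_smul]
      congr 1
      simp only [weightScalar, LinearMap.add_apply, map_add, LieModule.Weight.toLinear_apply]
      ring
    | zero => simp
    | add m n _ _ h1 h2 => rw [map_add]; exact add_mem h1 h2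
  | zero => simp
  | add x y _ _ h1 h2 => rw [map_add, LinearMap.add_apply]; exact add_mem h1 h2

local notation "𝐔" => UniversalEnvelopingAlgebra ℂ

/-- The defining relation of the enveloping algebra. -/
lemma enveloping_lie (x y : 𝔤) :
    UniversalEnvelopingAlgebra.ι ℂ ⁅x, y⁆ =
      UniversalEnvelopingAlgebra.ι ℂ x * UniversalEnvelopingAlgebra.ι ℂ y -
      UniversalEnvelopingAlgebra.ι ℂ y * UniversalEnvelopingAlgebra.ι ℂ x := by
  let _ : LieRing (𝐔 𝔤) := LieRing.ofAssociativeRing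
  exact ((UniversalEnvelopingAlgebra.ι ℂ).map_lie x y).trans
    (LieRing.of_associative_ring_bracket _ _)

/-- The relations defining `U(𝔤) ⊗_{U(𝔟)} (ℂ_μ ⊗ T)` as a quotient of `T ⊗_ℂ U(𝔤)`. An element
`H + X` of `𝔟 = 𝔥 ⊕ [𝔟, 𝔟]` acts on `ℂ_μ ⊗ T` by `μ(H) + φ(H)`. -/
def vermaRel {𝔥 : LieSubalgebra ℂ 𝔤} (𝔟 : LieSubalgebra ℂ 𝔤)
    (φ : SymmetricAlgebra ℂ 𝔥 →ₐ[ℂ] T) (μ : Module.Dual ℂ 𝔥) : Submodule T (T ⊗[ℂ] 𝐔 𝔤) :=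
  Submodule.span T {z | ∃ (t : T) (a : 𝐔 𝔤) (H : 𝔥), ∃ X ∈ commutant 𝔟,
    z = t ⊗ₜ[ℂ] (a * UniversalEnvelopingAlgebra.ι ℂ ((H : 𝔤) + X))
      - (weightScalar φ μ H * t) ⊗ₜ[ℂ] a}

/-- The deformed Verma module `Δ_T(μ) = U(𝔤) ⊗_{U(𝔟)} (ℂ_μ ⊗ T)`. -/
def verma {𝔥 : LieSubalgebra ℂ 𝔤} (𝔟 : LieSubalgebra ℂ 𝔤)
    (φ : SymmetricAlgebra ℂ 𝔥 →ₐ[ℂ] T) (μ : Module.Dual ℂ 𝔥) : Bimod.{u, v, max u v} 𝔤 T where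
  carrier := (T ⊗[ℂ] 𝐔 𝔤) ⧸ vermaRel 𝔟 φ μ
  act :=
    { toFun := fun x => (vermaRel 𝔟 φ μ).mapQ (vermaRel 𝔟 φ μ)
        ((LinearMap.mulLeft ℂ (UniversalEnvelopingAlgebra.ι ℂ x)).baseChange T) (by
          rw [vermaRel, Submodule.span_le]
          rintro _ ⟨t, a, H, X, hX, rfl⟩
          refine Submodule.subset_span ⟨t, UniversalEnvelopingAlgebra.ι ℂ x * a, H, X, hX, ?_⟩
          simp [mul_assoc])
      map_add' := fun x y => by
        ext a
        simp [add_mul, TensorProduct.tmul_add]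
      map_smul' := fun c x => by
        ext a
        simp [← Submodule.Quotient.mk_smul, TensorProduct.smul_tmul'] }
  act_lie x y := by
    ext a
    simp only [LinearMap.coe_mk, AddHom.coe_mk, enveloping_lie]
    simp [sub_mul, TensorProduct.tmul_sub, mul_assoc]

/-- The canonical generator `1 ⊗ 1` of `Δ_T(μ)`. -/
def vermaGen {𝔥 : LieSubalgebra ℂ 𝔤} (𝔟 : LieSubalgebra ℂ 𝔤)
    (φ : SymmetricAlgebra ℂ 𝔥 →ₐ[ℂ] T) (μ : Module.Dual ℂ 𝔥) : (verma 𝔟 φ μ).carrier :=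
  (vermaRel 𝔟 φ μ).mkQ (1 ⊗ₜ[ℂ] 1)

/-- The `T`-module `Hom_{U(𝔟')} (U(𝔤), ℂ_μ ⊗ T)`. An element `H + X` of `𝔟' = 𝔥 ⊕ [𝔟', 𝔟']` acts on
`ℂ_μ ⊗ T` by `μ(H) + φ(H)`. -/
def coindSubmodule {𝔥 : LieSubalgebra ℂ 𝔤} (𝔟' : LieSubalgebra ℂ 𝔤)
    (φ : SymmetricAlgebra ℂ 𝔥 →ₐ[ℂ] T) (μ : Module.Dual ℂ 𝔥) : Submodule T (𝐔 𝔤 →ₗ[ℂ] T) where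
  carrier := {f | ∀ (H : 𝔥), ∀ X ∈ commutant 𝔟', ∀ a : 𝐔 𝔤,
    f (UniversalEnvelopingAlgebra.ι ℂ ((H : 𝔤) + X) * a) = weightScalar φ μ H * f a}
  add_mem' := fun {f g} hf hg H X hX a => by
    simp only [LinearMap.add_apply, hf H X hX a, hg H X hX a, mul_add]
  zero_mem' := fun H X hX a => by simp
  smul_mem' := fun t f hf H X hX a => by
    simp only [LinearMap.smul_apply, hf H X hX a, smul_eq_mul]
    ring

/-- The coinduced bimodule `Hom_{U(𝔟')} (U(𝔤), ℂ_μ ⊗ T)`, with `(x f)(a) = f(a x)` for `x ∈ 𝔤`. -/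
def coind {𝔥 : LieSubalgebra ℂ 𝔤} (𝔟' : LieSubalgebra ℂ 𝔤)
    (φ : SymmetricAlgebra ℂ 𝔥 →ₐ[ℂ] T) (μ : Module.Dual ℂ 𝔥) : Bimod.{u, v, max u v} 𝔤 T where
  carrier := coindSubmodule 𝔟' φ μ
  act :=
    { toFun := fun x =>
        { toFun := fun f =>
            ⟨f.1 ∘ₗ LinearMap.mulRight ℂ (UniversalEnvelopingAlgebra.ι ℂ x), fun H X hX a => by
              simpa [mul_assoc] using f.2 H X hX (a * UniversalEnvelopingAlgebra.ι ℂ x)⟩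
          map_add' := fun f g => rfl
          map_smul' := fun t f => rfl }
      map_add' := fun x y => by
        ext f a
        simp [mul_add]
      map_smul' := fun c x => by
        ext f a
        simp }
  act_lie x y := by
    ext f a
    change f.1 (a * UniversalEnvelopingAlgebra.ι ℂ ⁅x, y⁆) =
      f.1 (a * UniversalEnvelopingAlgebra.ι ℂ x * UniversalEnvelopingAlgebra.ι ℂ y) -
      f.1 (a * UniversalEnvelopingAlgebra.ι ℂ y * UniversalEnvelopingAlgebra.ι ℂ x)
    rw [enveloping_lie, mul_sub, map_sub, mul_assoc, mul_assoc]

variable [FiniteDimensional ℂ 𝔤] [LieAlgebra.IsSemisimple ℂ 𝔤]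

/-- The deformed nabla module `∇_T(μ)`: the sum of all deformed weight spaces in
`Hom_{U(𝔟')} (U(𝔤), ℂ_μ ⊗ T)`, where `𝔟'` is the opposite Borel subalgebra. -/
def nabla {𝔥 : LieSubalgebra ℂ 𝔤} [𝔥.IsCartanSubalgebra] (𝔟' : LieSubalgebra ℂ 𝔤)
    (φ : SymmetricAlgebra ℂ 𝔥 →ₐ[ℂ] T) (μ : Module.Dual ℂ 𝔥) : Bimod.{u, v, max u v} 𝔤 T :=
  (coind 𝔟' φ μ).sub (⨆ ν, weightSpace φ (coind 𝔟' φ μ) ν)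
    (act_mem_iSup_weightSpace φ (coind 𝔟' φ μ))

/-- The value `f(1)` of `f ∈ ∇_T(μ)`; on the weight space `∇_T(μ)^μ` this is the canonical
identification with `T`. -/
def nablaEval {𝔥 : LieSubalgebra ℂ 𝔤} [𝔥.IsCartanSubalgebra] (𝔟' : LieSubalgebra ℂ 𝔤)
    (φ : SymmetricAlgebra ℂ 𝔥 →ₐ[ℂ] T) (μ : Module.Dual ℂ 𝔥) (f : (nabla 𝔟' φ μ).carrier) : T :=
  f.1.1 1

/-- The canonical map `Δ_T(μ) → ∇_T(μ)` is an isomorphism. The canonical map is the morphism that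
induces the identity of `T` under the canonical identifications of the weight spaces `Δ_T(μ)^μ` and
`∇_T(μ)^μ` with `T`. -/
def CanonicalIsIso {𝔥 : LieSubalgebra ℂ 𝔤} [𝔥.IsCartanSubalgebra] (𝔟 𝔟' : LieSubalgebra ℂ 𝔤)
    (φ : SymmetricAlgebra ℂ 𝔥 →ₐ[ℂ] T) (μ : Module.Dual ℂ 𝔥) : Prop :=
  ∃ e : Bimod.Iso (verma 𝔟 φ μ) (nabla 𝔟' φ μ), nablaEval 𝔟' φ μ (e.1 (vermaGen 𝔟 φ μ)) = 1

/-- Membership in the category `𝒦(T)` of `T`-deformed tilting modules: the smallest class of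
bimodules that contains the `Δ_T(μ)` for which the canonical map `Δ_T(μ) → ∇_T(μ)` is an
isomorphism and that is stable under tensoring with finite dimensional representations of `𝔤`,
under direct summands and under isomorphism. (The deformed category `𝒪(T)` contains the `Δ_T(μ)`
and has these stability properties, so that all these bimodules lie in it.) -/
inductive IsTilting {𝔥 : LieSubalgebra ℂ 𝔤} [𝔥.IsCartanSubalgebra] (𝔟 𝔟' : LieSubalgebra ℂ 𝔤)
    (φ : SymmetricAlgebra ℂ 𝔥 →ₐ[ℂ] T) : Bimod.{u, v, max u v} 𝔤 T → Prop
  | verma (μ : Module.Dual ℂ 𝔥) (hμ : CanonicalIsIso 𝔟 𝔟' φ μ) : IsTilting 𝔟 𝔟' φ (verma 𝔟 φ μ)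
  | tensor (M : Bimod.{u, v, max u v} 𝔤 T) (hM : IsTilting 𝔟 𝔟' φ M) (E : Type (max u v))
      [AddCommGroup E] [Module ℂ E] [LieRingModule 𝔤 E] [LieModule ℂ 𝔤 E]
      [FiniteDimensional ℂ E] : IsTilting 𝔟 𝔟' φ (M.tensor E)
  | summand (M N : Bimod.{u, v, max u v} 𝔤 T) (hM : IsTilting 𝔟 𝔟' φ M)
      (hN : Bimod.IsSummand N M) : IsTilting 𝔟 𝔟' φ N
  | iso (M N : Bimod.{u, v, max u v} 𝔤 T) (hM : IsTilting 𝔟 𝔟' φ M)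
      (e : Bimod.Iso M N) : IsTilting 𝔟 𝔟' φ N

/-- Evaluation at the origin of `𝔥*`, a homomorphism `S(𝔥) = 𝒪(𝔥*) → ℂ`. -/
def evalZero (𝔥 : LieSubalgebra ℂ 𝔤) : SymmetricAlgebra ℂ 𝔥 →ₐ[ℂ] ℂ :=
  SymmetricAlgebra.lift (0 : 𝔥 →ₗ[ℂ] ℂ)

end Deformed

end DeformedO

end

/-! Let 𝔪 be the kernel of T → ℂ. Reduction modulo 𝔪 is bijective on isomorphism classes because
homomorphisms between tilting modules form finite T-modules compatible with reduction, so that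
isomorphisms and idempotents lift from ℂ to T. By `IsTilting.exists_isSummand` every tilting module
is a direct summand of some Δ(μ) ⊗ E with Δ(μ) ≅ ∇(μ), and only homomorphisms between modules Δ(μ) ⊗
E have to be understood.

Duality (`Bimod.adjunction`) moves the finite-dimensional factor of the target to the source and
leaves Hom(Δ(λ) ⊗ F, ∇(μ)). By Frobenius reciprocity a homomorphism into ∇(μ) is a T-linear form on
which 𝔟' acts by the character of μ (`exists_hom_nabla`), and over 𝔟' the module Δ(λ) is induced
from 𝔥 (`exists_vermaMap`). What remains is a linear form F → T that H ∈ 𝔥 multiplies by (μ + φ)(H)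
- (λ + φ)(H). The deformation φ cancels, and the scalar is the complex number (μ - λ)(H). So the
homomorphisms are the T-valued forms on a finite-dimensional complex space, the (μ - λ)-coinvariants
of F, which knows nothing of T. This gives freeness and base change together
(`freeHom_tensor_nabla`, `freeHom_tensor_tensor`).

Injectivity: lift an isomorphism and its inverse. The two composites are congruent to the identity
modulo 𝔪 in finite T-algebras, hence are units by Nakayama (`Bimod.nonempty_iso_of_reduce`).

Surjectivity: if Δ(μ) → ∇(μ) is an isomorphism over ℂ, then it is one over T, by Nakayama on
finitely generated weight pieces (`CanonicalIsIso.of_reduce`). A summand of Δ(μ) ⊗ E over ℂ is the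
image of an idempotent, which lifts to the endomorphism algebra over T. That algebra is free of
finite rank, so limits are taken coordinatewise in the complete ring T and no noetherian hypothesis
enters (`exists_isIdempotentElem_sub_mem`).

Two inputs on 𝔤 come first. The Poincaré–Birkhoff–Witt theorem, proved through a faithful matrix
representation, makes 𝐔 𝔤 free over 𝐔 𝔟' on the monomials in positive root vectors. The triangular
decomposition is extracted from maximal solvability of 𝔟 and 𝔟' by showing that their roots form
pointed sets. -/

noncomputable section

set_option linter.unusedSectionVars false

namespace DeformedO

local notation "𝐔" => UniversalEnvelopingAlgebra ℂ
local notation "ιU" => UniversalEnvelopingAlgebra.ι ℂ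

/-! ### The Poincaré–Birkhoff–Witt theorem -/

namespace PBW

open MvPolynomial

/-! ### Matrix Lie algebras acting on polynomials by vector fields. -/

section Derivations

variable {K L : Type*} [Field K] [LieRing L] [LieAlgebra K L] {n : ℕ}

attribute [local instance] LieRing.ofAssociativeRing

variable (ρ : L →ₗ⁅K⁆ Matrix (Fin n) (Fin n) K)

/-- The derivation of the coordinate ring of `n × n` matrices `1 + Z` given by the right invariant
vector field attached to `x`. -/
def vectorField (x : L) :
    Derivation K (MvPolynomial (Fin n × Fin n) K) (MvPolynomial (Fin n × Fin n) K) :=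
  mkDerivation K fun p => C (ρ x p.1 p.2) + ∑ k, X (p.1, k) * C (ρ x k p.2)

/-- The constant coefficient part of `vectorField`. -/
def constField (x : L) :
    Derivation K (MvPolynomial (Fin n × Fin n) K) (MvPolynomial (Fin n × Fin n) K) :=
  mkDerivation K fun p => C (ρ x p.1 p.2)

lemma vectorField_X (x : L) (p : Fin n × Fin n) :
    vectorField ρ x (X p) = C (ρ x p.1 p.2) + ∑ k, X (p.1, k) * C (ρ x k p.2) :=
  mkDerivation_X _ _ _

lemma constField_X (x : L) (p : Fin n × Fin n) :
    constField ρ x (X p) = C (ρ x p.1 p.2) :=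
  mkDerivation_X _ _ _

/-- The action of a Lie algebra of matrices on polynomial functions on matrices. -/
def fieldHom : L →ₗ⁅K⁆ Module.End K (MvPolynomial (Fin n × Fin n) K) where
  toFun x := (vectorField ρ x).toLinearMap
  map_add' x y := by
    rw [← Derivation.coe_add_linearMap]
    congr 1
    refine derivation_ext fun p => ?_
    simp [vectorField_X, Finset.sum_add_distrib, mul_add]
    abel
  map_smul' c x := by
    simp only [RingHom.id_apply]
    rw [← Derivation.coe_smul_linearMap]
    congr 1
    refine derivation_ext fun p => ?_
    simp only [vectorField_X, Derivation.coe_smul, Pi.smul_apply, smul_add, Finset.smul_sum,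
      map_smul, Matrix.smul_apply, smul_eq_mul, C_mul, smul_eq_C_mul]
    congr 1
    exact Finset.sum_congr rfl fun k _ => by ring
  map_lie' := fun {x y} => by
    rw [LieRing.of_associative_ring_bracket]
    have : vectorField ρ ⁅x, y⁆ = ⁅vectorField ρ x, vectorField ρ y⁆ := by
      refine derivation_ext fun p => ?_
      -- In matrix form the field of x sends 1 + Z to (1 + Z)ρ(x), so applying the fields of y and
      -- then x gives (1 + Z)ρ(x)ρ(y); the commutator follows by subtraction.
      have key : ∀ x y : L, vectorField ρ x (vectorField ρ y (X p)) =
          C ((ρ x * ρ y) p.1 p.2) + ∑ k, X (p.1, k) * C ((ρ x * ρ y) k p.2) := by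
        intro x y
        have h1 : ∀ c, vectorField ρ x (C c) = 0 := fun c => derivation_C _ _
        simp only [vectorField_X, map_add, h1, zero_add, map_sum, Derivation.leibniz, smul_eq_mul,
          Matrix.mul_apply, C_mul, mul_add, Finset.sum_add_distrib, Finset.mul_sum, mul_zero]
        congr 1
        · exact Finset.sum_congr rfl fun k _ => by ring
        · rw [Finset.sum_comm]
          exact Finset.sum_congr rfl fun k _ => Finset.sum_congr rfl fun l _ => by ring
      rw [Derivation.commutator_apply, key, key, vectorField_X, LieHom.map_lie,
        LieRing.of_associative_ring_bracket]
      simp only [Matrix.sub_apply, C_sub, mul_sub, Finset.sum_sub_distrib]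
      ring
    rw [this]
    refine LinearMap.ext fun p => ?_
    exact Derivation.commutator_apply p

/-- The ideal of polynomials vanishing at the origin. -/
def originIdeal (K : Type*) [Field K] (n : ℕ) : Ideal (MvPolynomial (Fin n × Fin n) K) :=
  RingHom.ker (constantCoeff (σ := Fin n × Fin n) (R := K))

lemma X_mem_originIdeal (p : Fin n × Fin n) : X p ∈ originIdeal K n := by
  simp [originIdeal, RingHom.mem_ker]

lemma derivation_pow_mem {R A : Type*} [CommRing R] [CommRing A] [Algebra R A]
    (D : Derivation R A A) (I : Ideal A) (d : ℕ) {p : A} (hp : p ∈ I ^ (d + 1)) :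
    D p ∈ I ^ d := by
  induction d generalizing p with
  | zero => simp
  | succ d ih =>
    rw [pow_succ] at hp
    induction hp using Submodule.mul_induction_on' with
    | mem_mul_mem a ha b hb =>
      rw [Derivation.leibniz, smul_eq_mul, smul_eq_mul]
      refine add_mem (Ideal.mul_mem_right _ _ ha) ?_
      rw [pow_succ']
      exact Ideal.mul_mem_mul hb (ih ha)
    | add a _ b _ ha hb => rw [map_add]; exact add_mem ha hb

lemma derivation_pow_mem_of_le {R A : Type*} [CommRing R] [CommRing A] [Algebra R A]
    (D : Derivation R A A) (I : Ideal A) (hD : ∀ p ∈ I, D p ∈ I) (d : ℕ) {p : A}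
    (hp : p ∈ I ^ d) : D p ∈ I ^ d := by
  induction d generalizing p with
  | zero => simp
  | succ d ih =>
    rw [pow_succ] at hp ⊢
    induction hp using Submodule.mul_induction_on' with
    | mem_mul_mem a ha b hb =>
      rw [Derivation.leibniz, smul_eq_mul, smul_eq_mul, mul_comm b]
      exact add_mem (Ideal.mul_mem_mul ha (hD b hb)) (Ideal.mul_mem_mul (ih ha) hb)
    | add a _ b _ ha hb => rw [map_add]; exact add_mem ha hb

/-- The difference is the linear part Z ↦ Zρ(x) of the field. It vanishes at the origin, so unlike
the constant part it does not lower the order of vanishing. -/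
lemma vectorField_sub_constField_mem (x : L) (d : ℕ) {p : MvPolynomial (Fin n × Fin n) K}
    (hp : p ∈ originIdeal K n ^ d) :
    vectorField ρ x p - constField ρ x p ∈ originIdeal K n ^ d := by
  rw [← Derivation.sub_apply]
  refine derivation_pow_mem_of_le _ _ (fun q hq => ?_) d hp
  clear hq
  have : vectorField ρ x - constField ρ x =
      mkDerivation K fun p => ∑ k, X (p.1, k) * C (ρ x k p.2) := by
    refine derivation_ext fun p => ?_
    simp [vectorField_X, constField_X]
  rw [this]
  induction q using MvPolynomial.induction_on with
  | C a => rw [derivation_C]; exact zero_mem _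
  | add p q hp hq => rw [map_add]; exact add_mem hp hq
  | mul_X p i hp =>
    rw [Derivation.leibniz, smul_eq_mul, smul_eq_mul, mkDerivation_X]
    exact add_mem (Ideal.mul_mem_left _ _ (sum_mem fun k _ => Ideal.mul_mem_right _ _
      (X_mem_originIdeal _))) (Ideal.mul_mem_left _ _ hp)

/-- Successive application of the vector fields of a word. -/
def fieldWord (l : List L) : Module.End K (MvPolynomial (Fin n × Fin n) K) :=
  (l.map fun x => (vectorField ρ x).toLinearMap).prod

/-- Successive application of the constant vector fields of a word. -/
def constWord (l : List L) : Module.End K (MvPolynomial (Fin n × Fin n) K) :=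
  (l.map fun x => (constField ρ x).toLinearMap).prod

lemma fieldWord_cons (x : L) (l : List L) (p) :
    fieldWord ρ (x :: l) p = vectorField ρ x (fieldWord ρ l p) := by
  simp [fieldWord]

lemma constWord_cons (x : L) (l : List L) (p) :
    constWord ρ (x :: l) p = constField ρ x (constWord ρ l p) := by
  simp [constWord]

lemma fieldWord_mem (l : List L) (d : ℕ) {p : MvPolynomial (Fin n × Fin n) K}
    (hp : p ∈ originIdeal K n ^ (d + l.length)) : fieldWord ρ l p ∈ originIdeal K n ^ d := by
  induction l generalizing d with
  | nil => simpa [fieldWord] using hp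
  | cons x l ih =>
    rw [fieldWord_cons]
    refine derivation_pow_mem _ _ _ (ih (d + 1) ?_)
    rwa [List.length_cons, add_comm l.length, ← add_assoc] at hp

/-- Each replacement of a field by its constant part leaves an error one order higher. For a
function whose order of vanishing is the length of the word, the value at the origin is therefore
that of the commuting constant fields. -/
lemma fieldWord_sub_constWord_mem (l : List L) (d : ℕ) {p : MvPolynomial (Fin n × Fin n) K}
    (hp : p ∈ originIdeal K n ^ (d + l.length)) :
    fieldWord ρ l p - constWord ρ l p ∈ originIdeal K n ^ (d + 1) := by
  induction l generalizing d with
  | nil => simp [fieldWord, constWord]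
  | cons x l ih =>
    rw [List.length_cons, add_comm l.length, ← add_assoc] at hp
    have h1 := vectorField_sub_constField_mem ρ x (d + 1) (fieldWord_mem ρ l (d + 1) hp)
    have h2 := derivation_pow_mem (constField ρ x) _ _ (ih (d + 1) hp)
    rw [fieldWord_cons, constWord_cons]
    rw [map_sub] at h2
    convert add_mem h1 h2 using 1
    ring

lemma constantCoeff_fieldWord_of_lt (l : List L) {d : ℕ} (hd : l.length < d)
    {p : MvPolynomial (Fin n × Fin n) K} (hp : p ∈ originIdeal K n ^ d) :
    constantCoeff (fieldWord ρ l p) = 0 := by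
  have := fieldWord_mem ρ l 1 (p := p) (Ideal.pow_le_pow_right (by omega) hp)
  rwa [pow_one] at this

lemma constantCoeff_fieldWord (l : List L)
    {p : MvPolynomial (Fin n × Fin n) K} (hp : p ∈ originIdeal K n ^ l.length) :
    constantCoeff (fieldWord ρ l p) = constantCoeff (constWord ρ l p) := by
  have := fieldWord_sub_constWord_mem ρ l 0 (p := p) (by simpa using hp)
  rw [zero_add, pow_one] at this
  rw [← sub_eq_zero, ← map_sub]
  exact this

end Derivations

/-! ### Linear independence of ordered words. -/

section Independence

variable {K : Type*} [Field K] [CharZero K] {ι : Type*} [DecidableEq ι]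

/-- Iterated partial derivatives of a monomial. -/
lemma exists_pderiv_monomial (l : List ι) (s : Multiset ι) :
    ∃ c : K, (l.map fun i => ((pderiv i : Derivation K (MvPolynomial ι K) _)).toLinearMap).prod
        (monomial (Multiset.toFinsupp s) 1) = monomial (Multiset.toFinsupp (s - (l : Multiset ι))) c
      ∧ (c ≠ 0 ↔ (l : Multiset ι) ≤ s) := by
  induction l with
  | nil => exact ⟨1, by simp, by simp⟩
  | cons i l ih =>
    obtain ⟨c, hc, hc'⟩ := ih
    -- The new factor is the current exponent of `i`. It is zero exactly when `i` is exhausted, so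
    -- truncated subtraction in the exponent does no harm.
    refine ⟨c * ((s - (l : Multiset ι)).count i : ℕ), ?_, ?_⟩
    · simp only [List.map_cons, List.prod_cons, Module.End.mul_apply, hc]
      rw [Derivation.coeFn_coe, pderiv_monomial]
      congr 1
      · congr 1
        ext j
        have := Multiset.count_cons j i (l : Multiset ι)
        rw [Multiset.cons_coe] at this
        simp only [Finsupp.coe_tsub, Pi.sub_apply, Multiset.toFinsupp_apply, Multiset.count_sub,
          Finsupp.single_apply, this]
        split_ifs with h1 h2 h2
        · omega
        · exact absurd h1.symm h2
        · exact absurd h2.symm h1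
        · omega
    · rw [mul_ne_zero_iff, hc', Nat.cast_ne_zero, ← Multiset.cons_coe]
      simp only [Multiset.le_iff_count, Multiset.count_sub, Multiset.count_cons]
      constructor
      · rintro ⟨h1, h2⟩ j
        have := h1 j
        split_ifs with h
        · subst h; omega
        · omega
      · intro h
        refine ⟨fun j => ?_, ?_⟩
        · have := h j
          omega
        · have := h i
          rw [if_pos rfl] at this
          omega

attribute [local instance] LieRing.ofAssociativeRing

variable {L : Type*} [LieRing L] [LieAlgebra K L] {n : ℕ}
  (ρ : L →ₗ⁅K⁆ Matrix (Fin n) (Fin n) K)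

/-- Linear polynomials dual to a linearly independent family of constant vector fields. -/
lemma exists_dual_coordinates (hρ : Function.Injective ρ) {x : ι → L} (hx : LinearIndependent K x) :
    ∃ Y : ι → MvPolynomial (Fin n × Fin n) K, (∀ i, Y i ∈ originIdeal K n) ∧
      ∀ i j, constField ρ (x j) (Y i) = C (if i = j then 1 else 0) := by
  let ρ' : L →ₗ[K] Matrix (Fin n) (Fin n) K := ρ
  have h1 : LinearIndependent K fun i => ρ (x i) :=
    hx.map' ρ' (LinearMap.ker_eq_bot_of_injective hρ)
  have h2 : ∀ i, ∃ f : Module.Dual K (Matrix (Fin n) (Fin n) K),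
      ∀ j, f (ρ (x j)) = if i = j then 1 else 0 := by
    intro i
    obtain ⟨g, hg⟩ := LinearMap.exists_leftInverse_of_injective
      (Finsupp.linearCombination K fun i => ρ (x i)) (LinearMap.ker_eq_bot.mpr h1)
    refine ⟨Finsupp.lapply i ∘ₗ g, fun j => ?_⟩
    have := congrArg (fun f => f (Finsupp.single j 1)) hg
    simp only [LinearMap.comp_apply, Finsupp.linearCombination_single, one_smul,
      LinearMap.id_apply] at this
    simp [this, Finsupp.single_apply, eq_comm]
  choose f hf using h2
  -- The dual functional `f i` written as a linear polynomial in the matrix entries; a constant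
  -- field differentiates it to its value on the corresponding matrix.
  refine ⟨fun i => ∑ p : Fin n × Fin n, C (f i (Matrix.single p.1 p.2 1)) * X p,
    fun i => sum_mem fun p _ => Ideal.mul_mem_left _ _ (X_mem_originIdeal _), fun i j => ?_⟩
  have h3 : f i (ρ (x j)) =
      ∑ p : Fin n × Fin n, f i (Matrix.single p.1 p.2 1) * ρ (x j) p.1 p.2 := by
    generalize ρ (x j) = A
    conv_lhs => rw [Matrix.matrix_eq_sum_single A]
    rw [map_sum, Fintype.sum_prod_type]
    refine Finset.sum_congr rfl fun a _ => ?_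
    rw [map_sum]
    refine Finset.sum_congr rfl fun b _ => ?_
    have h4 : Matrix.single a b (A a b) = A a b • Matrix.single a b (1 : K) := by
      rw [Matrix.smul_single, smul_eq_mul, mul_one]
    rw [h4, map_smul, smul_eq_mul, mul_comm]
  rw [← hf i j, h3, map_sum, map_sum]
  refine Finset.sum_congr rfl fun p _ => ?_
  rw [Derivation.leibniz, derivation_C, smul_zero, add_zero, constField_X, C_mul, smul_eq_mul]

/-- Words in linearly independent elements that are pairwise different up to order are linearly
independent in the enveloping algebra. -/
theorem linearIndependent_words (hρ : Function.Injective ρ) {x : ι → L}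
    (hx : LinearIndependent K x) {κ : Type*} (w : κ → List ι)
    (hw : Function.Injective fun k => (w k : Multiset ι)) :
    LinearIndependent K fun k =>
      ((w k).map fun i => UniversalEnvelopingAlgebra.ι K (x i)).prod := by
  obtain ⟨Y, hY, hY'⟩ := exists_dual_coordinates ρ hρ hx
  -- Substituting the dual coordinates turns partial derivatives into constant fields, which reduces
  -- the question to monomials in polynomial rings.
  let θ : MvPolynomial ι K →ₐ[K] MvPolynomial (Fin n × Fin n) K := aeval Y
  have hθ : ∀ j p, constField ρ (x j) (θ p) = θ (pderiv j p) := by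
    intro j p
    induction p using MvPolynomial.induction_on with
    | C a => simp [θ, algebraMap_eq]
    | add p q hp hq => simp only [map_add, hp, hq]
    | mul_X p i hp =>
      have h1 : θ (X i) = Y i := aeval_X _ _
      rw [map_mul, Derivation.leibniz, Derivation.leibniz, hp, h1, hY', pderiv_X, smul_eq_mul,
        smul_eq_mul, smul_eq_mul, smul_eq_mul, map_add, map_mul, map_mul, h1]
      congr 2
      by_cases h : i = j
      · simp [h]
      · simp [h]
  have hθw : ∀ (l : List ι) p, constWord ρ (l.map x) (θ p) =
      θ ((l.map fun i => (pderiv i : Derivation K (MvPolynomial ι K) _).toLinearMap).prod p) := by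
    intro l p
    induction l with
    | nil => simp [constWord]
    | cons i l ih => simp [constWord_cons, ih, hθ]
  have hθc : ∀ p, constantCoeff (θ p) = constantCoeff p := by
    intro p
    have : (constantCoeff.comp θ.toRingHom) = constantCoeff := by
      refine MvPolynomial.ringHom_ext (fun a => by simp [θ, algebraMap_eq]) fun i => ?_
      have h1 : θ (X i) = Y i := aeval_X _ _
      have h2 : constantCoeff (Y i) = 0 := hY i
      simp [h1, h2]
    exact congrArg (fun f => f p) this
  have hθd : ∀ s : Multiset ι, θ (monomial (Multiset.toFinsupp s) 1) ∈
      originIdeal K n ^ (Multiset.card s) := by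
    intro s
    induction s using Multiset.induction_on with
    | empty => simp
    | cons i s ih =>
      rw [← Multiset.singleton_add, map_add, ← one_mul (1 : K), ← monomial_mul, map_mul,
        Multiset.card_add, pow_add]
      refine Ideal.mul_mem_mul ?_ ih
      simpa [θ, ← X.eq_def] using hY i
  let ev : UniversalEnvelopingAlgebra K L →ₐ[K] _ :=
    UniversalEnvelopingAlgebra.lift K (fieldHom ρ)
  have hev : ∀ l : List ι, ev ((l.map fun i => UniversalEnvelopingAlgebra.ι K (x i)).prod) =
      fieldWord ρ (l.map x) := by
    intro l
    rw [map_list_prod, List.map_map, fieldWord, List.map_map]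
    congr 1
    refine List.map_congr_left fun i _ => ?_
    exact UniversalEnvelopingAlgebra.lift_ι_apply K (fieldHom ρ) (x i)
  rw [linearIndependent_iff]
  intro c hc
  by_contra hne
  -- Test a relation on the monomial of its longest word. Shorter words give zero at the origin by
  -- order of vanishing, words of the same length with other letters give zero because they
  -- differentiate the monomial away, and the word itself gives a nonzero number in characteristic
  -- zero.
  obtain ⟨k₀, hk₀, hmax⟩ := Finset.exists_max_image c.support (fun k => (w k).length)
    (Finsupp.support_nonempty_iff.mpr hne)
  let q := θ (monomial (Multiset.toFinsupp (w k₀ : Multiset ι)) 1)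
  let val : UniversalEnvelopingAlgebra K L →ₗ[K] K :=
    (MvPolynomial.lcoeff K 0) ∘ₗ (LinearMap.applyₗ q) ∘ₗ ev.toLinearMap
  have hval : ∀ l : List ι, val ((l.map fun i => UniversalEnvelopingAlgebra.ι K (x i)).prod) =
      constantCoeff (fieldWord ρ (l.map x) q) := by
    intro l
    rw [← hev]
    rfl
  have h0 : ∀ k ∈ c.support, k ≠ k₀ → constantCoeff (fieldWord ρ ((w k).map x) q) = 0 := by
    intro k hk hkk
    rcases (hmax k hk).lt_or_eq with hlt | heq
    · exact constantCoeff_fieldWord_of_lt ρ _ (by simpa using hlt) (hθd _)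
    · rw [constantCoeff_fieldWord ρ _ (by simpa [heq] using hθd (w k₀ : Multiset ι)), hθw, hθc]
      obtain ⟨a, ha, ha'⟩ := exists_pderiv_monomial (K := K) (w k) (w k₀ : Multiset ι)
      rw [ha]
      have : a = 0 := by
        by_contra h
        exact hkk (hw (Multiset.eq_of_le_of_card_le (ha'.mp h) (by simpa using heq.ge)))
      simp [this]
  have h1 : constantCoeff (fieldWord ρ ((w k₀).map x) q) ≠ 0 := by
    rw [constantCoeff_fieldWord ρ _ (by simpa using hθd (w k₀ : Multiset ι)), hθw, hθc]
    obtain ⟨a, ha, ha'⟩ := exists_pderiv_monomial (K := K) (w k₀) (w k₀ : Multiset ι)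
    rw [ha, tsub_self]
    simpa using ha'.mpr le_rfl
  have h2 := congrArg val hc
  rw [Finsupp.linearCombination_apply, Finsupp.sum, map_sum, map_zero,
    Finset.sum_eq_single_of_mem k₀ hk₀ fun k hk hkk => by
      rw [map_smul, hval, h0 k hk hkk, smul_zero], map_smul, hval, smul_eq_mul] at h2
  exact (mul_ne_zero (Finsupp.mem_support_iff.mp hk₀) h1) h2

end Independence

/-! ### Spanning by ordered words. -/

section Spanning

variable {K L : Type*} [CommRing K] [LieRing L] [LieAlgebra K L] {ι : Type*} (x : ι → L)

lemma enveloping_lie' (y z : L) :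
    UniversalEnvelopingAlgebra.ι K ⁅y, z⁆ =
      UniversalEnvelopingAlgebra.ι K y * UniversalEnvelopingAlgebra.ι K z -
      UniversalEnvelopingAlgebra.ι K z * UniversalEnvelopingAlgebra.ι K y := by
  let _ : LieRing (UniversalEnvelopingAlgebra K L) := LieRing.ofAssociativeRing
  exact ((UniversalEnvelopingAlgebra.ι K).map_lie y z).trans
    (LieRing.of_associative_ring_bracket _ _)

/-- The enveloping algebra is generated by the Lie algebra. -/
lemma subalgebra_eq_top (S : Subalgebra K (UniversalEnvelopingAlgebra K L))
    (hS : ∀ y : L, UniversalEnvelopingAlgebra.ι K y ∈ S) : S = ⊤ := by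
  let _ : LieRing (UniversalEnvelopingAlgebra K L) := LieRing.ofAssociativeRing
  let _ : LieRing S := LieRing.ofAssociativeRing
  let j : L →ₗ⁅K⁆ S :=
    { toFun := fun y => ⟨UniversalEnvelopingAlgebra.ι K y, hS y⟩
      map_add' := fun y z => by ext; simp
      map_smul' := fun c y => by ext; simp
      map_lie' := fun {y z} => Subtype.ext (by
        rw [LieRing.of_associative_ring_bracket]
        exact enveloping_lie' y z) }
  -- The universal property lifts the inclusion of the Lie algebra to a map into `S`; followed by
  -- the inclusion of `S` it is the identity on generators, hence everywhere.
  have h : S.val.comp (UniversalEnvelopingAlgebra.lift K j) = AlgHom.id K _ := by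
    refine UniversalEnvelopingAlgebra.hom_ext K (LieHom.ext fun y => ?_)
    have := UniversalEnvelopingAlgebra.lift_ι_apply K j y
    exact congrArg Subtype.val this
  rw [eq_top_iff]
  intro a _
  have := congrArg (fun f => f a) h
  simp only [AlgHom.comp_apply, AlgHom.id_apply] at this
  rw [← this]
  exact (UniversalEnvelopingAlgebra.lift K j a).2

lemma mul_mem_of_ι_mul_mem {P : Submodule K (UniversalEnvelopingAlgebra K L)}
    (hP : ∀ y : L, ∀ v ∈ P, UniversalEnvelopingAlgebra.ι K y * v ∈ P)
    (a : UniversalEnvelopingAlgebra K L) {v : UniversalEnvelopingAlgebra K L} (hv : v ∈ P) :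
    a * v ∈ P := by
  let S : Subalgebra K (UniversalEnvelopingAlgebra K L) :=
    { carrier := {a | ∀ v ∈ P, a * v ∈ P}
      mul_mem' := fun {a b} ha hb v hv => by rw [mul_assoc]; exact ha _ (hb _ hv)
      add_mem' := fun {a b} ha hb v hv => by rw [add_mul]; exact add_mem (ha _ hv) (hb _ hv)
      algebraMap_mem' := fun c v hv => by
        rw [← Algebra.smul_def]; exact Submodule.smul_mem _ _ hv }
  have : a ∈ S := by rw [subalgebra_eq_top S hP]; trivial
  exact this v hv

/-- The product of a word in the enveloping algebra. -/
def word (l : List ι) : UniversalEnvelopingAlgebra K L :=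
  (l.map fun i => UniversalEnvelopingAlgebra.ι K (x i)).prod

@[simp] lemma word_nil : word (K := K) x [] = 1 := rfl

@[simp] lemma word_cons (i : ι) (l : List ι) :
    word (K := K) x (i :: l) = UniversalEnvelopingAlgebra.ι K (x i) * word x l := by
  simp [word]

lemma word_append (l l' : List ι) :
    word (K := K) x (l ++ l') = word x l * word x l' := by
  simp [word]

/-- The span of the words of length less than `d`. -/
def wordSpan (d : ℕ) : Submodule K (UniversalEnvelopingAlgebra K L) :=
  Submodule.span K {a | ∃ l : List ι, l.length < d ∧ a = word x l}

lemma wordSpan_mono {d e : ℕ} (h : d ≤ e) : wordSpan (K := K) x d ≤ wordSpan x e :=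
  Submodule.span_mono fun _ ⟨l, hl, ha⟩ => ⟨l, hl.trans_le h, ha⟩

lemma word_mem_wordSpan (l : List ι) : word x l ∈ wordSpan (K := K) x (l.length + 1) :=
  Submodule.subset_span ⟨l, by simp, rfl⟩

lemma mul_mem_wordSpan (i : ι) {d : ℕ} {a : UniversalEnvelopingAlgebra K L}
    (ha : a ∈ wordSpan (K := K) x d) :
    UniversalEnvelopingAlgebra.ι K (x i) * a ∈ wordSpan (K := K) x (d + 1) := by
  induction ha using Submodule.span_induction with
  | mem a h =>
    obtain ⟨l, hl, rfl⟩ := h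
    exact Submodule.subset_span ⟨i :: l, by simpa using hl, by simp⟩
  | zero => simp
  | add a b _ _ ha hb => rw [mul_add]; exact add_mem ha hb
  | smul c a _ ha => rw [mul_smul_comm]; exact Submodule.smul_mem _ _ ha

variable {x}

lemma ι_mul_mem_wordSpan (hx : Submodule.span K (Set.range x) = ⊤) (y : L) {d : ℕ}
    {a : UniversalEnvelopingAlgebra K L} (ha : a ∈ wordSpan (K := K) x d) :
    UniversalEnvelopingAlgebra.ι K y * a ∈ wordSpan (K := K) x (d + 1) := by
  have hy : y ∈ Submodule.span K (Set.range x) := hx ▸ Submodule.mem_top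
  induction hy using Submodule.span_induction with
  | mem y h => obtain ⟨i, rfl⟩ := h; exact mul_mem_wordSpan x i ha
  | zero => simp
  | add y z _ _ hy hz => rw [map_add, add_mul]; exact add_mem hy hz
  | smul c y _ hy => rw [map_smul, smul_mul_assoc]; exact Submodule.smul_mem _ _ hy

/-- Exchanging two neighbouring letters costs their bracket, which is a single letter up to linear
combination. As `wordSpan` bounds lengths strictly, the error consists of words shorter than `l`. -/
lemma word_sub_word_mem_of_perm (hx : Submodule.span K (Set.range x) = ⊤) {l l' : List ι}
    (h : l.Perm l') : word x l - word x l' ∈ wordSpan (K := K) x l.length := by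
  induction h with
  | nil => simp
  | cons i h ih =>
    rw [word_cons, word_cons, ← mul_sub]
    exact mul_mem_wordSpan x i ih
  | swap i j l =>
    have : word (K := K) x (j :: i :: l) - word x (i :: j :: l) =
        UniversalEnvelopingAlgebra.ι K ⁅x j, x i⁆ * word x l := by
      rw [enveloping_lie', word_cons, word_cons, word_cons, word_cons, sub_mul, mul_assoc,
        mul_assoc]
    rw [this]
    exact ι_mul_mem_wordSpan hx _ (word_mem_wordSpan x l)
  | trans h h' ih ih' =>
    rw [← h.length_eq] at ih'
    simpa using add_mem ih ih'

lemma span_word_eq_top (hx : Submodule.span K (Set.range x) = ⊤) :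
    Submodule.span K (Set.range fun l => word (K := K) x l) = ⊤ := by
  rw [eq_top_iff]
  intro a _
  rw [← mul_one a]
  refine mul_mem_of_ι_mul_mem (fun y v hv => ?_) a (Submodule.subset_span ⟨[], rfl⟩)
  induction hv using Submodule.span_induction with
  | mem v h =>
    obtain ⟨l, rfl⟩ := h
    refine Submodule.span_mono ?_ (ι_mul_mem_wordSpan hx y (word_mem_wordSpan x l))
    rintro _ ⟨l, -, rfl⟩
    exact ⟨l, rfl⟩
  | zero => simp
  | add a b _ _ ha hb => rw [mul_add]; exact add_mem ha hb
  | smul c a _ ha => rw [mul_smul_comm]; exact Submodule.smul_mem _ _ ha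

/-- If a family of words represents all multisets of letters from a spanning set, it spans the
enveloping algebra. -/
theorem span_words (hx : Submodule.span K (Set.range x) = ⊤) {κ : Type*} (w : κ → List ι)
    (hw : Function.Surjective fun k => (w k : Multiset ι)) :
    Submodule.span K (Set.range fun k => word (K := K) x (w k)) = ⊤ := by
  rw [eq_top_iff, ← span_word_eq_top (K := K) hx, Submodule.span_le]
  rintro _ ⟨l, rfl⟩
  -- Induction on length: a word equals the chosen word with the same letters up to shorter words.
  have key : ∀ d, wordSpan (K := K) x d ≤
      Submodule.span K (Set.range fun k => word (K := K) x (w k)) := by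
    intro d
    induction d with
    | zero =>
      rw [wordSpan, Submodule.span_le]
      rintro _ ⟨l, hl, rfl⟩
      simp at hl
    | succ d ih =>
      rw [wordSpan, Submodule.span_le]
      rintro _ ⟨l, hl, rfl⟩
      obtain ⟨k, hk⟩ := hw (l : Multiset ι)
      have h1 := word_sub_word_mem_of_perm (K := K) hx (Multiset.coe_eq_coe.mp hk).symm
      rw [SetLike.mem_coe, ← sub_add_cancel (word x l) (word x (w k))]
      exact add_mem (ih (wordSpan_mono x (by omega) h1)) (Submodule.subset_span ⟨k, rfl⟩)
  exact key _ (word_mem_wordSpan x l)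

end Spanning

end PBW

/-! ### Pointed sets -/

section Pointed

variable {V : Type*} [AddCommGroup V]

/-- A subset of an abelian group is pointed if no nonempty sum of its elements vanishes. -/
def Pointed (P : Set V) : Prop :=
  ∀ s : Multiset V, (∀ x ∈ s, x ∈ P) → s.sum = 0 → s = 0

lemma Pointed.mono {P Q : Set V} (hP : Pointed P) (h : Q ⊆ P) : Pointed Q :=
  fun s hs h0 => hP s (fun x hx => h (hs x hx)) h0

/-- There are only finitely many ways to write an element as a sum of elements of a finite pointed
family. -/
lemma finite_setOf_sum_eq {I : Type*} [Finite I] {f : I → V}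
    (hf : ∀ s : Multiset I, (s.map f).sum = 0 → s = 0) (y : V) :
    {s : Multiset I | (s.map f).sum = y}.Finite := by
  classical
  let S : Set (I →₀ ℕ) := {a | ((Finsupp.toMultiset a).map f).sum = y}
  -- Dickson's lemma: two comparable solutions differ by a multiset of sum zero, which is empty, so
  -- the solutions form an antichain in a well-quasi-order.
  have hS : S.Finite := by
    refine IsAntichain.finite_of_partiallyWellOrderedOn (r := (· ≤ ·)) ?_ 
      (Set.isPWO_of_wellQuasiOrderedLE S)
    intro a ha b hb hab hle
    apply hab
    obtain ⟨c, rfl⟩ := le_iff_exists_add.mp hle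
    have h1 : ((Finsupp.toMultiset c).map f).sum = 0 := by
      have : ((Finsupp.toMultiset (a + c)).map f).sum = y := hb
      rw [map_add, Multiset.map_add, Multiset.sum_add, show (Multiset.map f _).sum = y from ha]
        at this
      simpa using this
    have h2 := hf _ h1
    have h3 : c = 0 :=
      Finsupp.orderIsoMultiset.injective (h2.trans (map_zero Finsupp.toMultiset).symm)
    simp [h3]
  refine (hS.image Finsupp.toMultiset).subset fun s hs => ⟨Multiset.toFinsupp s, ?_, ?_⟩
  · change ((Finsupp.toMultiset (Multiset.toFinsupp s)).map f).sum = y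
    simpa using hs
  · simp

/-- Each of the finitely many elements has only finitely many decompositions. This bound makes the
derived series terminate in `isSolvable_closedSubalgebra`. -/
lemma Pointed.exists_card_lt {P : Set V} (hP : Pointed P) (hfin : P.Finite) :
    ∃ N : ℕ, ∀ s : Multiset V, (∀ x ∈ s, x ∈ P) → s.sum ∈ P → Multiset.card s < N := by
  have := hfin.to_subtype
  have h1 : ∀ y, {s : Multiset P | (s.map (fun x : P => (x : V))).sum = y}.Finite := fun y =>
    finite_setOf_sum_eq (fun s hs => by
      have := hP (s.map fun x : P => (x : V)) (by
        intro x hx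
        obtain ⟨y, -, rfl⟩ := Multiset.mem_map.mp hx
        exact y.2) hs
      simpa using this) y
  have h2 : (⋃ y ∈ P, {s : Multiset P | (s.map (fun x : P => (x : V))).sum = y}).Finite :=
    hfin.biUnion fun y _ => h1 y
  obtain ⟨N, hN⟩ := (h2.image Multiset.card).bddAbove
  refine ⟨N + 1, fun s hs hsum => Nat.lt_succ_of_le ?_⟩
  lift s to Multiset P using hs
  refine hN ⟨s, ?_, ?_⟩
  · simp only [Set.mem_iUnion]
    exact ⟨_, hsum, rfl⟩
  · simp

/-- A pointed set can be enlarged by `β` or by `-β`. -/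
lemma Pointed.insert_or_insert_neg {P : Set V} (hP : Pointed P) {β : V}
    (hβ : ∀ k : ℕ, k • β = 0 → k = 0) :
    Pointed (insert β P) ∨ Pointed (insert (-β) P) := by
  classical
  -- Pointedness can only fail through a relation that involves the new element γ; the copies of γ
  -- are split off.
  have key : ∀ γ : V, ¬ Pointed (insert γ P) → ∃ (k : ℕ) (s : Multiset V), 0 < k ∧
      (∀ x ∈ s, x ∈ P) ∧ k • γ + s.sum = 0 := by
    intro γ h
    simp only [Pointed, not_forall] at h
    obtain ⟨s, hs, h0, hne⟩ := h
    refine ⟨(s.filter (· = γ)).card, s.filter (¬ · = γ), ?_, ?_, ?_⟩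
    · by_contra hk
      have h1 : s.filter (· = γ) = 0 := by simpa using hk
      refine hne (hP s (fun x hx => (hs x hx).resolve_left fun h => ?_) h0)
      have : x ∈ s.filter (· = γ) := Multiset.mem_filter.mpr ⟨hx, h⟩
      simp [h1] at this
    · intro x hx
      obtain ⟨h1, h2⟩ := Multiset.mem_filter.mp hx
      exact (hs x h1).resolve_left h2
    · have h1 : (s.filter (· = γ)).sum = (s.filter (· = γ)).card • γ := by
        rw [Multiset.eq_replicate_card.mpr (fun b hb => (Multiset.mem_filter.mp hb).2),
          Multiset.sum_replicate, Multiset.card_replicate]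
      rw [← h1, ← Multiset.sum_add, Multiset.filter_add_not, h0]
  by_contra! h
  obtain ⟨k, s, hk, hs, h1⟩ := key β h.1
  obtain ⟨l, t, hl, ht, h2⟩ := key (-β) h.2
  -- Weighting the relations for β and -β by `l` and `k` cancels β and leaves a vanishing sum inside
  -- `P`. Hence `s` is empty and k β = 0, which is excluded.
  have h3 : (l • s + k • t).sum = 0 := by
    rw [Multiset.sum_add, Multiset.sum_nsmul, Multiset.sum_nsmul,
      eq_neg_of_add_eq_zero_right h1, eq_neg_of_add_eq_zero_right h2]
    simp only [smul_neg, neg_neg, ← mul_smul]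
    rw [mul_comm]
    simp
  have h4 := hP _ (fun x hx => by
    rcases Multiset.mem_add.mp hx with hx | hx
    · exact hs x (Multiset.mem_of_mem_nsmul hx)
    · exact ht x (Multiset.mem_of_mem_nsmul hx)) h3
  have h5 : l • s = 0 := (add_eq_zero.mp h4).1
  have h6 : s = 0 := by
    by_contra h
    have := congrArg Multiset.card h5
    rw [Multiset.card_nsmul] at this
    simp [hl.ne', h] at this
  rw [h6, Multiset.sum_zero, add_zero] at h1
  exact hk.ne' (hβ k h1)

/-- Nonzero sums of elements of a pointed set form a pointed set. -/
lemma Pointed.sums {P : Set V} (hP : Pointed P) :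
    Pointed {x | x ≠ 0 ∧ ∃ s : Multiset V, (∀ y ∈ s, y ∈ P) ∧ s.sum = x} := by
  intro s
  have key : ∀ s : Multiset V,
      (∀ x ∈ s, x ∈ {x | x ≠ 0 ∧ ∃ s : Multiset V, (∀ y ∈ s, y ∈ P) ∧ s.sum = x}) →
      ∃ t : Multiset V, (∀ y ∈ t, y ∈ P) ∧ t.sum = s.sum ∧ (t = 0 → s = 0) := by
    intro s
    induction s using Multiset.induction_on with
    | empty => exact fun _ => ⟨0, by simp, rfl, fun _ => rfl⟩
    | cons a s ih =>
      intro h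
      obtain ⟨t, ht, hts, -⟩ := ih fun x hx => h x (Multiset.mem_cons_of_mem hx)
      obtain ⟨ha, r, hr, hra⟩ := h a (Multiset.mem_cons_self a s)
      refine ⟨r + t, fun y hy => (Multiset.mem_add.mp hy).elim (hr y) (ht y), ?_, fun h0 => ?_⟩
      · rw [Multiset.sum_add, hra, hts, Multiset.sum_cons]
      · rw [(add_eq_zero.mp h0).1] at hra
        exact absurd hra.symm ha
  intro hs h0
  obtain ⟨t, ht, hts, h1⟩ := key s hs
  exact h1 (hP t ht (hts.trans h0))

end Pointed

/-! ### Borel subalgebras -/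

section Borel

open LieAlgebra LieModule

variable {𝔤 : Type u} [LieRing 𝔤] [LieAlgebra ℂ 𝔤] [FiniteDimensional ℂ 𝔤]
  [LieAlgebra.IsSemisimple ℂ 𝔤] (𝔥 : LieSubalgebra ℂ 𝔤) [𝔥.IsCartanSubalgebra]

/-- The sum of the root spaces of a set of linear forms. -/
def rootSum (A : Set (Module.Dual ℂ 𝔥)) : Submodule ℂ 𝔤 :=
  ⨆ χ ∈ A, (rootSpace 𝔥 (χ : 𝔥 → ℂ)).toSubmodule

variable {𝔥}

lemma rootSpace_le_rootSum {A : Set (Module.Dual ℂ 𝔥)} {χ : Module.Dual ℂ 𝔥} (h : χ ∈ A) :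
    (rootSpace 𝔥 (χ : 𝔥 → ℂ)).toSubmodule ≤ rootSum 𝔥 A :=
  le_iSup₂_of_le χ h le_rfl

lemma rootSum_mono {A B : Set (Module.Dual ℂ 𝔥)} (h : A ⊆ B) : rootSum 𝔥 A ≤ rootSum 𝔥 B :=
  biSup_mono h

lemma rootSum_le {A : Set (Module.Dual ℂ 𝔥)} {P : Submodule ℂ 𝔤}
    (h : ∀ χ ∈ A, ∀ x ∈ rootSpace 𝔥 (χ : 𝔥 → ℂ), x ∈ P) : rootSum 𝔥 A ≤ P :=
  iSup₂_le fun χ hχ x hx => h χ hχ x hx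

lemma lie_mem_of_mem_rootSum {A B : Set (Module.Dual ℂ 𝔥)} {P : Submodule ℂ 𝔤}
    (h : ∀ χ ∈ A, ∀ x ∈ rootSpace 𝔥 (χ : 𝔥 → ℂ), ∀ ψ ∈ B, ∀ y ∈ rootSpace 𝔥 (ψ : 𝔥 → ℂ),
      ⁅x, y⁆ ∈ P) {x y : 𝔤} (hx : x ∈ rootSum 𝔥 A) (hy : y ∈ rootSum 𝔥 B) : ⁅x, y⁆ ∈ P := by
  have h1 : ∀ χ ∈ A, ∀ x ∈ rootSpace 𝔥 (χ : 𝔥 → ℂ),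
      rootSum 𝔥 B ≤ P.comap (LieAlgebra.ad ℂ 𝔤 x) := fun χ hχ x hx =>
    rootSum_le fun ψ hψ y hy => h χ hχ x hx ψ hψ y hy
  have h2 : rootSum 𝔥 A ≤ P.comap (LieAlgebra.ad ℂ 𝔤 y) :=
    rootSum_le fun χ hχ x hx => by
      have := h1 χ hχ x hx hy
      change ⁅y, x⁆ ∈ P
      rw [← lie_skew]
      exact P.neg_mem this
  have := h2 hx
  rw [← lie_skew]
  exact P.neg_mem this

lemma mem_rootSpace_zero {x : 𝔤} : x ∈ rootSpace 𝔥 ((0 : Module.Dual ℂ 𝔥) : 𝔥 → ℂ) ↔ x ∈ 𝔥 := by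
  have : ((0 : Module.Dual ℂ 𝔥) : 𝔥 → ℂ) = 0 := rfl
  rw [this, rootSpace_zero_eq ℂ 𝔤 𝔥, LieSubalgebra.mem_toLieSubmodule]

lemma lie_mem_rootSpace_add {χ ψ : Module.Dual ℂ 𝔥} {x y : 𝔤}
    (hx : x ∈ rootSpace 𝔥 (χ : 𝔥 → ℂ)) (hy : y ∈ rootSpace 𝔥 (ψ : 𝔥 → ℂ)) :
    ⁅x, y⁆ ∈ rootSpace 𝔥 ((χ + ψ : Module.Dual ℂ 𝔥) : 𝔥 → ℂ) :=
  lie_mem_genWeightSpace_of_mem_genWeightSpace hx hy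

variable (𝔥) in
/-- The roots, as linear forms. -/
def rootForms : Set (Module.Dual ℂ 𝔥) := {χ | χ ≠ 0 ∧ rootSpace 𝔥 (χ : 𝔥 → ℂ) ≠ ⊥}

lemma finite_rootForms : (rootForms 𝔥).Finite := by
  refine (Set.finite_range fun α : Weight ℂ 𝔥 𝔤 => Weight.toLinear ℂ 𝔥 𝔤 α).subset ?_
  rintro χ ⟨-, h⟩
  exact ⟨⟨χ, h⟩, by ext; rfl⟩

lemma rootSum_rootForms : (⊤ : Submodule ℂ 𝔤) = rootSum 𝔥 (insert 0 (rootForms 𝔥)) := by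
  symm
  rw [eq_top_iff]
  have : (⨆ α : Weight ℂ 𝔥 𝔤, (rootSpace 𝔥 α).toSubmodule) = ⊤ := by
    rw [← LieSubmodule.iSup_toSubmodule, LieModule.iSup_genWeightSpace_eq_top' ℂ 𝔥 𝔤]
    rfl
  rw [← this]
  refine iSup_le fun α => ?_
  refine rootSpace_le_rootSum (χ := Weight.toLinear ℂ 𝔥 𝔤 α) ?_
  by_cases h : Weight.toLinear ℂ 𝔥 𝔤 α = 0
  · exact Or.inl h
  · exact Or.inr ⟨h, α.2⟩

/-- The roots of a subalgebra containing the Cartan subalgebra. -/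
def rootsOf (𝔠 : LieSubalgebra ℂ 𝔤) : Set (Module.Dual ℂ 𝔥) :=
  {χ | χ ∈ rootForms 𝔥 ∧ (rootSpace 𝔥 (χ : 𝔥 → ℂ)).toSubmodule ≤ 𝔠.toSubmodule}

lemma exists_span_rootSpace {χ : Module.Dual ℂ 𝔥} (h : χ ∈ rootForms 𝔥) :
    ∃ x : 𝔤, x ≠ 0 ∧ (rootSpace 𝔥 (χ : 𝔥 → ℂ)).toSubmodule = Submodule.span ℂ {x} := by
  let α : Weight ℂ 𝔥 𝔤 := ⟨χ, h.2⟩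
  have hα : α.IsNonZero := fun h0 => h.1 (by ext H; exact congrFun h0 H)
  have h1 := LieAlgebra.IsKilling.finrank_rootSpace_eq_one α hα
  obtain ⟨⟨x, hx⟩, hx0, hx1⟩ := finrank_eq_one_iff'.mp h1
  refine ⟨x, fun h => hx0 (Subtype.ext h), le_antisymm (fun y hy => ?_) ?_⟩
  · obtain ⟨c, hc⟩ := hx1 ⟨y, hy⟩
    exact Submodule.mem_span_singleton.mpr ⟨c, congrArg Subtype.val hc⟩
  · rw [Submodule.span_le, Set.singleton_subset_iff]
    exact hx

/-- Root spaces are lines, so one nonzero root vector in 𝔠 brings its whole root space. -/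
lemma mem_rootsOf_of_mem {𝔠 : LieSubalgebra ℂ 𝔤} {χ : Module.Dual ℂ 𝔥} (h0 : χ ≠ 0) {x : 𝔤}
    (hx : x ∈ rootSpace 𝔥 (χ : 𝔥 → ℂ)) (hx0 : x ≠ 0) (hxc : x ∈ 𝔠) : χ ∈ rootsOf 𝔠 := by
  have h : χ ∈ rootForms 𝔥 := ⟨h0, fun h => hx0 (by rw [h] at hx; simpa using hx)⟩
  refine ⟨h, ?_⟩
  obtain ⟨y, hy0, hy⟩ := exists_span_rootSpace h
  have hx' : x ∈ (rootSpace 𝔥 (χ : 𝔥 → ℂ)).toSubmodule := hx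
  rw [hy] at hx' ⊢
  obtain ⟨c, rfl⟩ := Submodule.mem_span_singleton.mp hx'
  have hc : c ≠ 0 := fun h => hx0 (by simp [h])
  rw [Submodule.span_le, Set.singleton_subset_iff]
  have := 𝔠.toSubmodule.smul_mem c⁻¹ hxc
  rwa [smul_smul, inv_mul_cancel₀ hc, one_smul] at this

/-- A subalgebra containing 𝔥 is stable under ad 𝔥, hence is the sum of its intersections with the
weight spaces, and each intersection with a root line is zero or everything. -/
lemma toSubmodule_eq_rootSum {𝔠 : LieSubalgebra ℂ 𝔤} (h : 𝔥 ≤ 𝔠) :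
    𝔠.toSubmodule = rootSum 𝔥 (insert 0 (rootsOf 𝔠)) := by
  let N : LieSubmodule ℂ 𝔥 𝔤 :=
    { 𝔠.toSubmodule with
      lie_mem := fun {H x} hx => 𝔠.lie_mem (h H.2) hx }
  apply le_antisymm
  · have h1 : N.toSubmodule = ⨆ χ : Weight ℂ 𝔥 𝔤, (N ⊓ genWeightSpace 𝔤 χ).toSubmodule := by
      conv_lhs => rw [eq_iSup_inf_genWeightSpace (N := N)]
      rw [LieSubmodule.iSup_toSubmodule]
    change N.toSubmodule ≤ _
    rw [h1]
    refine iSup_le fun α x hx => ?_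
    obtain ⟨hxN, hx⟩ := hx
    by_cases h0 : Weight.toLinear ℂ 𝔥 𝔤 α = 0
    · exact rootSpace_le_rootSum (χ := Weight.toLinear ℂ 𝔥 𝔤 α) (Or.inl h0) hx
    · by_cases hx0 : x = 0
      · rw [hx0]; exact zero_mem _
      · exact rootSpace_le_rootSum (χ := Weight.toLinear ℂ 𝔥 𝔤 α)
          (Or.inr (mem_rootsOf_of_mem h0 hx hx0 hxN)) hx
  · refine rootSum_le ?_
    rintro χ (rfl | hχ) x hx
    · exact h (mem_rootSpace_zero.mp hx)
    · exact hχ.2 hx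

/-- Otherwise 𝔠 contains an 𝔰𝔩₂-triple, and the triple survives in every term of the derived series.
-/
lemma neg_notMem_rootsOf {𝔠 : LieSubalgebra ℂ 𝔤} [LieAlgebra.IsSolvable 𝔠]
    {χ : Module.Dual ℂ 𝔥} (h : χ ∈ rootsOf 𝔠) : -χ ∉ rootsOf 𝔠 := by
  intro h'
  let α : Weight ℂ 𝔥 𝔤 := ⟨χ, h.1.2⟩
  have hα : α.IsNonZero := fun h0 => h.1.1 (by ext H; exact congrFun h0 H)
  obtain ⟨H, e, f, t, he, hf⟩ :=
    LieAlgebra.IsKilling.exists_isSl2Triple_of_weight_isNonZero hα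
  have hec : e ∈ 𝔠 := h.2 he
  have hfc : f ∈ 𝔠 := h'.2 hf
  have hHc : H ∈ 𝔠 := by rw [← t.lie_e_f]; exact 𝔠.lie_mem hec hfc
  obtain ⟨k, hk⟩ := (LieAlgebra.isSolvable_iff ℂ 𝔠).mp (inferInstance : LieAlgebra.IsSolvable 𝔠)
  have key : ∀ k, (⟨H, hHc⟩ : 𝔠) ∈ derivedSeries ℂ 𝔠 k ∧ (⟨e, hec⟩ : 𝔠) ∈ derivedSeries ℂ 𝔠 k ∧
      (⟨f, hfc⟩ : 𝔠) ∈ derivedSeries ℂ 𝔠 k := by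
    intro k
    induction k with
    | zero => simp
    | succ k ih =>
      obtain ⟨h1, h2, h3⟩ := ih
      rw [derivedSeries_def, derivedSeriesOfIdeal_succ]
      have hH := LieSubmodule.lie_mem_lie h2 h3
      have he' := LieSubmodule.lie_mem_lie h1 h2
      have hf' := LieSubmodule.lie_mem_lie h1 h3
      rw [show ⁅(⟨e, hec⟩ : 𝔠), (⟨f, hfc⟩ : 𝔠)⁆ = ⟨H, hHc⟩ from Subtype.ext t.lie_e_f] at hH
      rw [show ⁅(⟨H, hHc⟩ : 𝔠), (⟨e, hec⟩ : 𝔠)⁆ = (2 : ℂ) • ⟨e, hec⟩ from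
        Subtype.ext (t.lie_h_e_smul ℂ)] at he'
      rw [show ⁅(⟨H, hHc⟩ : 𝔠), (⟨f, hfc⟩ : 𝔠)⁆ = (-2 : ℂ) • ⟨f, hfc⟩ from
        Subtype.ext ((t.lie_lie_smul_f ℂ).trans (neg_smul _ _).symm)] at hf'
      refine ⟨hH, ?_, ?_⟩
      · have := SMulMemClass.smul_mem (2 : ℂ)⁻¹ he'
        rwa [smul_smul, inv_mul_cancel₀ (by norm_num), one_smul] at this
      · have := SMulMemClass.smul_mem (-2 : ℂ)⁻¹ hf'
        rwa [smul_smul, inv_mul_cancel₀ (by norm_num), one_smul] at this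
  have := (key k).2.1
  rw [hk] at this
  exact t.e_ne_zero (congrArg Subtype.val ((LieSubmodule.mem_bot _).mp this))

/-- If the root vector of χ killed that of ψ, the latter would be a primitive vector for the
𝔰𝔩₂-triple of χ in a finite-dimensional module, and its weight on the coroot would be a natural
number. So the bracket is a nonzero vector of weight χ + ψ. -/
lemma add_mem_rootsOf {𝔠 : LieSubalgebra ℂ 𝔤} {χ ψ : Module.Dual ℂ 𝔥} (hχ : χ ∈ rootsOf 𝔠)
    (hψ : ψ ∈ rootsOf 𝔠) (h0 : χ + ψ ≠ 0)
    (hneg : ∀ n : ℕ, ψ (LieAlgebra.IsKilling.coroot (⟨χ, hχ.1.2⟩ : Weight ℂ 𝔥 𝔤)) ≠ n) :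
    χ + ψ ∈ rootsOf 𝔠 := by
  let α : Weight ℂ 𝔥 𝔤 := ⟨χ, hχ.1.2⟩
  have hα : α.IsNonZero := fun h0 => hχ.1.1 (by ext H; exact congrFun h0 H)
  obtain ⟨H, e, f, t, he, hf⟩ :=
    LieAlgebra.IsKilling.exists_isSl2Triple_of_weight_isNonZero hα
  obtain rfl := t.h_eq_coroot hα he hf
  obtain ⟨x, hx0, hx⟩ := exists_span_rootSpace hψ.1
  have hx' : x ∈ rootSpace 𝔥 (ψ : 𝔥 → ℂ) := by
    change x ∈ (rootSpace 𝔥 (ψ : 𝔥 → ℂ)).toSubmodule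
    rw [hx]
    exact Submodule.mem_span_singleton_self x
  refine mem_rootsOf_of_mem h0 (lie_mem_rootSpace_add he hx') (fun hzero => ?_)
    (𝔠.lie_mem (hχ.2 he) (hψ.2 hx'))
  have hprim : t.HasPrimitiveVectorWith x (ψ (LieAlgebra.IsKilling.coroot α)) :=
    ⟨hx0, LieAlgebra.IsKilling.lie_eq_smul_of_mem_rootSpace hx' _, hzero⟩
  obtain ⟨n, hn⟩ := hprim.exists_nat
  exact hneg n hn

/-- Take a shortest nonempty relation and one of its roots χ. If another term pairs with the coroot
of χ to something other than a natural number, the two merge into one root and shorten the relation.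
If there is no such term, pairing the relation with the coroot gives 2 plus a natural number equal
to 0. -/
lemma pointed_rootsOf {𝔠 : LieSubalgebra ℂ 𝔤} [LieAlgebra.IsSolvable 𝔠] :
    Pointed (rootsOf (𝔥 := 𝔥) 𝔠) := by
  classical
  intro s
  induction hn : Multiset.card s using Nat.strong_induction_on generalizing s with
  | _ n ih =>
    intro hs h0
    by_contra hne
    obtain ⟨χ, hχs⟩ := Multiset.exists_mem_of_ne_zero hne
    obtain ⟨s, rfl⟩ := Multiset.exists_cons_of_mem hχs
    have hχ := hs χ (Multiset.mem_cons_self _ _)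
    let α : Weight ℂ 𝔥 𝔤 := ⟨χ, hχ.1.2⟩
    have hα : α.IsNonZero := fun h0 => hχ.1.1 (by ext H; exact congrFun h0 H)
    by_cases hex : ∃ ψ ∈ s, ∀ n : ℕ, ψ (LieAlgebra.IsKilling.coroot α) ≠ n
    · obtain ⟨ψ, hψs, hψ⟩ := hex
      obtain ⟨s, rfl⟩ := Multiset.exists_cons_of_mem hψs
      have hψ' := hs ψ (by simp)
      have hsum : χ + ψ ≠ 0 := fun h => neg_notMem_rootsOf hχ (by
        rwa [← eq_neg_of_add_eq_zero_right h])
      have h1 := add_mem_rootsOf hχ hψ' hsum hψ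
      have := ih (Multiset.card ((χ + ψ) ::ₘ s)) (by rw [← hn]; simp) ((χ + ψ) ::ₘ s) rfl
        (fun x hx => by
          rcases Multiset.mem_cons.mp hx with rfl | hx
          · exact h1
          · exact hs x (by simp [hx])) (by simpa [add_assoc] using h0)
      simp at this
    · push Not at hex
      have h1 := congrArg (fun f : Module.Dual ℂ 𝔥 => f (LieAlgebra.IsKilling.coroot α)) h0
      have h2 : ∀ s : Multiset (Module.Dual ℂ 𝔥),
          (∀ ψ ∈ s, ∃ n : ℕ, ψ (LieAlgebra.IsKilling.coroot α) = n) →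
          ∃ n : ℕ, s.sum (LieAlgebra.IsKilling.coroot α) = n := by
        intro s
        induction s using Multiset.induction_on with
        | empty => exact fun _ => ⟨0, by simp⟩
        | cons a s ih =>
          intro h
          obtain ⟨n, hn⟩ := ih fun x hx => h x (by simp [hx])
          obtain ⟨m, hm⟩ := h a (by simp)
          exact ⟨m + n, by simp [hn, hm]⟩
      obtain ⟨m, hm⟩ := h2 s hex
      have h3 : χ (LieAlgebra.IsKilling.coroot α) = 2 := LieAlgebra.IsKilling.root_apply_coroot hα
      simp only [Multiset.sum_cons, LinearMap.add_apply, h3, hm, LinearMap.zero_apply] at h1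
      have : ((2 + m : ℕ) : ℂ) = 0 := by push_cast; exact h1
      rw [Nat.cast_eq_zero] at this
      omega

/-- The elements of `P` that are sums of at least `k` elements of `P`. -/
def depthSet {V : Type*} [AddCommGroup V] (P : Set V) (k : ℕ) : Set V :=
  {χ | χ ∈ P ∧ ∃ s : Multiset V, (∀ x ∈ s, x ∈ P) ∧ k ≤ Multiset.card s ∧ s.sum = χ}

lemma lie_mem_rootSum_of_closed {P A : Set (Module.Dual ℂ 𝔥)} {χ ψ : Module.Dual ℂ 𝔥} {x y : 𝔤}
    (hx : x ∈ rootSpace 𝔥 (χ : 𝔥 → ℂ)) (hy : y ∈ rootSpace 𝔥 (ψ : 𝔥 → ℂ))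
    (hP : χ + ψ ∈ rootForms 𝔥 → χ + ψ ∈ P) (hA : χ + ψ ∈ insert 0 P → χ + ψ ∈ A) :
    ⁅x, y⁆ ∈ rootSum 𝔥 A := by
  have h := lie_mem_rootSpace_add hx hy
  by_cases h0 : χ + ψ = 0
  · exact rootSpace_le_rootSum (hA (Or.inl h0)) h
  · by_cases hb : rootSpace 𝔥 ((χ + ψ : Module.Dual ℂ 𝔥) : 𝔥 → ℂ) = ⊥
    · rw [hb, LieSubmodule.mem_bot] at h
      rw [h]
      exact zero_mem _
    · exact rootSpace_le_rootSum (hA (Or.inr (hP ⟨h0, hb⟩))) h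

/-- The subalgebra spanned by the Cartan subalgebra and the root spaces of a closed set of roots. -/
def closedSubalgebra (P : Set (Module.Dual ℂ 𝔥))
    (hP : ∀ χ ∈ P, ∀ ψ ∈ P, χ + ψ ∈ rootForms 𝔥 → χ + ψ ∈ P) : LieSubalgebra ℂ 𝔤 :=
  { rootSum 𝔥 (insert 0 P) with
    lie_mem' := fun {x y} hx hy => by
      refine lie_mem_of_mem_rootSum (A := insert 0 P) (B := insert 0 P)
        (P := rootSum 𝔥 (insert 0 P))
        ?_ hx hy
      rintro χ (rfl | hχ) x hx ψ hψ y hy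
      · refine rootSpace_le_rootSum hψ ?_
        have := lie_mem_rootSpace_add hx hy
        rwa [zero_add] at this
      · rcases hψ with rfl | hψ
        · refine rootSpace_le_rootSum (Or.inr hχ) ?_
          have := lie_mem_rootSpace_add hx hy
          rwa [add_zero] at this
        · exact lie_mem_rootSum_of_closed hx hy (hP χ hχ ψ hψ) id }

/-- Taking brackets adds the lengths of decompositions into elements of `P`, so terms of the derived
series live on roots of growing depth, and depth is bounded. The first derived term already loses 𝔥,
which is why the induction starts at index one. -/
lemma isSolvable_closedSubalgebra {P : Set (Module.Dual ℂ 𝔥)}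
    (hP : ∀ χ ∈ P, ∀ ψ ∈ P, χ + ψ ∈ rootForms 𝔥 → χ + ψ ∈ P) (hPr : P ⊆ rootForms 𝔥)
    (hpt : Pointed P) : LieAlgebra.IsSolvable (closedSubalgebra P hP) := by
  set 𝔠 := closedSubalgebra P hP with h𝔠
  have hne : ∀ χ ∈ P, ∀ ψ ∈ P, χ + ψ ≠ 0 := fun χ hχ ψ hψ h => by
    have := hpt {χ, ψ} (by simp [hχ, hψ]) (by simpa using h)
    simp at this
  have hsub : ∀ χ, χ ∈ P → χ ∈ depthSet P 1 := fun χ hχ =>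
    ⟨hχ, {χ}, by simpa using hχ, by simp, by simp⟩
  have hstep : ∀ (k l : ℕ) (x y : 𝔤), x ∈ rootSum 𝔥 (depthSet P k) → y ∈ rootSum 𝔥 (depthSet P l) →
      ⁅x, y⁆ ∈ rootSum 𝔥 (depthSet P (k + l)) := by
    intro k l x y
    refine lie_mem_of_mem_rootSum ?_
    rintro χ ⟨hχ, s, hs, hsk, hsχ⟩ x hx ψ ⟨hψ, t, ht, htl, htψ⟩ y hy
    refine lie_mem_rootSum_of_closed hx hy (hP χ hχ ψ hψ) fun h => ?_
    refine ⟨h.resolve_left (hne χ hχ ψ hψ), s + t, fun x hx => ?_, ?_, ?_⟩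
    · exact (Multiset.mem_add.mp hx).elim (hs x) (ht x)
    · rw [Multiset.card_add]; omega
    · rw [Multiset.sum_add, hsχ, htψ]
  have key : ∀ k, ∀ x ∈ derivedSeries ℂ 𝔠 (k + 1), (x : 𝔤) ∈ rootSum 𝔥 (depthSet P (k + 1)) := by
    intro k
    induction k with
    | zero =>
      intro x hx
      rw [derivedSeries_def, derivedSeriesOfIdeal_succ] at hx
      change x ∈ (⁅_, _⁆ : LieSubmodule ℂ _ _).toSubmodule at hx
      rw [LieSubmodule.lieIdeal_oper_eq_linear_span'] at hx
      induction hx using Submodule.span_induction with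
      | mem x hx =>
        obtain ⟨a, -, b, -, rfl⟩ := hx
        have ha : (a : 𝔤) ∈ rootSum 𝔥 (insert 0 P) := a.2
        have hb : (b : 𝔤) ∈ rootSum 𝔥 (insert 0 P) := b.2
        rw [LieSubalgebra.coe_bracket]
        refine lie_mem_of_mem_rootSum ?_ ha hb
        rintro χ (rfl | hχ) x hx ψ hψ y hy
        · rcases hψ with rfl | hψ
          · have := trivial_lie_zero 𝔥 𝔥 ⟨x, mem_rootSpace_zero.mp hx⟩
              ⟨y, mem_rootSpace_zero.mp hy⟩
            have h0 : ⁅x, y⁆ = 0 := congrArg Subtype.val this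
            rw [h0]
            exact zero_mem _
          · refine rootSpace_le_rootSum (hsub ψ hψ) ?_
            have := lie_mem_rootSpace_add hx hy
            rwa [zero_add] at this
        · rcases hψ with rfl | hψ
          · refine rootSpace_le_rootSum (hsub χ hχ) ?_
            have := lie_mem_rootSpace_add hx hy
            rwa [add_zero] at this
          · exact lie_mem_rootSum_of_closed hx hy (hP χ hχ ψ hψ) fun h =>
              hsub _ (h.resolve_left (hne χ hχ ψ hψ))
      | zero => exact zero_mem _
      | add a b _ _ ha hb => exact add_mem ha hb
      | smul c a _ ha => exact Submodule.smul_mem _ c ha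
    | succ k ih =>
      intro x hx
      rw [derivedSeries_def, derivedSeriesOfIdeal_succ] at hx
      change x ∈ (⁅_, _⁆ : LieSubmodule ℂ _ _).toSubmodule at hx
      rw [LieSubmodule.lieIdeal_oper_eq_linear_span'] at hx
      induction hx using Submodule.span_induction with
      | mem x hx =>
        obtain ⟨a, ha, b, hb, rfl⟩ := hx
        refine rootSum_mono ?_ (hstep (k + 1) (k + 1) a b (ih a ha) (ih b hb))
        rintro χ ⟨h1, s, h2, h3, h4⟩
        exact ⟨h1, s, h2, by omega, h4⟩
      | zero => exact zero_mem _
      | add a b _ _ ha hb => exact add_mem ha hb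
      | smul c a _ ha => exact Submodule.smul_mem _ c ha
  obtain ⟨N, hN⟩ := hpt.exists_card_lt (finite_rootForms.subset hPr)
  refine (LieAlgebra.isSolvable_iff ℂ 𝔠).mpr ⟨N + 1, ?_⟩
  rw [eq_bot_iff]
  intro x hx
  have h1 := key N x hx
  have h2 : depthSet P (N + 1) = ∅ := by
    rw [Set.eq_empty_iff_forall_notMem]
    rintro χ ⟨h1, s, h2, h3, h4⟩
    have := hN s h2 (h4 ▸ h1)
    omega
  rw [h2] at h1
  have h3 : (x : 𝔤) = 0 := by simpa [rootSum] using h1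
  exact (LieSubmodule.mem_bot _).mpr (Subtype.ext h3)

variable {𝔟 𝔟' : LieSubalgebra ℂ 𝔤}

/-- The roots of 𝔟 stay pointed after adding β or -β. Closing up under sums that are roots yields a
solvable subalgebra containing 𝔟, and maximality puts the new root into 𝔟. -/
lemma mem_rootsOf_or_neg_mem_rootsOf (h𝔟 : IsBorel 𝔟) (h𝔥𝔟 : 𝔥 ≤ 𝔟) {β : Module.Dual ℂ 𝔥}
    (hβ : β ∈ rootForms 𝔥) : β ∈ rootsOf 𝔟 ∨ -β ∈ rootsOf 𝔟 := by
  have hsolv : LieAlgebra.IsSolvable 𝔟 := h𝔟.1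
  have key : ∀ γ ∈ rootForms 𝔥, Pointed (insert γ (rootsOf 𝔟)) → γ ∈ rootsOf 𝔟 := by
    intro γ hγ hpt
    let P : Set (Module.Dual ℂ 𝔥) := {x | x ∈ rootForms 𝔥 ∧ x ≠ 0 ∧ ∃ s : Multiset _,
      (∀ y ∈ s, y ∈ insert γ (rootsOf 𝔟)) ∧ s.sum = x}
    have hP : ∀ χ ∈ P, ∀ ψ ∈ P, χ + ψ ∈ rootForms 𝔥 → χ + ψ ∈ P := by
      rintro χ ⟨-, -, s, hs, rfl⟩ ψ ⟨-, -, t, ht, rfl⟩ h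
      exact ⟨h, h.1, s + t, fun x hx => (Multiset.mem_add.mp hx).elim (hs x) (ht x),
        Multiset.sum_add _ _⟩
    have hP' : ∀ χ ∈ rootForms 𝔥, χ ∈ insert γ (rootsOf 𝔟) → χ ∈ P := fun χ h h' =>
      ⟨h, h.1, {χ}, by simpa using h', by simp⟩
    have hPpt : Pointed P := hpt.sums.mono fun x hx => hx.2
    have hle : 𝔟 ≤ closedSubalgebra P hP := by
      intro x hx
      have hx' : x ∈ 𝔟.toSubmodule := hx
      rw [toSubmodule_eq_rootSum h𝔥𝔟] at hx'
      refine rootSum_mono (B := insert 0 P) ?_ hx'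
      exact Set.insert_subset_insert fun χ hχ => hP' χ hχ.1 (Or.inr hχ)
    have hle' := h𝔟.2 (isSolvable_closedSubalgebra hP (fun x hx => hx.1) hPpt) hle
    refine ⟨hγ, fun x hx => hle' ?_⟩
    exact rootSpace_le_rootSum (A := insert 0 P) (Or.inr (hP' γ hγ (Or.inl rfl))) hx
  have hβ' : -β ∈ rootForms 𝔥 := by
    refine ⟨neg_ne_zero.mpr hβ.1, ?_⟩
    exact (-(⟨β, hβ.2⟩ : Weight ℂ 𝔥 𝔤)).2
  rcases (pointed_rootsOf (𝔥 := 𝔥) (𝔠 := 𝔟)).insert_or_insert_neg (β := β) (fun k hk => by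
    rw [← Nat.cast_smul_eq_nsmul ℂ, smul_eq_zero] at hk
    exact_mod_cast hk.resolve_right hβ.1) with h | h
  · exact Or.inl (key β hβ h)
  · exact Or.inr (key (-β) hβ' h)

/-- Brackets of root vectors never fall into 𝔥, because opposite roots do not both occur in 𝔟.
Conversely a root vector x is [H, x]/χ(H) for any H with χ(H) ≠ 0. -/
lemma commutant_eq_rootSum (h𝔟 : IsBorel 𝔟) (h𝔥𝔟 : 𝔥 ≤ 𝔟) :
    commutant 𝔟 = rootSum 𝔥 (rootsOf 𝔟) := by
  have hsolv : LieAlgebra.IsSolvable 𝔟 := h𝔟.1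
  apply le_antisymm
  · rw [commutant, Submodule.span_le]
    rintro _ ⟨x, hx, y, hy, rfl⟩
    have hx' : x ∈ 𝔟.toSubmodule := hx
    have hy' : y ∈ 𝔟.toSubmodule := hy
    rw [toSubmodule_eq_rootSum h𝔥𝔟] at hx' hy'
    refine lie_mem_of_mem_rootSum ?_ hx' hy'
    rintro χ (rfl | hχ) x hx ψ hψ y hy
    · rcases hψ with rfl | hψ
      · have := trivial_lie_zero 𝔥 𝔥 ⟨x, mem_rootSpace_zero.mp hx⟩
          ⟨y, mem_rootSpace_zero.mp hy⟩
        have h0 : ⁅x, y⁆ = 0 := congrArg Subtype.val this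
        rw [h0]
        exact zero_mem _
      · refine rootSpace_le_rootSum hψ ?_
        have := lie_mem_rootSpace_add hx hy
        rwa [zero_add] at this
    · rcases hψ with rfl | hψ
      · refine rootSpace_le_rootSum hχ ?_
        have := lie_mem_rootSpace_add hx hy
        rwa [add_zero] at this
      · by_cases h0 : ⁅x, y⁆ = 0
        · rw [h0]; exact zero_mem _
        · have h1 := lie_mem_rootSpace_add hx hy
          refine rootSpace_le_rootSum (mem_rootsOf_of_mem ?_ h1 h0
            (𝔟.lie_mem (hχ.2 hx) (hψ.2 hy))) h1
          exact fun h => neg_notMem_rootsOf hχ (by rwa [← eq_neg_of_add_eq_zero_right h])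
  · refine rootSum_le fun χ hχ x hx => ?_
    obtain ⟨H, hH⟩ : ∃ H, χ H ≠ 0 := by
      by_contra! h
      exact hχ.1.1 (LinearMap.ext h)
    have h1 : ⁅(H : 𝔤), x⁆ = χ H • x := LieAlgebra.IsKilling.lie_eq_smul_of_mem_rootSpace hx H
    have h2 : ⁅(H : 𝔤), x⁆ ∈ commutant 𝔟 := Submodule.subset_span ⟨H, h𝔥𝔟 H.2, x, hχ.2 hx, rfl⟩
    have := (commutant 𝔟).smul_mem (χ H)⁻¹ h2
    rwa [h1, smul_smul, inv_mul_cancel₀ hH, one_smul] at this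

lemma disjoint_rootSum {A B : Set (Module.Dual ℂ 𝔥)} (h : Disjoint A B) :
    Disjoint (rootSum 𝔥 A) (rootSum 𝔥 B) := by
  have h1 : iSupIndep fun χ : Module.Dual ℂ 𝔥 => (rootSpace 𝔥 (χ : 𝔥 → ℂ)).toSubmodule := by
    have := (LieSubmodule.iSupIndep_toSubmodule.mpr (LieModule.iSupIndep_genWeightSpace ℂ 𝔥 𝔤))
    exact this.comp (f := fun χ : Module.Dual ℂ 𝔥 => (χ : 𝔥 → ℂ)) DFunLike.coe_injective
  exact h1.disjoint_biSup_biSup h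

lemma disjoint_rootsOf (h𝔟' : IsOppositeBorel 𝔥 𝔟 𝔟') :
    Disjoint (rootsOf (𝔥 := 𝔥) 𝔟) (rootsOf 𝔟') := by
  rw [Set.disjoint_left]
  intro χ h1 h2
  obtain ⟨x, hx0, hx⟩ := exists_span_rootSpace h1.1
  have hx1 : x ∈ (rootSpace 𝔥 (χ : 𝔥 → ℂ)).toSubmodule := by
    rw [hx]; exact Submodule.mem_span_singleton_self x
  have hx2 : x ∈ 𝔥 := by
    rw [← h𝔟'.2]
    exact ⟨h1.2 hx1, h2.2 hx1⟩
  have h3 := disjoint_rootSum (𝔥 := 𝔥) (A := {χ}) (B := {0})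
    (Set.disjoint_singleton.mpr h1.1.1)
  have h4 : x ∈ rootSum 𝔥 {χ} := rootSpace_le_rootSum (Set.mem_singleton χ) hx1
  have h5 : x ∈ rootSum 𝔥 {0} :=
    rootSpace_le_rootSum (Set.mem_singleton 0) (mem_rootSpace_zero.mpr hx2)
  exact hx0 (Submodule.disjoint_def.mp h3 x h4 h5)

/-- Each root belongs to exactly one of 𝔟 and 𝔟': a common root vector would lie in 𝔥, and if χ
belonged to neither, then -χ would belong to both. -/
lemma isCompl_commutant (h𝔟 : IsBorel 𝔟) (h𝔥𝔟 : 𝔥 ≤ 𝔟) (h𝔟' : IsOppositeBorel 𝔥 𝔟 𝔟') :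
    IsCompl 𝔟'.toSubmodule (commutant 𝔟) := by
  have h𝔥𝔟' : 𝔥 ≤ 𝔟' := h𝔟'.2 ▸ inf_le_right
  have hs : LieAlgebra.IsSolvable 𝔟 := h𝔟.1
  rw [toSubmodule_eq_rootSum h𝔥𝔟', commutant_eq_rootSum h𝔟 h𝔥𝔟]
  constructor
  · refine disjoint_rootSum (Set.disjoint_left.mpr ?_)
    rintro χ (rfl | h1) h2
    · exact h2.1.1 rfl
    · exact Set.disjoint_left.mp (disjoint_rootsOf h𝔟') h2 h1
  · rw [codisjoint_iff, eq_top_iff, rootSum_rootForms (𝔥 := 𝔥)]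
    refine rootSum_le ?_
    rintro χ (rfl | hχ) x hx
    · exact Submodule.mem_sup_left (rootSpace_le_rootSum (Or.inl rfl) hx)
    · by_cases h1 : χ ∈ rootsOf 𝔟
      · exact Submodule.mem_sup_right (rootSpace_le_rootSum h1 hx)
      · by_cases h2 : χ ∈ rootsOf 𝔟'
        · exact Submodule.mem_sup_left (rootSpace_le_rootSum (Or.inr h2) hx)
        · exact absurd ((mem_rootsOf_or_neg_mem_rootsOf h𝔟'.1 h𝔥𝔟' hχ).resolve_left h2)
            (Set.disjoint_left.mp (disjoint_rootsOf h𝔟')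
              ((mem_rootsOf_or_neg_mem_rootsOf h𝔟 h𝔥𝔟 hχ).resolve_left h1))

lemma toSubmodule_eq_sup_commutant (h𝔟 : IsBorel 𝔟) (h𝔥𝔟 : 𝔥 ≤ 𝔟) :
    𝔟.toSubmodule = 𝔥.toSubmodule ⊔ commutant 𝔟 := by
  rw [toSubmodule_eq_rootSum h𝔥𝔟, commutant_eq_rootSum h𝔟 h𝔥𝔟]
  apply le_antisymm
  · refine rootSum_le ?_
    rintro χ (rfl | hχ) x hx
    · exact Submodule.mem_sup_left (mem_rootSpace_zero.mp hx)
    · exact Submodule.mem_sup_right (rootSpace_le_rootSum hχ hx)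
  · refine sup_le (fun x hx => rootSpace_le_rootSum (Or.inl rfl) (mem_rootSpace_zero.mpr hx))
      (rootSum_mono fun χ hχ => Or.inr hχ)

/-- A finite basis of weight vectors of a subspace, with pointed weights. -/
structure WeightBasis (𝔥 : LieSubalgebra ℂ 𝔤) (N : Submodule ℂ 𝔤) where
  I : Type u
  [finite : Finite I]
  vec : I → 𝔤
  wt : I → Module.Dual ℂ 𝔥
  linearIndependent : LinearIndependent ℂ vec
  span_eq : Submodule.span ℂ (Set.range vec) = N
  lie_vec : ∀ (H : 𝔥) i, ⁅(H : 𝔤), vec i⁆ = wt i H • vec i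
  pointed : ∀ s : Multiset I, (s.map wt).sum = 0 → s = 0

attribute [instance] WeightBasis.finite

lemma exists_weightBasis (h𝔟 : IsBorel 𝔟) (h𝔥𝔟 : 𝔥 ≤ 𝔟) :
    Nonempty (WeightBasis 𝔥 (commutant 𝔟)) := by
  have hs : LieAlgebra.IsSolvable 𝔟 := h𝔟.1
  have hfin : (rootsOf (𝔥 := 𝔥) 𝔟).Finite := finite_rootForms.subset fun χ hχ => hχ.1
  have := hfin.to_subtype
  choose x hx0 hx using fun χ : rootsOf (𝔥 := 𝔥) 𝔟 => exists_span_rootSpace χ.2.1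
  have hmem : ∀ χ : rootsOf (𝔥 := 𝔥) 𝔟, x χ ∈ rootSpace 𝔥 (χ.1 : 𝔥 → ℂ) := fun χ => by
    change x χ ∈ (rootSpace 𝔥 (χ.1 : 𝔥 → ℂ)).toSubmodule
    rw [hx]
    exact Submodule.mem_span_singleton_self _
  refine ⟨⟨rootsOf (𝔥 := 𝔥) 𝔟, x, Subtype.val, ?_, ?_, fun H χ =>
    LieAlgebra.IsKilling.lie_eq_smul_of_mem_rootSpace (hmem χ) H, fun s hs => ?_⟩⟩
  · have h1 : iSupIndep fun χ : rootsOf (𝔥 := 𝔥) 𝔟 =>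
        (rootSpace 𝔥 (χ.1 : 𝔥 → ℂ)).toSubmodule := by
      have := (LieSubmodule.iSupIndep_toSubmodule.mpr (LieModule.iSupIndep_genWeightSpace ℂ 𝔥 𝔤))
      exact this.comp (f := fun χ : rootsOf (𝔥 := 𝔥) 𝔟 => (χ.1 : 𝔥 → ℂ))
        (DFunLike.coe_injective.comp Subtype.val_injective)
    exact h1.linearIndependent _ hmem hx0
  · rw [commutant_eq_rootSum h𝔟 h𝔥𝔟, Submodule.span_range_eq_iSup, rootSum, iSup_subtype']
    exact iSup_congr fun χ => (hx χ).symm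
  · have := pointed_rootsOf (s.map Subtype.val) (by
      intro y hy
      obtain ⟨z, -, rfl⟩ := Multiset.mem_map.mp hy
      exact z.2) hs
    simpa using this

end Borel

/-! ### Triangular decompositions -/

section Triangular

variable {𝔤 : Type u} [LieRing 𝔤] [LieAlgebra ℂ 𝔤] [FiniteDimensional ℂ 𝔤]
  [LieAlgebra.IsSemisimple ℂ 𝔤]

/-- A triangular decomposition with weight bases of its nilpotent parts. -/
structure Triangular (𝔥 𝔟 𝔟' : LieSubalgebra ℂ 𝔤) where
  le : 𝔥 ≤ 𝔟
  le' : 𝔥 ≤ 𝔟'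
  pos : WeightBasis 𝔥 (commutant 𝔟)
  neg : WeightBasis 𝔥 (commutant 𝔟')
  isCompl : IsCompl 𝔟'.toSubmodule (commutant 𝔟)
  isCompl' : IsCompl 𝔟.toSubmodule (commutant 𝔟')
  sup_eq : 𝔟.toSubmodule = 𝔥.toSubmodule ⊔ commutant 𝔟
  sup_eq' : 𝔟'.toSubmodule = 𝔥.toSubmodule ⊔ commutant 𝔟'

lemma exists_triangular {𝔥 𝔟 𝔟' : LieSubalgebra ℂ 𝔤} [𝔥.IsCartanSubalgebra]
    (h𝔟 : IsBorel 𝔟) (h𝔥𝔟 : 𝔥 ≤ 𝔟) (h𝔟' : IsOppositeBorel 𝔥 𝔟 𝔟') :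
    Nonempty (Triangular 𝔥 𝔟 𝔟') := by
  have h𝔥𝔟' : 𝔥 ≤ 𝔟' := h𝔟'.2 ▸ inf_le_right
  obtain ⟨p⟩ := exists_weightBasis h𝔟 h𝔥𝔟
  obtain ⟨n⟩ := exists_weightBasis h𝔟'.1 h𝔥𝔟'
  exact ⟨⟨h𝔥𝔟, h𝔥𝔟', p, n, isCompl_commutant h𝔟 h𝔥𝔟 h𝔟',
    isCompl_commutant h𝔟'.1 h𝔥𝔟' ⟨h𝔟, by rw [inf_comm]; exact h𝔟'.2⟩,
    toSubmodule_eq_sup_commutant h𝔟 h𝔥𝔟, toSubmodule_eq_sup_commutant h𝔟'.1 h𝔥𝔟'⟩⟩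

lemma commutant_le (𝔠 : LieSubalgebra ℂ 𝔤) : commutant 𝔠 ≤ 𝔠.toSubmodule := by
  rw [commutant, Submodule.span_le]
  rintro _ ⟨x, hx, y, hy, rfl⟩
  exact 𝔠.lie_mem hx hy

/-- The derived subalgebra of a subalgebra. -/
def commutantSubalgebra (𝔠 : LieSubalgebra ℂ 𝔤) : LieSubalgebra ℂ 𝔤 :=
  { commutant 𝔠 with
    lie_mem' := fun {x y} hx hy =>
      Submodule.subset_span ⟨x, commutant_le 𝔠 hx, y, commutant_le 𝔠 hy, rfl⟩ }

/-- The homomorphism of enveloping algebras induced by the inclusion of a subalgebra. -/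
def envelopingIncl (𝔠 : LieSubalgebra ℂ 𝔤) : 𝐔 𝔠 →ₐ[ℂ] 𝐔 𝔤 :=
  let _ : LieRing (𝐔 𝔤) := LieRing.ofAssociativeRing
  UniversalEnvelopingAlgebra.lift ℂ ((ιU).comp 𝔠.incl)

@[simp] lemma envelopingIncl_ι (𝔠 : LieSubalgebra ℂ 𝔤) (x : 𝔠) :
    envelopingIncl 𝔠 (ιU x) = ιU (x : 𝔤) := by
  let _ : LieRing (𝐔 𝔤) := LieRing.ofAssociativeRing
  exact UniversalEnvelopingAlgebra.lift_ι_apply ℂ ((ιU).comp 𝔠.incl) x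

lemma envelopingIncl_word (𝔠 : LieSubalgebra ℂ 𝔤) {κ : Type*} (y : κ → 𝔠) (l : List κ) :
    envelopingIncl 𝔠 (PBW.word y l) = PBW.word (fun i => (y i : 𝔤)) l := by
  induction l with
  | nil => simp
  | cons i l ih => rw [PBW.word_cons, PBW.word_cons, map_mul, envelopingIncl_ι, ih]

section MatrixRep

attribute [local instance] LieRing.ofAssociativeRing

variable (𝔤) in
-- The adjoint representation: its kernel is the centre, which vanishes. It supplies the faithful ρ
-- required by `PBW.linearIndependent_words`.
lemma exists_injective_matrixRep :
    ∃ (n : ℕ) (ρ : 𝔤 →ₗ⁅ℂ⁆ Matrix (Fin n) (Fin n) ℂ), Function.Injective ρ := by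
  let b := Module.finBasis ℂ 𝔤
  let e : Module.End ℂ 𝔤 ≃ₐ[ℂ] Matrix _ _ ℂ := LinearMap.toMatrixAlgEquiv b
  refine ⟨Module.finrank ℂ 𝔤, (AlgHom.toLieHom (e : _ →ₐ[ℂ] _)).comp (LieAlgebra.ad ℂ 𝔤), ?_⟩
  have h : Function.Injective (LieAlgebra.ad ℂ 𝔤) := by
    have h1 : (LieAlgebra.ad ℂ 𝔤).ker = ⊥ := by
      rw [LieAlgebra.ad_ker_eq_self_module_ker, LieAlgebra.self_module_ker_eq_center,
        LieAlgebra.center_eq_bot]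
    exact (LieHom.ker_eq_bot _).mp h1
  exact e.injective.comp h

end MatrixRep

/-- The words attached to pairs of multisets. -/
def pairWord {A B : Type*} (p : Multiset A × Multiset B) : List (A ⊕ B) :=
  p.1.toList.map Sum.inl ++ p.2.toList.map Sum.inr

/-- A multiset of letters of two kinds is a pair of multisets. Injectivity feeds
`PBW.linearIndependent_words` and surjectivity feeds `PBW.span_words`. -/
lemma pairWord_bijective {A B : Type*} :
    Function.Bijective fun p : Multiset A × Multiset B => (pairWord p : Multiset (A ⊕ B)) := by
  have h : ∀ p : Multiset A × Multiset B,
      (pairWord p : Multiset (A ⊕ B)) = p.1.map Sum.inl + p.2.map Sum.inr := fun p => by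
    rw [pairWord, ← Multiset.coe_add, ← Multiset.map_coe, ← Multiset.map_coe,
      Multiset.coe_toList, Multiset.coe_toList]
  constructor
  · rintro ⟨a, b⟩ ⟨c, d⟩ hp
    simp only [h] at hp
    have h1 := congrArg (Multiset.filterMap Sum.getLeft?) hp
    have h2 := congrArg (Multiset.filterMap Sum.getRight?) hp
    simp only [Multiset.filterMap_add, Multiset.filterMap_map] at h1 h2
    have e1 : (Sum.getLeft? ∘ (Sum.inl : A → A ⊕ B)) = some := rfl
    have e2 : (Sum.getLeft? ∘ (Sum.inr : B → A ⊕ B)) = fun _ => none := rfl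
    have e3 : (Sum.getRight? ∘ (Sum.inl : A → A ⊕ B)) = fun _ => none := rfl
    have e4 : (Sum.getRight? ∘ (Sum.inr : B → A ⊕ B)) = some := rfl
    have e5 : ∀ s : Multiset B, s.filterMap (fun _ => (none : Option A)) = 0 :=
      fun s => Multiset.eq_zero_of_forall_notMem (by simp [Multiset.mem_filterMap])
    have e6 : ∀ s : Multiset A, s.filterMap (fun _ => (none : Option B)) = 0 :=
      fun s => Multiset.eq_zero_of_forall_notMem (by simp [Multiset.mem_filterMap])
    simp only [e1, e2, e3, e4, e5, e6, Multiset.filterMap_some, add_zero, zero_add] at h1 h2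
    rw [h1, h2]
  · intro s
    simp only [h]
    induction s using Multiset.induction_on with
    | empty => exact ⟨(0, 0), by simp⟩
    | cons x s ih =>
      obtain ⟨⟨a, b⟩, rfl⟩ := ih
      rcases x with x | x
      · exact ⟨(x ::ₘ a, b), by simp⟩
      · exact ⟨(a, x ::ₘ b), by simp⟩

lemma word_pairWord {A B : Type*} (y : A → 𝔤) (z : B → 𝔤) (p : Multiset A × Multiset B) :
    PBW.word (K := ℂ) (Sum.elim y z) (pairWord p) =
      PBW.word y p.1.toList * PBW.word z p.2.toList := by
  rw [pairWord, PBW.word_append]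
  simp [PBW.word, List.map_map, Function.comp_def]

namespace Triangular

variable {𝔥 𝔟 𝔟' : LieSubalgebra ℂ 𝔤} (D : Triangular 𝔥 𝔟 𝔟')

lemma lie_word {N : Submodule ℂ 𝔤} (B : WeightBasis 𝔥 N) (H : 𝔥) (l : List B.I) :
    ιU (H : 𝔤) * PBW.word B.vec l = PBW.word B.vec l * ιU (H : 𝔤) +
      (l.map B.wt).sum H • PBW.word B.vec l := by
  induction l with
  | nil => simp
  | cons i l ih =>
    have h := enveloping_lie (H : 𝔤) (B.vec i)
    rw [B.lie_vec, map_smul, eq_sub_iff_add_eq] at h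
    rw [PBW.word_cons, ← mul_assoc, ← h, add_mul, mul_assoc, ih, List.map_cons, List.sum_cons,
      LinearMap.add_apply, add_smul, mul_add, smul_mul_assoc, mul_smul_comm, mul_assoc]
    abel

/-- The monomial attached to a multiset of positive root vectors. -/
def mon (t : Multiset D.pos.I) : 𝐔 𝔤 := PBW.word D.pos.vec t.toList

@[simp] lemma mon_zero : D.mon 0 = 1 := by simp [mon]

/-- The weight of a monomial. -/
def monWt (t : Multiset D.pos.I) : Module.Dual ℂ 𝔥 := (t.map D.pos.wt).sum

lemma ι_mul_mon (H : 𝔥) (t : Multiset D.pos.I) :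
    ιU (H : 𝔤) * D.mon t = D.mon t * ιU (H : 𝔤) + D.monWt t H • D.mon t := by
  rw [mon, lie_word, monWt, ← Multiset.sum_coe, ← Multiset.map_coe, Multiset.coe_toList]

/-- Finiteness of Kostant's partition function; it underlies every finiteness statement on weight
spaces below. -/
lemma finite_monWt (χ : Module.Dual ℂ 𝔥) : {t | D.monWt t = χ}.Finite :=
  finite_setOf_sum_eq D.pos.pointed χ

/-- Products of words in a subspace and a complementary weight basis. -/
lemma exists_basis : ∃ (n : ℕ) (y : Fin n → 𝔟'),
    Submodule.span ℂ (Set.range y) = ⊤ ∧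
      ∃ b : Module.Basis (Multiset (Fin n) × Multiset D.pos.I) ℂ (𝐔 𝔤),
      ∀ p, b p = envelopingIncl 𝔟' (PBW.word y p.1.toList) * D.mon p.2 := by
  classical
  let y := Module.finBasis ℂ 𝔟'
  refine ⟨_, y, y.span_eq, ?_⟩
  obtain ⟨n, ρ, hρ⟩ := exists_injective_matrixRep 𝔤
  let z : Fin (Module.finrank ℂ 𝔟') ⊕ D.pos.I → 𝔤 := Sum.elim (fun i => (y i : 𝔤)) D.pos.vec
  have hy : LinearIndependent ℂ fun i => (y i : 𝔤) :=
    y.linearIndependent.map' 𝔟'.toSubmodule.subtype (Submodule.ker_subtype _)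
  have hys : Submodule.span ℂ (Set.range fun i => (y i : 𝔤)) = 𝔟'.toSubmodule := by
    have h1 := congrArg (Submodule.map 𝔟'.toSubmodule.subtype) y.span_eq
    rw [Submodule.map_span, ← Set.range_comp] at h1
    refine h1.trans ?_
    rw [Submodule.map_top, Submodule.range_subtype]
  have hz : LinearIndependent ℂ z := by
    refine LinearIndependent.sum_type hy D.pos.linearIndependent ?_
    rw [hys, D.pos.span_eq]
    exact D.isCompl.disjoint
  have hzs : Submodule.span ℂ (Set.range z) = ⊤ := by
    rw [Set.Sum.elim_range, Submodule.span_union, hys, D.pos.span_eq]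
    exact D.isCompl.sup_eq_top
  have h1 : LinearIndependent ℂ fun p => PBW.word (K := ℂ) z (pairWord p) :=
    PBW.linearIndependent_words ρ hρ hz pairWord pairWord_bijective.1
  have h2 := PBW.span_words (K := ℂ) hzs pairWord pairWord_bijective.2
  refine ⟨Module.Basis.mk h1 h2.ge, fun p => ?_⟩
  rw [Module.Basis.mk_apply, envelopingIncl_word]
  exact word_pairWord _ _ p

lemma span_mul_mon : Submodule.span ℂ {a : 𝐔 𝔤 | ∃ (c : 𝐔 𝔟') (t : Multiset D.pos.I),
    a = envelopingIncl 𝔟' c * D.mon t} = ⊤ := by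
  obtain ⟨n, y, -, b, hb⟩ := D.exists_basis
  rw [eq_top_iff, ← b.span_eq]
  refine Submodule.span_mono ?_
  rintro _ ⟨p, rfl⟩
  exact ⟨_, _, hb p⟩

/-- `𝐔 𝔤` is free over `𝐔 𝔟'` with basis the monomials in the positive root vectors. -/
theorem exists_linearMap {W : Type*} [AddCommGroup W] [Module ℂ W] (σ : 𝐔 𝔟' →ₐ[ℂ] Module.End ℂ W)
    (c : Multiset D.pos.I → W) :
    ∃ f : 𝐔 𝔤 →ₗ[ℂ] W, ∀ a t, f (envelopingIncl 𝔟' a * D.mon t) = σ a (c t) := by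
  obtain ⟨n, y, hy, b, hb⟩ := D.exists_basis
  -- The map is prescribed on the basis; ordered words span 𝐔 𝔟', so the formula extends by
  -- linearity to every `a`.
  refine ⟨b.constr ℂ fun p => σ (PBW.word y p.1.toList) (c p.2), fun a t => ?_⟩
  have h1 := PBW.span_words (K := ℂ) hy Multiset.toList (fun s => ⟨s, by simp⟩)
  have ha : a ∈ Submodule.span ℂ (Set.range fun s : Multiset (Fin n) =>
    PBW.word (K := ℂ) y s.toList) := h1 ▸ Submodule.mem_top
  induction ha using Submodule.span_induction with
  | mem a h =>
    obtain ⟨s, rfl⟩ := h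
    have := hb (s, t)
    simp only at this ⊢
    rw [← this, b.constr_basis]
  | zero => simp
  | add a b _ _ ha hb => simp only [map_add, add_mul, ha, hb, LinearMap.add_apply]
  | smul c a _ ha => simp only [map_smul, smul_mul_assoc, ha, LinearMap.smul_apply]

lemma map_mul_of_exists {W : Type*} [AddCommGroup W] [Module ℂ W]
    {σ : 𝐔 𝔟' →ₐ[ℂ] Module.End ℂ W} {c : Multiset D.pos.I → W} {f : 𝐔 𝔤 →ₗ[ℂ] W}
    (hf : ∀ a t, f (envelopingIncl 𝔟' a * D.mon t) = σ a (c t)) (a : 𝐔 𝔟') (u : 𝐔 𝔤) :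
    f (envelopingIncl 𝔟' a * u) = σ a (f u) := by
  have hu : u ∈ Submodule.span ℂ {a : 𝐔 𝔤 | ∃ (c : 𝐔 𝔟') (t : Multiset D.pos.I),
    a = envelopingIncl 𝔟' c * D.mon t} := D.span_mul_mon ▸ Submodule.mem_top
  induction hu using Submodule.span_induction with
  | mem u h =>
    obtain ⟨b, t, rfl⟩ := h
    rw [← mul_assoc, ← map_mul, hf, hf, map_mul]
    rfl
  | zero => simp
  | add a b _ _ ha hb => simp only [map_add, mul_add, ha, hb]
  | smul c a _ ha => simp only [map_smul, mul_smul_comm, ha]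

/-- Right multiplication by elements of the nilradical preserves the augmentation ideal. -/
lemma mon_mul_mem {X : 𝔤} (hX : X ∈ commutant 𝔟) (t : Multiset D.pos.I) :
    D.mon t * ιU X ∈ Submodule.span ℂ {a | ∃ s, s ≠ 0 ∧ a = D.mon s} := by
  let 𝔫 := commutantSubalgebra 𝔟
  have hvec : ∀ i, D.pos.vec i ∈ 𝔫 := fun i => by
    have : D.pos.vec i ∈ commutant 𝔟 := D.pos.span_eq.le (Submodule.subset_span ⟨i, rfl⟩)
    exact this
  let y : D.pos.I → 𝔫 := fun i => ⟨D.pos.vec i, hvec i⟩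
  have hy : Submodule.span ℂ (Set.range y) = ⊤ := by
    have h1 : (Submodule.span ℂ (Set.range y)).map 𝔫.toSubmodule.subtype = 𝔫.toSubmodule := by
      rw [Submodule.map_span, ← Set.range_comp]
      exact D.pos.span_eq
    rw [eq_top_iff]
    rintro ⟨x, hx⟩ -
    have hx' : x ∈ 𝔫.toSubmodule := hx
    rw [← h1] at hx'
    obtain ⟨z, hz, rfl⟩ := hx'
    exact hz
  let _ : LieRing ℂ := LieRing.ofAssociativeRing
  let ε : 𝐔 𝔫 →ₐ[ℂ] ℂ := UniversalEnvelopingAlgebra.lift ℂ (0 : 𝔫 →ₗ⁅ℂ⁆ ℂ)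
  have hε : ∀ x, ε (ιU x) = 0 := fun x => UniversalEnvelopingAlgebra.lift_ι_apply ℂ _ x
  have h1 := PBW.span_words (K := ℂ) hy Multiset.toList (fun s => ⟨s, by simp⟩)
  -- Expand the product in ordered words inside 𝐔 𝔫. The augmentation kills the product and every
  -- nonempty word, so the constant term is zero.
  have h2 : PBW.word y t.toList * ιU ⟨X, hX⟩ ∈ Submodule.span ℂ (insert (1 : 𝐔 𝔫)
      {a | ∃ s : Multiset D.pos.I, s ≠ 0 ∧ a = PBW.word y s.toList}) := by
    refine Submodule.span_mono ?_ (h1.ge Submodule.mem_top)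
    rintro _ ⟨s, rfl⟩
    by_cases hs : s = 0
    · left; simp [hs]
    · right; exact ⟨s, hs, rfl⟩
  obtain ⟨c, r, hr, hcr⟩ := Submodule.mem_span_insert.mp h2
  have h3 : ε r = 0 := by
    refine (Submodule.span_le (p := LinearMap.ker ε.toLinearMap)).mpr ?_ hr
    rintro _ ⟨s, hs, rfl⟩
    have : s.toList ≠ [] := by simpa using hs
    obtain ⟨i, l, hil⟩ := List.exists_cons_of_ne_nil this
    rw [SetLike.mem_coe, LinearMap.mem_ker, AlgHom.toLinearMap_apply, hil, PBW.word_cons, map_mul,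
      hε, zero_mul]
  have h4 : c = 0 := by
    have := congrArg ε hcr
    rw [map_mul, hε, mul_zero, map_add, h3, add_zero, map_smul, map_one, smul_eq_mul, mul_one]
      at this
    exact this.symm
  rw [h4, zero_smul, zero_add] at hcr
  have h5 := congrArg (envelopingIncl 𝔫) hcr
  rw [map_mul, envelopingIncl_ι, envelopingIncl_word] at h5
  change D.mon t * ιU X = _ at h5
  rw [h5]
  have h6 := Submodule.mem_map_of_mem (f := (envelopingIncl 𝔫).toLinearMap) hr
  rw [Submodule.map_span] at h6
  refine Submodule.span_mono ?_ h6
  rintro _ ⟨_, ⟨s, hs, rfl⟩, rfl⟩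
  exact ⟨s, hs, envelopingIncl_word 𝔫 y _⟩

end Triangular

end Triangular

/-! ### The action of the enveloping algebra -/

namespace Bimod

attribute [local instance] complexModule complexModule_isScalarTower

variable {𝔤 : Type u} [LieRing 𝔤] [LieAlgebra ℂ 𝔤] {T : Type v} [CommRing T] [Algebra ℂ T]

lemma act_complex_smul (M : Bimod.{u, v, w} 𝔤 T) (c : ℂ) (x : 𝔤) (m : M.carrier) :
    M.act (c • x) m = algebraMap ℂ T c • M.act x m := by
  rw [LinearMap.map_smulₛₗ, LinearMap.smul_apply]

/-- The action of the enveloping algebra on a bimodule. -/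
def uact (M : Bimod.{u, v, w} 𝔤 T) : 𝐔 𝔤 →ₐ[ℂ] Module.End T M.carrier :=
  let _ : LieRing (Module.End T M.carrier) := LieRing.ofAssociativeRing
  UniversalEnvelopingAlgebra.lift ℂ
    { toFun := M.act
      map_add' := map_add _
      map_smul' := fun c x => by
        refine LinearMap.ext fun m => ?_
        exact M.act_complex_smul c x m
      map_lie' := fun {x y} => M.act_lie x y }

@[simp] lemma uact_ι (M : Bimod.{u, v, w} 𝔤 T) (x : 𝔤) : M.uact (ιU x) = M.act x := by
  let _ : LieRing (Module.End T M.carrier) := LieRing.ofAssociativeRing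
  exact UniversalEnvelopingAlgebra.lift_ι_apply ℂ _ x

lemma uact_mul (M : Bimod.{u, v, w} 𝔤 T) (a b : 𝐔 𝔤) (m : M.carrier) :
    M.uact (a * b) m = M.uact a (M.uact b m) := by
  rw [map_mul]; rfl

lemma uact_smul (M : Bimod.{u, v, w} 𝔤 T) (c : ℂ) (a : 𝐔 𝔤) (m : M.carrier) :
    M.uact (c • a) m = algebraMap ℂ T c • M.uact a m := by
  rw [map_smul]; rfl

end Bimod

/-- Induction principle for the enveloping algebra. -/
lemma enveloping_induction {L : Type*} [LieRing L] [LieAlgebra ℂ L] {P : 𝐔 L → Prop}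
    (hι : ∀ x, P (ιU x)) (hC : ∀ c, P (algebraMap ℂ _ c)) (hadd : ∀ a b, P a → P b → P (a + b))
    (hmul : ∀ a b, P a → P b → P (a * b)) (a : 𝐔 L) : P a := by
  let S : Subalgebra ℂ (𝐔 L) :=
    { carrier := {a | P a}
      mul_mem' := fun {a b} => hmul a b
      add_mem' := fun {a b} => hadd a b
      algebraMap_mem' := hC }
  have : a ∈ S := by rw [PBW.subalgebra_eq_top S hι]; trivial
  exact this

namespace Bimod

variable {𝔤 : Type u} [LieRing 𝔤] [LieAlgebra ℂ 𝔤] {T : Type v} [CommRing T] [Algebra ℂ T]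

lemma uact_algebraMap (M : Bimod.{u, v, w} 𝔤 T) (c : ℂ) (m : M.carrier) :
    M.uact (algebraMap ℂ _ c) m = algebraMap ℂ T c • m := by
  rw [Algebra.algebraMap_eq_smul_one, uact_smul, map_one]; rfl

lemma uact_mem (M : Bimod.{u, v, w} 𝔤 T) {P : Submodule T M.carrier}
    (hP : ∀ x, ∀ m ∈ P, M.act x m ∈ P) (a : 𝐔 𝔤) {m : M.carrier} (hm : m ∈ P) :
    M.uact a m ∈ P := by
  induction a using enveloping_induction generalizing m with
  | hι x => rw [uact_ι]; exact hP x m hm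
  | hC c => rw [uact_algebraMap]; exact P.smul_mem _ hm
  | hadd a b ha hb => rw [map_add]; exact add_mem (ha hm) (hb hm)
  | hmul a b ha hb => rw [uact_mul]; exact ha (hb hm)

lemma uact_envelopingIncl_mem [FiniteDimensional ℂ 𝔤] [LieAlgebra.IsSemisimple ℂ 𝔤]
    (M : Bimod.{u, v, w} 𝔤 T) {𝔠 : LieSubalgebra ℂ 𝔤} {P : Submodule T M.carrier}
    (hP : ∀ x ∈ 𝔠, ∀ m ∈ P, M.act x m ∈ P) (a : 𝐔 𝔠) {m : M.carrier} (hm : m ∈ P) :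
    M.uact (envelopingIncl 𝔠 a) m ∈ P := by
  induction a using enveloping_induction generalizing m with
  | hι x => rw [envelopingIncl_ι, uact_ι]; exact hP x x.2 m hm
  | hC c => rw [AlgHom.commutes, uact_algebraMap]; exact P.smul_mem _ hm
  | hadd a b ha hb => rw [map_add, map_add]; exact add_mem (ha hm) (hb hm)
  | hmul a b ha hb => rw [map_mul, uact_mul]; exact ha (hb hm)

end Bimod

/-! ### Deformed Verma modules -/

section Verma

variable {𝔤 : Type u} [LieRing 𝔤] [LieAlgebra ℂ 𝔤] [FiniteDimensional ℂ 𝔤]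
  [LieAlgebra.IsSemisimple ℂ 𝔤] {T : Type v} [CommRing T] [Algebra ℂ T]
  {𝔥 𝔟 𝔟' : LieSubalgebra ℂ 𝔤} {φ : SymmetricAlgebra ℂ 𝔥 →ₐ[ℂ] T}
  {μ : Module.Dual ℂ 𝔥}

variable (𝔟 φ μ) in
/-- The quotient map onto `Δ(μ)`. -/
def vermaMk : T ⊗[ℂ] 𝐔 𝔤 →ₗ[T] (verma 𝔟 φ μ).carrier := (vermaRel 𝔟 φ μ).mkQ

lemma vermaMk_surjective : Function.Surjective (vermaMk 𝔟 φ μ) :=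
  (vermaRel 𝔟 φ μ).mkQ_surjective

lemma vermaMk_eq_zero {z : T ⊗[ℂ] 𝐔 𝔤} : vermaMk 𝔟 φ μ z = 0 ↔ z ∈ vermaRel 𝔟 φ μ :=
  Submodule.Quotient.mk_eq_zero _

lemma vermaGen_eq : vermaGen 𝔟 φ μ = vermaMk 𝔟 φ μ (1 ⊗ₜ 1) := rfl

lemma verma_act_mk (x : 𝔤) (t : T) (a : 𝐔 𝔤) :
    (verma 𝔟 φ μ).act x (vermaMk 𝔟 φ μ (t ⊗ₜ a)) = vermaMk 𝔟 φ μ (t ⊗ₜ (ιU x * a)) := rfl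

lemma verma_uact_mk (b : 𝐔 𝔤) (t : T) (a : 𝐔 𝔤) :
    (verma 𝔟 φ μ).uact b (vermaMk 𝔟 φ μ (t ⊗ₜ a)) = vermaMk 𝔟 φ μ (t ⊗ₜ (b * a)) := by
  induction b using enveloping_induction generalizing a with
  | hι x => rw [Bimod.uact_ι, verma_act_mk]
  | hC c =>
    rw [Bimod.uact_algebraMap, ← Algebra.smul_def, TensorProduct.tmul_smul,
      ← algebraMap_smul T c (t ⊗ₜ[ℂ] a), map_smul]
  | hadd b c hb hc =>
    rw [map_add, LinearMap.add_apply, hb, hc, add_mul, TensorProduct.tmul_add, map_add]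
  | hmul b c hb hc => rw [Bimod.uact_mul, hc, hb, mul_assoc]

lemma vermaMk_tmul (t : T) (a : 𝐔 𝔤) :
    vermaMk 𝔟 φ μ (t ⊗ₜ a) = t • (verma 𝔟 φ μ).uact a (vermaGen 𝔟 φ μ) := by
  rw [vermaGen_eq, verma_uact_mk, mul_one, ← map_smul, TensorProduct.smul_tmul', smul_eq_mul,
    mul_one]

lemma verma_act_gen (H : 𝔥) {X : 𝔤} (hX : X ∈ commutant 𝔟) :
    (verma 𝔟 φ μ).act ((H : 𝔤) + X) (vermaGen 𝔟 φ μ) =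
      weightScalar φ μ H • vermaGen 𝔟 φ μ := by
  rw [vermaGen_eq, verma_act_mk, ← map_smul, ← sub_eq_zero, ← map_sub, vermaMk_eq_zero]
  refine Submodule.subset_span ⟨1, 1, H, X, hX, ?_⟩
  rw [TensorProduct.smul_tmul', smul_eq_mul, mul_one, one_mul]

lemma verma_act_cartan_gen (H : 𝔥) :
    (verma 𝔟 φ μ).act (H : 𝔤) (vermaGen 𝔟 φ μ) = weightScalar φ μ H • vermaGen 𝔟 φ μ := by
  have := verma_act_gen (𝔟 := 𝔟) (φ := φ) (μ := μ) H (zero_mem _)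
  rwa [add_zero] at this

lemma weightScalar_zero : weightScalar φ μ (0 : 𝔥) = 0 := by simp [weightScalar]

lemma verma_act_commutant_gen {X : 𝔤} (hX : X ∈ commutant 𝔟) :
    (verma 𝔟 φ μ).act X (vermaGen 𝔟 φ μ) = 0 := by
  have := verma_act_gen (φ := φ) (μ := μ) (0 : 𝔥) hX
  rwa [ZeroMemClass.coe_zero, zero_add, weightScalar_zero, zero_smul] at this

/-- `Δ(μ)` is generated by its highest weight vector. -/
lemma verma_induction_full {P : Submodule T (verma 𝔟 φ μ).carrier} (hv : vermaGen 𝔟 φ μ ∈ P)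
    (hP : ∀ (y : 𝔤), ∀ m ∈ P, (verma 𝔟 φ μ).act y m ∈ P) : P = ⊤ := by
  refine Submodule.eq_top_iff'.mpr fun m => ?_
  obtain ⟨z, rfl⟩ := vermaMk_surjective m
  induction z with
  | zero => rw [map_zero]; exact zero_mem _
  | add x y hx hy => rw [map_add]; exact add_mem hx hy
  | tmul t a =>
    rw [vermaMk_tmul]
    exact P.smul_mem _ (Bimod.uact_mem _ hP a hv)

lemma uact_word_gen (B : WeightBasis 𝔥 (commutant 𝔟)) (l : List B.I) (hl : l ≠ []) :
    (verma 𝔟 φ μ).uact (PBW.word B.vec l) (vermaGen 𝔟 φ μ) = 0 := by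
  induction l with
  | nil => exact absurd rfl hl
  | cons i l ih =>
    rw [PBW.word_cons, Bimod.uact_mul]
    by_cases h : l = []
    · have hi : B.vec i ∈ commutant 𝔟 := B.span_eq.le (Submodule.subset_span ⟨i, rfl⟩)
      rw [h, PBW.word_nil, map_one, Module.End.one_apply, Bimod.uact_ι,
        verma_act_commutant_gen hi]
    · rw [ih h, map_zero]

/-- `Δ(μ)` is generated by its highest weight vector under the opposite Borel subalgebra. -/
lemma verma_induction (D : Triangular 𝔥 𝔟 𝔟') {P : Submodule T (verma 𝔟 φ μ).carrier}
    (hv : vermaGen 𝔟 φ μ ∈ P)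
    (hP : ∀ y ∈ 𝔟', ∀ m ∈ P, (verma 𝔟 φ μ).act y m ∈ P) : P = ⊤ := by
  refine Submodule.eq_top_iff'.mpr fun m => ?_
  obtain ⟨z, rfl⟩ := vermaMk_surjective m
  induction z with
  | zero => rw [map_zero]; exact zero_mem _
  | add x y hx hy => rw [map_add]; exact add_mem hx hy
  | tmul t a =>
    rw [vermaMk_tmul]
    refine P.smul_mem _ ?_
    -- Write 𝐔 𝔤 as 𝐔 𝔟' times positive monomials: the nontrivial monomials kill the generator, and
    -- only 𝐔 𝔟' is left to act.
    have ha : a ∈ Submodule.span ℂ {a : 𝐔 𝔤 | ∃ (c : 𝐔 𝔟') (t : Multiset D.pos.I),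
      a = envelopingIncl 𝔟' c * D.mon t} := D.span_mul_mon ▸ Submodule.mem_top
    induction ha using Submodule.span_induction with
    | mem a h =>
      obtain ⟨c, s, rfl⟩ := h
      rw [Bimod.uact_mul]
      refine Bimod.uact_envelopingIncl_mem _ hP c ?_
      by_cases hs : s = 0
      · rw [hs, D.mon_zero, map_one]; exact hv
      · rw [Triangular.mon, uact_word_gen _ _ (by simpa using hs)]
        exact zero_mem _
    | zero => rw [map_zero]; exact zero_mem _
    | add a b _ _ ha hb => rw [map_add]; exact add_mem ha hb
    | smul c a _ ha => rw [Bimod.uact_smul]; exact P.smul_mem _ ha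

section

attribute [local instance] Bimod.complexModule Bimod.complexModule_isScalarTower

/-- As a module over the opposite Borel subalgebra, `Δ(μ)` is induced from the Cartan
subalgebra. -/
theorem exists_vermaMap (D : Triangular 𝔥 𝔟 𝔟') (W : Bimod.{u, v, w} 𝔟' T) (m : W.carrier)
    (hm : ∀ H : 𝔥, W.act ⟨H, D.le' H.2⟩ m = weightScalar φ μ H • m) :
    ∃ g : (verma 𝔟 φ μ).carrier →ₗ[T] W.carrier, g (vermaGen 𝔟 φ μ) = m ∧
      ∀ (y : 𝔟') n, g ((verma 𝔟 φ μ).act y n) = W.act y (g n) := by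
  classical
  let r : Module.End T W.carrier →ₐ[ℂ] Module.End ℂ W.carrier :=
    { toFun := fun f => f.restrictScalars ℂ
      map_one' := rfl
      map_mul' := fun f g => rfl
      map_zero' := rfl
      map_add' := fun f g => rfl
      commutes' := fun c => rfl }
  -- On the free 𝐔 𝔟'-module 𝐔 𝔤, send the trivial monomial to `m` and all others to zero. The work
  -- is to check that this respects the relations of Δ(μ).
  obtain ⟨f, hf⟩ := D.exists_linearMap (r.comp W.uact) (fun t => if t = 0 then m else 0)
  have hf' : ∀ a u, f (envelopingIncl 𝔟' a * u) = W.uact a (f u) := D.map_mul_of_exists hf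
  replace hf : ∀ a t, f (envelopingIncl 𝔟' a * D.mon t) = W.uact a (if t = 0 then m else 0) := hf
  have hf0 : ∀ a t, t ≠ 0 → f (envelopingIncl 𝔟' a * D.mon t) = 0 := fun a t ht => by
    rw [hf, if_neg ht, map_zero]
  have key : ∀ a (H : 𝔥), ∀ X ∈ commutant 𝔟, f (a * ιU ((H : 𝔤) + X)) =
      weightScalar φ μ H • f a := by
    intro a H X hX
    have ha : a ∈ Submodule.span ℂ {a : 𝐔 𝔤 | ∃ (c : 𝐔 𝔟') (t : Multiset D.pos.I),
      a = envelopingIncl 𝔟' c * D.mon t} := D.span_mul_mon ▸ Submodule.mem_top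
    induction ha using Submodule.span_induction with
    | mem a h =>
      obtain ⟨c, s, rfl⟩ := h
      have h1 : f (envelopingIncl 𝔟' c * D.mon s * ιU X) = 0 := by
        rw [mul_assoc]
        have h2 := D.mon_mul_mem hX s
        generalize D.mon s * ιU X = z at h2
        induction h2 using Submodule.span_induction with
        | mem z h => obtain ⟨t, ht, rfl⟩ := h; exact hf0 c t ht
        | zero => rw [mul_zero, map_zero]
        | add a b _ _ ha hb => rw [mul_add, map_add, ha, hb, add_zero]
        | smul c a _ ha => rw [mul_smul_comm, map_smul, ha, smul_zero]
      have h2 : envelopingIncl 𝔟' c * D.mon s * ιU (H : 𝔤) =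
          envelopingIncl 𝔟' (c * ιU ⟨H, D.le' H.2⟩) * D.mon s -
            D.monWt s H • (envelopingIncl 𝔟' c * D.mon s) := by
        rw [map_mul, envelopingIncl_ι, mul_assoc, mul_assoc, D.ι_mul_mon, mul_add, mul_smul_comm]
        abel
      rw [map_add, mul_add, map_add, h1, add_zero, h2, map_sub, map_smul]
      by_cases hs : s = 0
      · rw [hf, hf, if_pos hs, Bimod.uact_mul, Bimod.uact_ι, hm, hs]
        simp [Triangular.monWt]
      · rw [hf0 _ _ hs, hf0 _ _ hs, smul_zero, smul_zero, sub_zero]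
    | zero => rw [zero_mul, map_zero, smul_zero]
    | add a b _ _ ha hb => rw [add_mul, map_add, ha, hb, map_add, smul_add]
    | smul c a _ ha => rw [smul_mul_assoc, map_smul, ha, map_smul, smul_comm]
  let G : T ⊗[ℂ] 𝐔 𝔤 →ₗ[T] W.carrier := LinearMap.liftBaseChange T f
  have hG : ∀ t a, G (t ⊗ₜ a) = t • f a := fun t a => LinearMap.liftBaseChange_tmul T f t a
  have hle : vermaRel 𝔟 φ μ ≤ LinearMap.ker G := by
    rw [vermaRel, Submodule.span_le]
    rintro _ ⟨t, a, H, X, hX, rfl⟩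
    rw [SetLike.mem_coe, LinearMap.mem_ker, map_sub, hG, hG, key a H X hX, smul_smul, mul_comm,
      sub_self]
  let g : (verma 𝔟 φ μ).carrier →ₗ[T] W.carrier := (vermaRel 𝔟 φ μ).liftQ G hle
  have hg : ∀ t a, g (vermaMk 𝔟 φ μ (t ⊗ₜ a)) = t • f a := fun t a => hG t a
  refine ⟨g, ?_, fun y n => ?_⟩
  · rw [vermaGen_eq, hg, one_smul]
    have := hf 1 0
    rw [map_one, map_one, D.mon_zero, one_mul, if_pos rfl] at this
    exact this
  · obtain ⟨z, rfl⟩ := vermaMk_surjective n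
    induction z with
    | zero => simp only [map_zero]
    | add a b ha hb => simp only [map_add, ha, hb]
    | tmul t a =>
      rw [verma_act_mk, hg, hg, map_smul]
      congr 1
      have := hf' (ιU y) a
      rwa [envelopingIncl_ι, Bimod.uact_ι] at this

end

end Verma

section Nabla

variable {𝔤 : Type u} [LieRing 𝔤] [LieAlgebra ℂ 𝔤] [FiniteDimensional ℂ 𝔤]
  [LieAlgebra.IsSemisimple ℂ 𝔤] {T : Type v} [CommRing T] [Algebra ℂ T]
  {𝔥 𝔟 𝔟' : LieSubalgebra ℂ 𝔤} {φ : SymmetricAlgebra ℂ 𝔥 →ₐ[ℂ] T}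
  {μ : Module.Dual ℂ 𝔥}

/-! ### The character of the opposite Borel subalgebra -/

variable (φ μ) in
/-- The scalars `μ(H) + φ(H)` as a linear map. -/
def weightScalarₗ : 𝔥 →ₗ[ℂ] T :=
  Algebra.linearMap ℂ T ∘ₗ μ + φ.toLinearMap ∘ₗ SymmetricAlgebra.ι ℂ 𝔥

lemma weightScalar_sub (ν : Module.Dual ℂ 𝔥) (H : 𝔥) :
    weightScalar φ μ H - weightScalar φ ν H = algebraMap ℂ T ((μ - ν) H) := by
  simp [weightScalar]

/-- The projection of 𝔤 onto 𝔟 along the commutant of 𝔟' sends H + X to H. Following it by any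
extension of the scalars μ + φ from 𝔥 to 𝔤 gives the character. -/
lemma Triangular.exists_char (D : Triangular 𝔥 𝔟 𝔟') (φ : SymmetricAlgebra ℂ 𝔥 →ₐ[ℂ] T)
    (μ : Module.Dual ℂ 𝔥) : ∃ χ : 𝔟' →ₗ[ℂ] T, ∀ (y : 𝔟') (H : 𝔥), ∀ X ∈ commutant 𝔟',
      (y : 𝔤) = H + X → χ y = weightScalar φ μ H := by
  obtain ⟨g, hg⟩ := LinearMap.exists_extend (p := 𝔥.toSubmodule) (weightScalarₗ φ μ)
  refine ⟨g ∘ₗ 𝔟.toSubmodule.subtype ∘ₗ Submodule.projectionOnto _ _ D.isCompl' ∘ₗ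
    𝔟'.toSubmodule.subtype, fun y H X hX hy => ?_⟩
  have h1 : Submodule.projectionOnto _ _ D.isCompl' (y : 𝔤) = ⟨H, D.le H.2⟩ := by
    rw [hy, map_add, Submodule.projectionOnto_apply_of_mem_right _ hX, add_zero]
    exact Submodule.projectionOnto_apply_left _ (⟨H, D.le H.2⟩ : 𝔟.toSubmodule)
  change g ((Submodule.projectionOnto _ _ D.isCompl' (y : 𝔤) : 𝔟.toSubmodule) : 𝔤) = _
  rw [h1]
  exact LinearMap.congr_fun hg H

lemma Triangular.exists_add (D : Triangular 𝔥 𝔟 𝔟') {y : 𝔤} (hy : y ∈ 𝔟') :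
    ∃ H : 𝔥, ∃ X ∈ commutant 𝔟', y = H + X := by
  have hy' : y ∈ 𝔟'.toSubmodule := hy
  rw [D.sup_eq'] at hy'
  obtain ⟨H, hH, X, hX, rfl⟩ := Submodule.mem_sup.mp hy'
  exact ⟨⟨H, hH⟩, X, hX, rfl⟩

/-- The character of `𝔟'` on `ℂ_μ ⊗ T`. -/
def Triangular.char (D : Triangular 𝔥 𝔟 𝔟') (φ : SymmetricAlgebra ℂ 𝔥 →ₐ[ℂ] T)
    (μ : Module.Dual ℂ 𝔥) : 𝔟' →ₗ[ℂ] T := (D.exists_char φ μ).choose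

lemma Triangular.char_apply (D : Triangular 𝔥 𝔟 𝔟') {y : 𝔟'} {H : 𝔥} {X : 𝔤}
    (hX : X ∈ commutant 𝔟') (hy : (y : 𝔤) = H + X) : D.char φ μ y = weightScalar φ μ H :=
  (D.exists_char φ μ).choose_spec y H X hX hy

lemma Triangular.char_cartan (D : Triangular 𝔥 𝔟 𝔟') (H : 𝔥) :
    D.char φ μ ⟨H, D.le' H.2⟩ = weightScalar φ μ H :=
  D.char_apply (zero_mem _) (by simp)

lemma Triangular.char_lie (D : Triangular 𝔥 𝔟 𝔟') (x y : 𝔟') : D.char φ μ ⁅x, y⁆ = 0 := by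
  rw [D.char_apply (H := 0) (X := ⁅(x : 𝔤), (y : 𝔤)⁆)
    (Submodule.subset_span ⟨x, x.2, y, y.2, rfl⟩) (by simp), weightScalar_zero]

/-- The character of `𝐔 𝔟'` on `ℂ_μ ⊗ T`. -/
def Triangular.charHom (D : Triangular 𝔥 𝔟 𝔟') (φ : SymmetricAlgebra ℂ 𝔥 →ₐ[ℂ] T)
    (μ : Module.Dual ℂ 𝔥) : 𝐔 𝔟' →ₐ[ℂ] T :=
  let _ : LieRing T := LieRing.ofAssociativeRing
  UniversalEnvelopingAlgebra.lift ℂ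
    { D.char φ μ with
      map_lie' := fun {x y} => by
        refine (D.char_lie x y).trans ?_
        rw [LieRing.of_associative_ring_bracket, mul_comm, sub_self] }

lemma Triangular.charHom_ι (D : Triangular 𝔥 𝔟 𝔟') (y : 𝔟') :
    D.charHom φ μ (ιU y) = D.char φ μ y := by
  let _ : LieRing T := LieRing.ofAssociativeRing
  exact UniversalEnvelopingAlgebra.lift_ι_apply ℂ _ y

/-! ### Coordinates on coinduced modules -/

/-- The linear form underlying an element of a coinduced module. -/
def coindVal : (coind 𝔟' φ μ).carrier →ₗ[T] (𝐔 𝔤 →ₗ[ℂ] T) := (coindSubmodule 𝔟' φ μ).subtype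

lemma coindVal_injective : Function.Injective (coindVal (𝔟' := 𝔟') (φ := φ) (μ := μ)) :=
  Subtype.val_injective

lemma coindVal_act (x : 𝔤) (f : (coind 𝔟' φ μ).carrier) (a : 𝐔 𝔤) :
    coindVal ((coind 𝔟' φ μ).act x f) a = coindVal f (a * ιU x) := rfl

lemma coindVal_mul (D : Triangular 𝔥 𝔟 𝔟') (f : (coind 𝔟' φ μ).carrier) (y : 𝔟') (a : 𝐔 𝔤) :
    coindVal f (ιU (y : 𝔤) * a) = D.char φ μ y * coindVal f a := by
  obtain ⟨H, X, hX, h⟩ := D.exists_add y.2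
  rw [D.char_apply hX h, h]
  exact f.2 H X hX a

lemma coindVal_envelopingIncl_mul (D : Triangular 𝔥 𝔟 𝔟') (f : (coind 𝔟' φ μ).carrier)
    (c : 𝐔 𝔟') (a : 𝐔 𝔤) :
    coindVal f (envelopingIncl 𝔟' c * a) = D.charHom φ μ c * coindVal f a := by
  induction c using enveloping_induction generalizing a with
  | hι y => rw [envelopingIncl_ι, coindVal_mul D, D.charHom_ι]
  | hC c => rw [AlgHom.commutes, ← Algebra.smul_def, map_smul, Algebra.smul_def, AlgHom.commutes]
  | hadd b c hb hc => rw [map_add, map_add, add_mul, map_add, hb, hc, add_mul]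
  | hmul b c hb hc => rw [map_mul (envelopingIncl 𝔟'), mul_assoc, hb, hc, map_mul, mul_assoc]

lemma coindVal_mem (D : Triangular 𝔥 𝔟 𝔟') {f : (coind 𝔟' φ μ).carrier} {J : Ideal T}
    (hf : ∀ t, coindVal f (D.mon t) ∈ J) (a : 𝐔 𝔤) : coindVal f a ∈ J := by
  have ha : a ∈ Submodule.span ℂ {a : 𝐔 𝔤 | ∃ (c : 𝐔 𝔟') (t : Multiset D.pos.I),
      a = envelopingIncl 𝔟' c * D.mon t} := D.span_mul_mon ▸ Submodule.mem_top
  induction ha using Submodule.span_induction with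
  | mem a h =>
    obtain ⟨c, t, rfl⟩ := h
    rw [coindVal_envelopingIncl_mul D]
    exact J.mul_mem_left _ (hf t)
  | zero => rw [map_zero]; exact zero_mem _
  | add a b _ _ ha hb => rw [map_add]; exact add_mem ha hb
  | smul c a _ ha => rw [map_smul, Algebra.smul_def]; exact J.mul_mem_left _ ha

lemma coind_ext (D : Triangular 𝔥 𝔟 𝔟') {f g : (coind 𝔟' φ μ).carrier}
    (h : ∀ t, coindVal f (D.mon t) = coindVal g (D.mon t)) : f = g := by
  rw [← sub_eq_zero]
  refine coindVal_injective (LinearMap.ext fun a => ?_)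
  have := coindVal_mem D (f := f - g) (J := ⊥) (fun t => by
    rw [map_sub, LinearMap.sub_apply, h, sub_self]; exact zero_mem _) a
  rw [map_zero]
  exact this

/-- With `coind_ext` this identifies the coinduced module with the product of copies of T indexed by
the positive monomials. -/
lemma exists_coind (D : Triangular 𝔥 𝔟 𝔟') (φ : SymmetricAlgebra ℂ 𝔥 →ₐ[ℂ] T)
    (μ : Module.Dual ℂ 𝔥) (c : Multiset D.pos.I → T) :
    ∃ f : (coind 𝔟' φ μ).carrier, ∀ t, coindVal f (D.mon t) = c t := by
  obtain ⟨f, hf⟩ := D.exists_linearMap ((Algebra.lmul ℂ T).comp (D.charHom φ μ)) c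
  have hf' := D.map_mul_of_exists hf
  refine ⟨⟨f, fun H X hX a => ?_⟩, fun t => ?_⟩
  · have hy : (H : 𝔤) + X ∈ 𝔟' := add_mem (D.le' H.2) (commutant_le 𝔟' hX)
    have h1 := hf' (ιU ⟨_, hy⟩) a
    rw [envelopingIncl_ι, AlgHom.comp_apply, D.charHom_ι, D.char_apply hX rfl] at h1
    exact h1
  · have := hf 1 t
    rw [map_one, map_one, one_mul] at this
    exact this

lemma coindVal_act_cartan (D : Triangular 𝔥 𝔟 𝔟') (H : 𝔥) (f : (coind 𝔟' φ μ).carrier)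
    (t : Multiset D.pos.I) : coindVal ((coind 𝔟' φ μ).act (H : 𝔤) f) (D.mon t) =
      weightScalar φ (μ - D.monWt t) H * coindVal f (D.mon t) := by
  have h1 : D.mon t * ιU (H : 𝔤) = ιU (H : 𝔤) * D.mon t - D.monWt t H • D.mon t :=
    eq_sub_of_add_eq (D.ι_mul_mon H t).symm
  rw [coindVal_act, h1, map_sub, map_smul]
  have h2 := coindVal_mul D f ⟨H, D.le' H.2⟩ (D.mon t)
  rw [D.char_cartan] at h2
  refine (congrArg (· - _) h2).trans ?_
  rw [Algebra.smul_def, ← sub_mul]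
  congr 1
  simp only [weightScalar, LinearMap.sub_apply, map_sub]
  ring

/-- Generalised deformed weight vectors. -/
def IsGenWeight (φ : SymmetricAlgebra ℂ 𝔥 →ₐ[ℂ] T) (M : Bimod.{u, v, w} 𝔤 T) (m : M.carrier) :
    Prop :=
  ∃ c : 𝔥 → ℂ, ∀ H : 𝔥, ∃ k : ℕ, ((M.act (H : 𝔤) -
    (algebraMap ℂ T (c H) + φ (SymmetricAlgebra.ι ℂ 𝔥 H)) • (1 : Module.End T M.carrier)) ^ k) m = 0

/-- On the coordinate `t`, the operator H - c(H) - φ(H) is multiplication by a complex number, since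
φ cancels. A nonzero number is a unit in T and its powers kill nothing, so all nonzero coordinates
share one weight and are finite in number. -/
lemma finite_coindVal_ne_zero (D : Triangular 𝔥 𝔟 𝔟') {f : (coind 𝔟' φ μ).carrier}
    (hf : IsGenWeight φ (coind 𝔟' φ μ) f) : {t | coindVal f (D.mon t) ≠ 0}.Finite := by
  obtain ⟨c, hc⟩ := hf
  have h1 : ∀ t, coindVal f (D.mon t) ≠ 0 → ∀ H, (μ - D.monWt t) H = c H := by
    intro t ht H
    by_contra hne
    obtain ⟨k, hk⟩ := hc H
    have h2 : ∀ (k : ℕ) (g : (coind 𝔟' φ μ).carrier),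
        coindVal ((((coind 𝔟' φ μ).act (H : 𝔤) -
          (algebraMap ℂ T (c H) + φ (SymmetricAlgebra.ι ℂ 𝔥 H)) •
            (1 : Module.End T (coind 𝔟' φ μ).carrier)) ^ k) g) (D.mon t) =
        algebraMap ℂ T (((μ - D.monWt t) H - c H) ^ k) * coindVal g (D.mon t) := by
      intro k
      induction k with
      | zero => intro g; simp
      | succ k ih =>
        intro g
        rw [pow_succ, Module.End.mul_apply, ih, pow_succ, map_mul, mul_assoc]
        congr 1
        have h0 : coindVal ((coind 𝔟' φ μ).act (H : 𝔤) g) (D.mon t) - (algebraMap ℂ T (c H) +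
            φ (SymmetricAlgebra.ι ℂ 𝔥 H)) * coindVal g (D.mon t) =
            algebraMap ℂ T ((μ - D.monWt t) H - c H) * coindVal g (D.mon t) := by
          rw [coindVal_act_cartan, ← sub_mul, weightScalar, map_sub]
          congr 1
          ring
        exact h0
    have h3 := h2 k f
    rw [hk, map_zero, LinearMap.zero_apply] at h3
    have h4 : IsUnit (algebraMap ℂ T (((μ - D.monWt t) H - c H) ^ k)) :=
      (IsUnit.mk0 _ (pow_ne_zero _ (sub_ne_zero.mpr hne))).map _
    exact ht ((h4.mul_right_eq_zero).mp h3.symm)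
  rcases Set.eq_empty_or_nonempty {t | coindVal f (D.mon t) ≠ 0} with h | ⟨t₀, ht₀⟩
  · rw [h]; exact Set.finite_empty
  · refine (D.finite_monWt (D.monWt t₀)).subset fun t ht => ?_
    have := h1 t ht
    have h0 := h1 t₀ ht₀
    refine LinearMap.ext fun H => ?_
    have h5 := (this H).trans (h0 H).symm
    simpa using h5

lemma isGenWeight_of_mem {M : Bimod.{u, v, w} 𝔤 T} {ν : Module.Dual ℂ 𝔥} {m : M.carrier}
    (hm : m ∈ weightSpace φ M ν) : IsGenWeight φ M m :=
  ⟨ν, fun H => ⟨1, by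
    rw [pow_one, LinearMap.sub_apply, hm H, LinearMap.smul_apply, Module.End.one_apply]
    exact sub_self _⟩⟩

/-- An element of the coinduced module lies in the sum of the weight spaces if it has finitely many
nonzero coordinates. -/
lemma mem_iSup_weightSpace_coind (D : Triangular 𝔥 𝔟 𝔟') {f : (coind 𝔟' φ μ).carrier} :
    f ∈ ⨆ ν, weightSpace φ (coind 𝔟' φ μ) ν ↔ {t | coindVal f (D.mon t) ≠ 0}.Finite := by
  classical
  constructor
  · intro hf
    induction hf using Submodule.iSup_induction' with
    | mem ν f hf => exact finite_coindVal_ne_zero D (isGenWeight_of_mem hf)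
    | zero => simp
    | add f g _ _ hf hg =>
      refine (hf.union hg).subset fun t ht => ?_
      by_contra h
      simp only [Set.mem_union, Set.mem_ofPred_eq, not_or, not_not] at h
      exact ht (by rw [map_add, LinearMap.add_apply, h.1, h.2, add_zero])
  · intro hf
    choose δ hδ using fun t => exists_coind D φ μ (fun s => if s = t then 1 else 0)
    have h1 : ∀ t, δ t ∈ weightSpace φ (coind 𝔟' φ μ) (μ - D.monWt t) := fun t H => by
      refine coind_ext D fun s => ?_
      rw [coindVal_act_cartan, map_smul, LinearMap.smul_apply, smul_eq_mul, hδ]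
      split_ifs with h
      · rw [h]
      · rw [mul_zero, mul_zero]
    have h2 : f = ∑ t ∈ hf.toFinset, coindVal f (D.mon t) • δ t := by
      refine coind_ext D fun s => ?_
      rw [map_sum, LinearMap.sum_apply]
      simp only [map_smul, LinearMap.smul_apply, hδ, smul_eq_mul, mul_ite, mul_one, mul_zero]
      rw [Finset.sum_ite_eq]
      split_ifs with h
      · rfl
      · simpa using h
    rw [h2]
    exact Submodule.sum_mem _ fun t _ => Submodule.smul_mem _ _ (Submodule.mem_iSup_of_mem _ (h1 t))

/-! ### Coordinates on nabla modules -/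

variable [𝔥.IsCartanSubalgebra]

/-- The inclusion of the nabla module into the coinduced module. -/
def nablaIncl : (nabla 𝔟' φ μ).carrier →ₗ[T] (coind 𝔟' φ μ).carrier :=
  (⨆ ν, weightSpace φ (coind 𝔟' φ μ) ν).subtype

lemma nablaIncl_injective : Function.Injective (nablaIncl (𝔟' := 𝔟') (φ := φ) (μ := μ)) :=
  Subtype.val_injective

/-- The linear form underlying an element of a nabla module. -/
def nablaVal : (nabla 𝔟' φ μ).carrier →ₗ[T] (𝐔 𝔤 →ₗ[ℂ] T) := coindVal ∘ₗ nablaIncl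

lemma nablaEval_eq (f : (nabla 𝔟' φ μ).carrier) : nablaEval 𝔟' φ μ f = nablaVal f 1 := rfl

lemma nablaVal_act (x : 𝔤) (f : (nabla 𝔟' φ μ).carrier) (a : 𝐔 𝔤) :
    nablaVal ((nabla 𝔟' φ μ).act x f) a = nablaVal f (a * ιU x) := rfl

lemma nablaVal_injective : Function.Injective (nablaVal (𝔟' := 𝔟') (φ := φ) (μ := μ)) :=
  coindVal_injective.comp nablaIncl_injective

lemma nablaVal_mul (D : Triangular 𝔥 𝔟 𝔟') (f : (nabla 𝔟' φ μ).carrier) (y : 𝔟') (a : 𝐔 𝔤) :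
    nablaVal f (ιU (y : 𝔤) * a) = D.char φ μ y * nablaVal f a :=
  coindVal_mul D (nablaIncl f) y a

/-- The coordinates on a nabla module: the values on the monomials in the positive root vectors. -/
def nablaCoord (D : Triangular 𝔥 𝔟 𝔟') (φ : SymmetricAlgebra ℂ 𝔥 →ₐ[ℂ] T)
    (μ : Module.Dual ℂ 𝔥) : (nabla 𝔟' φ μ).carrier ≃ₗ[T] (Multiset D.pos.I →₀ T) :=
  LinearEquiv.ofBijective
    { toFun := fun f => Finsupp.ofSupportFinite (fun t => nablaVal f (D.mon t))
        ((mem_iSup_weightSpace_coind D).mp f.2)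
      map_add' := fun f g => by
        ext t
        change nablaVal (f + g) (D.mon t) = nablaVal f (D.mon t) + nablaVal g (D.mon t)
        rw [map_add, LinearMap.add_apply]
      map_smul' := fun c f => by
        ext t
        change nablaVal (c • f) (D.mon t) = c • nablaVal f (D.mon t)
        rw [map_smul, LinearMap.smul_apply] } (by
    constructor
    · intro f g h
      refine nablaIncl_injective (coind_ext D fun t => ?_)
      exact DFunLike.congr_fun h t
    · intro c
      obtain ⟨f, hf⟩ := exists_coind D φ μ c
      refine ⟨⟨f, (mem_iSup_weightSpace_coind D).mpr ?_⟩, Finsupp.ext fun t => hf t⟩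
      simp only [hf]
      exact c.hasFiniteSupport)

lemma nablaCoord_apply (D : Triangular 𝔥 𝔟 𝔟') (f : (nabla 𝔟' φ μ).carrier)
    (t : Multiset D.pos.I) : nablaCoord D φ μ f t = nablaVal f (D.mon t) := rfl

lemma nablaEval_eq_coord (D : Triangular 𝔥 𝔟 𝔟') (f : (nabla 𝔟' φ μ).carrier) :
    nablaEval 𝔟' φ μ f = nablaCoord D φ μ f 0 := by
  rw [nablaCoord_apply, D.mon_zero, nablaEval_eq]

lemma nablaCoord_act_cartan (D : Triangular 𝔥 𝔟 𝔟') (H : 𝔥) (f : (nabla 𝔟' φ μ).carrier)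
    (t : Multiset D.pos.I) : nablaCoord D φ μ ((nabla 𝔟' φ μ).act (H : 𝔤) f) t =
      weightScalar φ (μ - D.monWt t) H * nablaCoord D φ μ f t :=
  coindVal_act_cartan D H (nablaIncl f) t

lemma mem_weightSpace_nabla (D : Triangular 𝔥 𝔟 𝔟') {f : (nabla 𝔟' φ μ).carrier}
    {ν : Module.Dual ℂ 𝔥} : f ∈ weightSpace φ (nabla 𝔟' φ μ) ν ↔
      ∀ t, nablaCoord D φ μ f t ≠ 0 → μ - D.monWt t = ν := by
  constructor
  · intro hf t ht
    by_contra hne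
    obtain ⟨H, hH⟩ : ∃ H, (μ - D.monWt t - ν) H ≠ 0 := by
      by_contra! h
      exact hne (sub_eq_zero.mp (LinearMap.ext h))
    have h1 := nablaCoord_act_cartan D H f t
    rw [hf H, map_smul, Finsupp.smul_apply, smul_eq_mul, eq_comm, ← sub_eq_zero, ← sub_mul,
      weightScalar_sub] at h1
    exact ht (((IsUnit.mk0 _ hH).map (algebraMap ℂ T)).mul_right_eq_zero.mp h1)
  · intro h H
    refine (nablaCoord D φ μ).injective (Finsupp.ext fun t => ?_)
    rw [nablaCoord_act_cartan, map_smul, Finsupp.smul_apply, smul_eq_mul]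
    by_cases ht : nablaCoord D φ μ f t = 0
    · rw [ht, mul_zero, mul_zero]
    · rw [h t ht]

lemma nabla_eq_sum (D : Triangular 𝔥 𝔟 𝔟') (f : (nabla 𝔟' φ μ).carrier) :
    f = ∑ t ∈ (nablaCoord D φ μ f).support,
      nablaCoord D φ μ f t • (nablaCoord D φ μ).symm (Finsupp.single t 1) := by
  apply (nablaCoord D φ μ).injective
  simp only [map_sum, map_smul, LinearEquiv.apply_symm_apply, Finsupp.smul_single_one]
  exact (Finsupp.sum_single (nablaCoord D φ μ f)).symm

lemma nabla_mem_smul_top (D : Triangular 𝔥 𝔟 𝔟') {J : Ideal T} {f : (nabla 𝔟' φ μ).carrier}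
    (hf : ∀ t, nablaCoord D φ μ f t ∈ J) : f ∈ J • (⊤ : Submodule T (nabla 𝔟' φ μ).carrier) := by
  rw [nabla_eq_sum D f]
  exact Submodule.sum_mem _ fun t _ => Submodule.smul_mem_smul (hf t) trivial

/-- A form on a bimodule that is semi-invariant under the opposite Borel subalgebra comes from a
homomorphism to a nabla module. -/
theorem exists_hom_nabla (D : Triangular 𝔥 𝔟 𝔟') {M : Bimod.{u, v, w} 𝔤 T}
    (hM : Submodule.span T {m | IsGenWeight φ M m} = ⊤) (ψ : M.carrier →ₗ[T] T)
    (hψ : ∀ (y : 𝔟') m, ψ (M.act y m) = D.char φ μ y * ψ m) :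
    ∃ Ψ : M.carrier →ₗ[T] (nabla 𝔟' φ μ).carrier,
      (∀ x m, Ψ (M.act x m) = (nabla 𝔟' φ μ).act x (Ψ m)) ∧
      ∀ m, nablaEval 𝔟' φ μ (Ψ m) = ψ m := by
  -- Frobenius reciprocity: `m` goes to the form a ↦ ψ(a m).
  let F : M.carrier → (coind 𝔟' φ μ).carrier := fun m =>
    ⟨{ toFun := fun a => ψ (M.uact a m)
       map_add' := fun a b => by rw [map_add, LinearMap.add_apply, map_add]
       map_smul' := fun c a => by
        rw [Bimod.uact_smul, map_smul, RingHom.id_apply, algebraMap_smul] },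
     fun H X hX a => by
      have hy : (H : 𝔤) + X ∈ 𝔟' := add_mem (D.le' H.2) (commutant_le 𝔟' hX)
      have h1 := hψ ⟨_, hy⟩ (M.uact a m)
      rw [D.char_apply hX rfl] at h1
      simp only [LinearMap.coe_mk, AddHom.coe_mk]
      rw [Bimod.uact_mul, Bimod.uact_ι]
      exact h1⟩
  have hF : ∀ m a, coindVal (F m) a = ψ (M.uact a m) := fun m a => rfl
  let G : M.carrier →ₗ[T] (coind 𝔟' φ μ).carrier :=
    { toFun := F
      map_add' := fun m n => coindVal_injective (LinearMap.ext fun a => by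
        rw [map_add, LinearMap.add_apply, hF, hF, hF, map_add, map_add])
      map_smul' := fun c m => coindVal_injective (LinearMap.ext fun a => by
        rw [map_smul, RingHom.id_apply, LinearMap.smul_apply, hF, hF, map_smul, map_smul]) }
  have hG : ∀ x m, G (M.act x m) = (coind 𝔟' φ μ).act x (G m) := fun x m =>
    coindVal_injective (LinearMap.ext fun a => by
      rw [coindVal_act]
      change ψ (M.uact a (M.act x m)) = ψ (M.uact (a * ιU x) m)
      rw [Bimod.uact_mul, Bimod.uact_ι])
  -- The image falls into ∇(μ) because generalised weight vectors map to generalised weight vectors,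
  -- which have finitely many nonzero coordinates.
  have hG' : ∀ m, G m ∈ ⨆ ν, weightSpace φ (coind 𝔟' φ μ) ν := by
    have : Submodule.span T {m | IsGenWeight φ M m} ≤
        (⨆ ν, weightSpace φ (coind 𝔟' φ μ) ν).comap G := by
      rw [Submodule.span_le]
      rintro m ⟨c, hc⟩
      rw [SetLike.mem_coe, Submodule.mem_comap, mem_iSup_weightSpace_coind D]
      refine finite_coindVal_ne_zero D ⟨c, fun H => ?_⟩
      obtain ⟨k, hk⟩ := hc H
      refine ⟨k, ?_⟩
      rw [← map_zero G, ← hk]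
      clear hk hc
      induction k generalizing m with
      | zero => rfl
      | succ k ih =>
        rw [pow_succ, pow_succ, Module.End.mul_apply, Module.End.mul_apply, ← ih]
        congr 1
        simp only [LinearMap.sub_apply, LinearMap.smul_apply, Module.End.one_apply, map_sub,
          map_smul, hG]
    intro m
    exact this (hM ▸ Submodule.mem_top)
  refine ⟨G.codRestrict _ hG', fun x m => nablaIncl_injective (hG x m), fun m => ?_⟩
  change ψ (M.uact 1 m) = ψ m
  rw [map_one, Module.End.one_apply]

end Nabla

/-! ### Morphisms of bimodules -/

namespace Bimod

section Morphisms

variable {𝔤 : Type u} [LieRing 𝔤] [LieAlgebra ℂ 𝔤] {T : Type v} [CommRing T] [Algebra ℂ T]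

/-- The identity morphism. -/
def Hom.id (M : Bimod.{u, v, w} 𝔤 T) : Hom M M := ⟨LinearMap.id, fun _ _ => rfl⟩

/-- Composition of morphisms. -/
def Hom.comp {M N P : Bimod.{u, v, w} 𝔤 T} (g : Hom N P) (f : Hom M N) : Hom M P :=
  ⟨g.1 ∘ₗ f.1, fun x m => by rw [LinearMap.comp_apply, f.2, g.2, LinearMap.comp_apply]⟩

lemma Hom.comp_apply {M N P : Bimod.{u, v, w} 𝔤 T} (g : Hom N P) (f : Hom M N) (m : M.carrier) :
    (g.comp f).1 m = g.1 (f.1 m) := rfl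

/-- A morphism from an additive map. -/
def Hom.ofAddMonoidHom {M N : Bimod.{u, v, w} 𝔤 T} (g : M.carrier →+ N.carrier)
    (hs : ∀ (t : T) m, g (t • m) = t • g m) (ha : ∀ x m, g (M.act x m) = N.act x (g m)) :
    Hom M N :=
  ⟨{ g with map_smul' := hs }, ha⟩

/-- The morphism underlying an isomorphism. -/
def Iso.toHom {M N : Bimod.{u, v, w} 𝔤 T} (e : Iso M N) : Hom M N := ⟨e.1.toLinearMap, e.2⟩

/-- The inverse isomorphism. -/
def Iso.symm {M N : Bimod.{u, v, w} 𝔤 T} (e : Iso M N) : Iso N M :=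
  ⟨e.1.symm, fun x n => by
    apply e.1.injective
    rw [e.2, e.1.apply_symm_apply, e.1.apply_symm_apply]⟩

/-- Composition of isomorphisms. -/
def Iso.trans {M N P : Bimod.{u, v, w} 𝔤 T} (e : Iso M N) (f : Iso N P) : Iso M P :=
  ⟨e.1.trans f.1, fun x m => by simp [e.2, f.2]⟩

lemma Iso.toHom_apply {M N : Bimod.{u, v, w} 𝔤 T} (e : Iso M N) (m : M.carrier) :
    e.toHom.1 m = e.1 m := rfl

lemma Iso.symm_apply_apply {M N : Bimod.{u, v, w} 𝔤 T} (e : Iso M N) (m : M.carrier) :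
    e.symm.1 (e.1 m) = m := e.1.symm_apply_apply m

lemma Iso.apply_symm_apply {M N : Bimod.{u, v, w} 𝔤 T} (e : Iso M N) (n : N.carrier) :
    e.1 (e.symm.1 n) = n := e.1.apply_symm_apply n

/-- A bijective morphism is an isomorphism. -/
def Iso.ofBijective {M N : Bimod.{u, v, w} 𝔤 T} (f : Hom M N) (hf : Function.Bijective f.1) :
    Iso M N := ⟨LinearEquiv.ofBijective f.1 hf, f.2⟩

/-- Mutually inverse morphisms give an isomorphism. -/
def Iso.ofInverse {M N : Bimod.{u, v, w} 𝔤 T} (f : Hom M N) (g : Hom N M)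
    (hgf : ∀ m, g.1 (f.1 m) = m) (hfg : ∀ n, f.1 (g.1 n) = n) : Iso M N :=
  Iso.ofBijective f ⟨Function.LeftInverse.injective hgf, Function.RightInverse.surjective hfg⟩

lemma IsSummand.of_iso {M N : Bimod.{u, v, w} 𝔤 T} (e : Iso M N) : IsSummand M N :=
  ⟨e.toHom, e.symm.toHom, e.symm_apply_apply⟩

lemma IsSummand.trans {M N P : Bimod.{u, v, w} 𝔤 T} (h : IsSummand M N) (h' : IsSummand N P) :
    IsSummand M P := by
  obtain ⟨i, p, hip⟩ := h
  obtain ⟨j, q, hjq⟩ := h'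
  refine ⟨j.comp i, p.comp q, fun m => ?_⟩
  rw [Hom.comp_apply, Hom.comp_apply, hjq, hip]

end Morphisms

/-! ### Tensor products with representations -/

section Tensor

attribute [local instance] complexModule complexModule_isScalarTower

variable {𝔤 : Type u} [LieRing 𝔤] [LieAlgebra ℂ 𝔤] {T : Type v} [CommRing T] [Algebra ℂ T]
  {M : Bimod.{u, v, w} 𝔤 T} {E : Type w} [AddCommGroup E] [Module ℂ E]
  [LieRingModule 𝔤 E] [LieModule ℂ 𝔤 E]

variable (M E) in
/-- The pure tensors in `M ⊗ E`. -/
def pure : M.carrier →+ E →+ (M.tensor E).carrier where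
  toFun m :=
    { toFun := fun e => (m ⊗ₜ[ℂ] e : M.carrier ⊗[ℂ] E)
      map_zero' := TensorProduct.tmul_zero _ _
      map_add' := TensorProduct.tmul_add _ }
  map_zero' := AddMonoidHom.ext fun _ => TensorProduct.zero_tmul _ _
  map_add' m n := AddMonoidHom.ext fun e => TensorProduct.add_tmul m n e

lemma pure_smul (t : T) (m : M.carrier) (e : E) : pure M E (t • m) e = t • pure M E m e := rfl

lemma pure_complex_smul (c : ℂ) (m : M.carrier) (e : E) :
    pure M E m (c • e) = algebraMap ℂ T c • pure M E m e :=
  (TensorProduct.smul_tmul c m e).symm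

lemma act_pure (x : 𝔤) (m : M.carrier) (e : E) :
    (M.tensor E).act x (pure M E m e) = pure M E (M.act x m) e + pure M E m ⁅x, e⁆ := rfl

lemma tensor_induction {P : (M.tensor E).carrier → Prop} (hz : P 0)
    (hp : ∀ m e, P (pure M E m e)) (ha : ∀ a b, P a → P b → P (a + b))
    (z : (M.tensor E).carrier) : P z :=
  TensorProduct.induction_on (R := ℂ) (M := M.carrier) (N := E) (motive := P) z hz hp ha

/-- Additive maps out of a tensor product. -/
def tensorLift {V : Type*} [AddCommGroup V] (g : M.carrier →+ E →+ V)
    (hg : ∀ (c : ℂ) m e, g (algebraMap ℂ T c • m) e = g m (c • e)) :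
    (M.tensor E).carrier →+ V :=
  TensorProduct.liftAddHom (R := ℂ) (M := M.carrier) (N := E) g hg

lemma tensorLift_pure {V : Type*} [AddCommGroup V] (g : M.carrier →+ E →+ V)
    (hg : ∀ (c : ℂ) m e, g (algebraMap ℂ T c • m) e = g m (c • e)) (m : M.carrier) (e : E) :
    tensorLift g hg (pure M E m e) = g m e := rfl

lemma tensorLift_smul {V T' : Type*} [AddCommGroup V] [CommRing T'] [Module T' V] (σ : T →+* T')
    (g : M.carrier →+ E →+ V) (hg : ∀ (c : ℂ) m e, g (algebraMap ℂ T c • m) e = g m (c • e))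
    (hs : ∀ (t : T) m e, g (t • m) e = σ t • g m e) (t : T) (z : (M.tensor E).carrier) :
    tensorLift g hg (t • z) = σ t • tensorLift g hg z := by
  induction z using tensor_induction with
  | hz => rw [smul_zero, map_zero, smul_zero]
  | hp m e => rw [← pure_smul, tensorLift_pure, tensorLift_pure, hs]
  | ha a b ha hb => rw [smul_add, map_add, ha, hb, map_add, smul_add]

end Tensor

section TensorFunctoriality

variable {𝔤 : Type u} [LieRing 𝔤] [LieAlgebra ℂ 𝔤] {T : Type v} [CommRing T] [Algebra ℂ T]
  {M N : Bimod.{u, v, w} 𝔤 T} {E : Type w} [AddCommGroup E] [Module ℂ E]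
  [LieRingModule 𝔤 E] [LieModule ℂ 𝔤 E] {F : Type w} [AddCommGroup F] [Module ℂ F]
  [LieRingModule 𝔤 F] [LieModule ℂ 𝔤 F]

lemma Hom.tensor_ext {f g : Hom (M.tensor E) N}
    (h : ∀ m e, f.1 (pure M E m e) = g.1 (pure M E m e)) (z : (M.tensor E).carrier) :
    f.1 z = g.1 z := by
  induction z using tensor_induction with
  | hz => rw [map_zero, map_zero]
  | hp m e => exact h m e
  | ha a b ha hb => rw [map_add, map_add, ha, hb]

/-- Morphisms out of a tensor product. -/
def Hom.tensorLift (g : M.carrier →+ E →+ N.carrier)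
    (hs : ∀ (t : T) m e, g (t • m) e = t • g m e)
    (hc : ∀ (c : ℂ) m e, g m (c • e) = algebraMap ℂ T c • g m e)
    (ha : ∀ x m e, g (M.act x m) e + g m ⁅x, e⁆ = N.act x (g m e)) : Hom (M.tensor E) N :=
  Hom.ofAddMonoidHom (Bimod.tensorLift g fun c m e => by rw [hs, hc])
    (tensorLift_smul (RingHom.id T) g _ hs) (fun x z => by
      induction z using tensor_induction with
      | hz => simp only [map_zero]
      | hp m e => rw [act_pure, map_add, tensorLift_pure, tensorLift_pure, tensorLift_pure, ha]
      | ha a b ha hb => simp only [map_add, ha, hb])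

variable (E) in
/-- Functoriality of the tensor product with a representation. -/
def Hom.tensor (f : Hom M N) : Hom (M.tensor E) (N.tensor E) :=
  Hom.tensorLift ((pure N E).comp f.1.toAddMonoidHom)
    (fun t m e => by
      simp only [AddMonoidHom.comp_apply, LinearMap.toAddMonoidHom_coe, map_smul, pure_smul])
    (fun c m e => pure_complex_smul c (f.1 m) e)
    (fun x m e => by
      simp only [AddMonoidHom.comp_apply, LinearMap.toAddMonoidHom_coe, f.2, act_pure])

lemma Hom.tensor_pure (f : Hom M N) (m : M.carrier) (e : E) :
    (f.tensor E).1 (pure M E m e) = pure N E (f.1 m) e := rfl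

lemma IsSummand.tensor (h : IsSummand M N) : IsSummand (M.tensor E) (N.tensor E) := by
  obtain ⟨i, p, hip⟩ := h
  refine ⟨i.tensor E, p.tensor E, fun z => ?_⟩
  refine Hom.tensor_ext (f := (p.tensor E).comp (i.tensor E)) (g := Hom.id _) (fun m e => ?_) z
  rw [Hom.comp_apply, Hom.tensor_pure, Hom.tensor_pure, hip]
  rfl

variable (E) in
/-- Functoriality of the tensor product with a representation. -/
def Iso.tensor (e : Iso M N) : Iso (M.tensor E) (N.tensor E) :=
  Iso.ofInverse (e.toHom.tensor E) (e.symm.toHom.tensor E)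
    (Hom.tensor_ext (f := (e.symm.toHom.tensor E).comp (e.toHom.tensor E)) (g := Hom.id _)
      (fun m f => by
        rw [Hom.comp_apply, Hom.tensor_pure, Hom.tensor_pure, Iso.toHom_apply, Iso.toHom_apply,
          Iso.symm_apply_apply]; rfl))
    (Hom.tensor_ext (f := (e.toHom.tensor E).comp (e.symm.toHom.tensor E)) (g := Hom.id _)
      (fun m f => by
        rw [Hom.comp_apply, Hom.tensor_pure, Hom.tensor_pure, Iso.toHom_apply, Iso.toHom_apply,
          Iso.apply_symm_apply]; rfl))

/-- Tensoring with a trivial one-dimensional representation. -/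
lemma nonempty_iso_tensor_trivial (M : Bimod.{u, v, w} 𝔤 T) (e₀ : E)
    (he : ∀ e : E, ∃! c : ℂ, e = c • e₀) (hx : ∀ (x : 𝔤) (e : E), ⁅x, e⁆ = 0) :
    Nonempty (Iso M (M.tensor E)) := by
  choose c hc huniq using fun e => he e
  have hc' : ∀ e, e = c e • e₀ := hc
  have hadd : ∀ e f, c (e + f) = c e + c f := fun e f =>
    (huniq (e + f) _ (by simp only [add_smul, ← hc'])).symm
  have hsmul : ∀ (z : ℂ) e, c (z • e) = z * c e := fun z e =>
    (huniq (z • e) _ (by simp only [mul_smul, ← hc'])).symm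
  have hone : c e₀ = 1 := (huniq e₀ 1 (by simp)).symm
  let F : Hom M (M.tensor E) := Hom.ofAddMonoidHom ((pure M E).flip e₀)
    (fun t m => pure_smul t m e₀) (fun x m => by
      simp only [AddMonoidHom.flip_apply, act_pure, hx, map_zero, add_zero])
  have hc0 : c 0 = 0 := by simpa using hsmul 0 0
  let G : Hom (M.tensor E) M := Hom.tensorLift
    { toFun := fun m =>
        { toFun := fun e => algebraMap ℂ T (c e) • m
          map_zero' := by rw [hc0, map_zero, zero_smul]
          map_add' := fun e f => by rw [hadd, map_add, add_smul] }
      map_zero' := by ext e; simp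
      map_add' := fun m n => by ext e; simp }
    (fun t m e => smul_comm _ _ _)
    (fun z m e => by
      simp only [AddMonoidHom.coe_mk, ZeroHom.coe_mk, hsmul, map_mul, mul_smul])
    (fun x m e => by
      simp only [AddMonoidHom.coe_mk, ZeroHom.coe_mk, hx, map_zero, add_zero, map_smul])
  have hF : ∀ m, F.1 m = pure M E m e₀ := fun m => rfl
  have hG : ∀ m e, G.1 (pure M E m e) = algebraMap ℂ T (c e) • m := fun m e => rfl
  refine ⟨Iso.ofInverse F G (fun m => ?_) (Hom.tensor_ext (f := F.comp G) (g := Hom.id _)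
    fun m e => ?_)⟩
  · rw [hF, hG, hone, map_one, one_smul]
  · rw [Hom.comp_apply, hG, map_smul, hF, ← pure_complex_smul, ← hc']
    rfl

/-- Associativity of tensor products. -/
lemma nonempty_iso_tensor_assoc (M : Bimod.{u, v, w} 𝔤 T) :
    Nonempty (Iso ((M.tensor E).tensor F) (M.tensor (E ⊗[ℂ] F))) := by
  have hK : ∀ f : F, ∃ K : (M.tensor E).carrier →+ (M.tensor (E ⊗[ℂ] F)).carrier,
      ∀ m e, K (pure M E m e) = pure M (E ⊗[ℂ] F) m (e ⊗ₜ f) := fun f =>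
    ⟨Bimod.tensorLift (M := M) (E := E)
      { toFun := fun m => (pure M (E ⊗[ℂ] F) m).comp
          ((TensorProduct.mk ℂ E F).flip f).toAddMonoidHom
        map_zero' := by ext e; simp
        map_add' := fun m n => by ext e; simp }
      (fun c m e => by
        simp only [AddMonoidHom.coe_mk, ZeroHom.coe_mk, AddMonoidHom.comp_apply,
          LinearMap.toAddMonoidHom_coe, LinearMap.flip_apply, TensorProduct.mk_apply, pure_smul,
          ← TensorProduct.smul_tmul', pure_complex_smul]), fun m e => rfl⟩
  choose K hK using hK
  have hK0 : K 0 = 0 := by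
    ext z
    induction z using tensor_induction with
    | hz => simp only [map_zero]
    | hp m e => rw [hK, TensorProduct.tmul_zero, map_zero]; rfl
    | ha a b ha hb => rw [map_add, map_add, ha, hb]
  have hKadd : ∀ f g, K (f + g) = K f + K g := fun f g => by
    ext z
    induction z using tensor_induction with
    | hz => simp only [map_zero]
    | hp m e => rw [AddMonoidHom.add_apply, hK, hK, hK, TensorProduct.tmul_add, map_add]
    | ha a b ha hb => rw [map_add, map_add, ha, hb]
  let A : Hom ((M.tensor E).tensor F) (M.tensor (E ⊗[ℂ] F)) := Hom.tensorLift
    (AddMonoidHom.flip ⟨⟨K, hK0⟩, hKadd⟩)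
    (fun t z f => by
      change K f (t • z) = t • K f z
      induction z using tensor_induction with
      | hz => simp only [map_zero, smul_zero]
      | hp m e => rw [← pure_smul, hK, hK, pure_smul]
      | ha a b ha hb => rw [smul_add, map_add, ha, hb, map_add, smul_add])
    (fun c z f => by
      change K (c • f) z = algebraMap ℂ T c • K f z
      induction z using tensor_induction with
      | hz => simp only [map_zero, smul_zero]
      | hp m e => rw [hK, hK, TensorProduct.tmul_smul, pure_complex_smul]
      | ha a b ha hb => rw [map_add, ha, hb, map_add, smul_add])
    (fun x z f => by
      change K f ((M.tensor E).act x z) + K ⁅x, f⁆ z = (M.tensor (E ⊗[ℂ] F)).act x (K f z)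
      induction z using tensor_induction with
      | hz => simp only [map_zero, add_zero]
      | hp m e =>
        rw [act_pure, map_add, hK, hK, hK, hK, act_pure, TensorProduct.LieModule.lie_tmul_right,
          map_add, add_assoc]
      | ha a b ha hb =>
        simp only [map_add, ← ha, ← hb]
        abel)
  have hA : ∀ m e f, A.1 (pure _ F (pure M E m e) f) = pure M (E ⊗[ℂ] F) m (e ⊗ₜ f) :=
    fun m e f => hK f m e
  let B : Hom (M.tensor (E ⊗[ℂ] F)) ((M.tensor E).tensor F) := Hom.tensorLift
    { toFun := fun m => TensorProduct.liftAddHom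
        ((pure (M.tensor E) F).comp (pure M E m)) (fun c e f => by
          simp [pure_complex_smul, pure_smul])
      map_zero' := by
        ext z
        induction z using TensorProduct.induction_on with
        | zero => simp
        | tmul e f => simp
        | add a b ha hb => simp only [map_add, ha, hb]
      map_add' := fun m n => by
        ext z
        induction z using TensorProduct.induction_on with
        | zero => simp
        | tmul e f => simp
        | add a b ha hb =>
          rw [(TensorProduct.liftAddHom _ _).map_add, ha, hb, ← AddMonoidHom.map_add] }
    (fun t m z => by
      simp only [AddMonoidHom.coe_mk, ZeroHom.coe_mk]
      induction z using TensorProduct.induction_on with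
      | zero => simp
      | tmul e f => simp [pure_smul]
      | add a b ha hb => simp only [map_add, ha, hb, smul_add])
    (fun c m z => by
      simp only [AddMonoidHom.coe_mk, ZeroHom.coe_mk]
      induction z using TensorProduct.induction_on with
      | zero => simp
      | tmul e f => simp [TensorProduct.smul_tmul', pure_complex_smul, pure_smul]
      | add a b ha hb => simp only [map_add, ha, hb, smul_add])
    (fun x m z => by
      simp only [AddMonoidHom.coe_mk, ZeroHom.coe_mk]
      induction z using TensorProduct.induction_on with
      | zero => simp only [map_zero, lie_zero, add_zero]
      | tmul e f =>
        simp only [TensorProduct.LieModule.lie_tmul_right, map_add, TensorProduct.liftAddHom_tmul,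
          AddMonoidHom.comp_apply, act_pure, AddMonoidHom.add_apply]
        abel
      | add a b ha hb =>
        simp only [map_add, lie_add, ← ha, ← hb]
        abel)
  have hB : ∀ m e f, B.1 (pure M (E ⊗[ℂ] F) m (e ⊗ₜ f)) = pure _ F (pure M E m e) f :=
    fun m e f => rfl
  refine ⟨Iso.ofInverse A B (Hom.tensor_ext (f := B.comp A) (g := Hom.id _) fun z f => ?_)
    (Hom.tensor_ext (f := A.comp B) (g := Hom.id _) fun m z => ?_)⟩
  · induction z using tensor_induction with
    | hz => simp only [map_zero, AddMonoidHom.zero_apply]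
    | hp m e => rw [Hom.comp_apply, hA, hB]; rfl
    | ha a b ha hb => simp only [map_add, AddMonoidHom.add_apply, ha, hb]
  · induction z using TensorProduct.induction_on with
    | zero => simp only [map_zero]
    | tmul e f => rw [Hom.comp_apply, hB, hA]; rfl
    | add a b ha hb => simp only [map_add, ha, hb]

end TensorFunctoriality

end Bimod

/-! ### Reduction modulo the maximal ideal -/

namespace Bimod

variable {𝔤 : Type u} [LieRing 𝔤] [LieAlgebra ℂ 𝔤] {T : Type v} [CommRing T] [Algebra ℂ T]
  [Algebra T ℂ] [IsScalarTower ℂ T ℂ]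

lemma residue_algebraMap (c : ℂ) : algebraMap T ℂ (algebraMap ℂ T c) = c := by
  rw [← IsScalarTower.algebraMap_apply]; rfl

/-- The reduction map `M → ℂ ⊗_T M`. -/
def red (M : Bimod.{u, v, w} 𝔤 T) : M.carrier →+ (M.baseChange ℂ).carrier where
  toFun m := ((1 : ℂ) ⊗ₜ[T] m : ℂ ⊗[T] M.carrier)
  map_zero' := TensorProduct.tmul_zero _ _
  map_add' := TensorProduct.tmul_add _

variable {M N : Bimod.{u, v, w} 𝔤 T}

lemma red_act (x : 𝔤) (m : M.carrier) : M.red (M.act x m) = (M.baseChange ℂ).act x (M.red m) := rfl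

lemma red_smul (t : T) (m : M.carrier) : M.red (t • m) = algebraMap T ℂ t • M.red m := by
  change ((1 : ℂ) ⊗ₜ[T] (t • m) : ℂ ⊗[T] M.carrier) = algebraMap T ℂ t • ((1 : ℂ) ⊗ₜ[T] m)
  rw [← TensorProduct.smul_tmul, TensorProduct.smul_tmul', Algebra.smul_def, smul_eq_mul]

lemma red_surjective : Function.Surjective M.red := by
  intro z
  induction z using TensorProduct.induction_on (R := T) (M := ℂ) (N := M.carrier) with
  | zero => exact ⟨0, map_zero _⟩
  | tmul c m =>
    refine ⟨algebraMap ℂ T c • m, ?_⟩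
    rw [red_smul, residue_algebraMap]
    change c • ((1 : ℂ) ⊗ₜ[T] m) = c ⊗ₜ[T] m
    rw [TensorProduct.smul_tmul', smul_eq_mul, mul_one]
  | add a b ha hb =>
    obtain ⟨m, hm⟩ := ha
    obtain ⟨n, hn⟩ := hb
    exact ⟨m + n, by rw [map_add, hm, hn]; rfl⟩

/-- Additive maps out of the reduction. -/
def redLift {V : Type*} [AddCommGroup V] [Module ℂ V] (g : M.carrier →+ V)
    (hg : ∀ (t : T) m, g (t • m) = algebraMap T ℂ t • g m) : (M.baseChange ℂ).carrier →+ V :=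
  TensorProduct.liftAddHom (R := T) (M := ℂ) (N := M.carrier)
    { toFun := fun c => (DistribSMul.toAddMonoidHom V c).comp g
      map_zero' := by ext m; simp
      map_add' := fun c d => by ext m; simp [add_smul] }
    (fun t c m => by simp [hg, smul_smul, Algebra.smul_def, mul_comm])

lemma redLift_red {V : Type*} [AddCommGroup V] [Module ℂ V] (g : M.carrier →+ V)
    (hg : ∀ (t : T) m, g (t • m) = algebraMap T ℂ t • g m) (m : M.carrier) :
    redLift g hg (M.red m) = g m := by
  change (1 : ℂ) • g m = g m
  rw [one_smul]

lemma redLift_smul {V : Type*} [AddCommGroup V] [Module ℂ V] (g : M.carrier →+ V)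
    (hg : ∀ (t : T) m, g (t • m) = algebraMap T ℂ t • g m) (c : ℂ) (z : (M.baseChange ℂ).carrier) :
    redLift g hg (c • z) = c • redLift g hg z := by
  obtain ⟨m, rfl⟩ := red_surjective z
  have h := red_smul (algebraMap ℂ T c) m
  rw [residue_algebraMap] at h
  rw [← h, redLift_red, redLift_red, hg, residue_algebraMap]

/-- Since ℂ is T modulo the kernel, ℂ ⊗ M is the quotient of M by that kernel. The quotient gets its
ℂ-structure through ℂ → T, and the quotient map factors through the reduction. -/
lemma red_eq_zero {m : M.carrier} :
    M.red m = 0 ↔ m ∈ RingHom.ker (algebraMap T ℂ) • (⊤ : Submodule T M.carrier) := by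
  constructor
  · intro h
    let _ : Module ℂ (M.carrier ⧸ RingHom.ker (algebraMap T ℂ) • (⊤ : Submodule T M.carrier)) :=
      Module.compHom _ (algebraMap ℂ T)
    have h1 := redLift_red (M := M)
      (RingHom.ker (algebraMap T ℂ) • (⊤ : Submodule T M.carrier)).mkQ.toAddMonoidHom
      (fun t m => by
        change (RingHom.ker (algebraMap T ℂ) • (⊤ : Submodule T M.carrier)).mkQ (t • m) =
          algebraMap ℂ T (algebraMap T ℂ t) •
            (RingHom.ker (algebraMap T ℂ) • (⊤ : Submodule T M.carrier)).mkQ m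
        rw [← map_smul, ← sub_eq_zero, ← map_sub, ← sub_smul, Submodule.mkQ_apply,
          Submodule.Quotient.mk_eq_zero]
        refine Submodule.smul_mem_smul ?_ trivial
        rw [RingHom.mem_ker, map_sub, residue_algebraMap, sub_self]) m
    rw [h, map_zero] at h1
    exact (Submodule.Quotient.mk_eq_zero _).mp h1.symm
  · intro h
    induction h using Submodule.smul_induction_on' with
    | smul t ht m _ => rw [red_smul, RingHom.mem_ker.mp ht, zero_smul]
    | add a _ b _ ha hb => rw [map_add, ha, hb, add_zero]

/-- Morphisms out of the reduction. -/
def Hom.redLift {N : Bimod.{u, 0, w} 𝔤 ℂ} (g : M.carrier →+ N.carrier)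
    (hg : ∀ (t : T) m, g (t • m) = algebraMap T ℂ t • g m)
    (ha : ∀ x m, g (M.act x m) = N.act x (g m)) : Hom (M.baseChange ℂ) N :=
  Hom.ofAddMonoidHom (Bimod.redLift g hg) (redLift_smul g hg) (fun x z => by
    obtain ⟨m, rfl⟩ := red_surjective z
    rw [← red_act, redLift_red, redLift_red, ha])

lemma Hom.redLift_red {N : Bimod.{u, 0, w} 𝔤 ℂ} (g : M.carrier →+ N.carrier)
    (hg : ∀ (t : T) m, g (t • m) = algebraMap T ℂ t • g m)
    (ha : ∀ x m, g (M.act x m) = N.act x (g m)) (m : M.carrier) :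
    (Hom.redLift g hg ha).1 (M.red m) = g m := Bimod.redLift_red g hg m

/-- Functoriality of the reduction. -/
def Hom.reduce (f : Hom M N) : Hom (M.baseChange ℂ) (N.baseChange ℂ) :=
  Hom.redLift (N.red.comp f.1.toAddMonoidHom)
    (fun t m => by
      simp only [AddMonoidHom.comp_apply, LinearMap.toAddMonoidHom_coe, map_smul, red_smul])
    (fun x m => by
      simp only [AddMonoidHom.comp_apply, LinearMap.toAddMonoidHom_coe, f.2, red_act])

lemma Hom.reduce_red (f : Hom M N) (m : M.carrier) : f.reduce.1 (M.red m) = N.red (f.1 m) :=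
  Hom.redLift_red _ _ _ m

lemma IsSummand.reduce (h : IsSummand M N) : IsSummand (M.baseChange ℂ) (N.baseChange ℂ) := by
  obtain ⟨i, p, hip⟩ := h
  refine ⟨i.reduce, p.reduce, fun z => ?_⟩
  obtain ⟨m, rfl⟩ := red_surjective z
  rw [Hom.reduce_red, Hom.reduce_red, hip]

/-- Functoriality of the reduction. -/
def Iso.reduce (e : Iso M N) : Iso (M.baseChange ℂ) (N.baseChange ℂ) :=
  Iso.ofInverse e.toHom.reduce e.symm.toHom.reduce
    (fun z => by
      obtain ⟨m, rfl⟩ := red_surjective z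
      rw [Hom.reduce_red, Hom.reduce_red, Iso.toHom_apply, Iso.toHom_apply, Iso.symm_apply_apply])
    (fun z => by
      obtain ⟨m, rfl⟩ := red_surjective z
      rw [Hom.reduce_red, Hom.reduce_red, Iso.toHom_apply, Iso.toHom_apply, Iso.apply_symm_apply])

lemma Iso.reduce_red (e : Iso M N) (m : M.carrier) : e.reduce.1 (M.red m) = N.red (e.1 m) :=
  Hom.reduce_red e.toHom m

/-- The reduction of a tensor product. -/
lemma nonempty_iso_reduce_tensor (M : Bimod.{u, v, w} 𝔤 T) (E : Type w) [AddCommGroup E]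
    [Module ℂ E] [LieRingModule 𝔤 E] [LieModule ℂ 𝔤 E] :
    Nonempty (Iso ((M.tensor E).baseChange ℂ) ((M.baseChange ℂ).tensor E)) := by
  have hg : ∀ (t : T) (m : M.carrier) (e : E), pure (M.baseChange ℂ) E (M.red (t • m)) e =
      algebraMap T ℂ t • pure (M.baseChange ℂ) E (M.red m) e := fun t m e => by
    rw [red_smul, pure_smul]
  have hA₀ : ∃ A₀ : (M.tensor E).carrier →+ ((M.baseChange ℂ).tensor E).carrier,
      (∀ (t : T) z, A₀ (t • z) = algebraMap T ℂ t • A₀ z) ∧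
      ∀ m e, A₀ (pure M E m e) = pure (M.baseChange ℂ) E (M.red m) e :=
    ⟨tensorLift ((pure (M.baseChange ℂ) E).comp M.red) (fun c m e => by
        simp only [AddMonoidHom.comp_apply]
        rw [hg, residue_algebraMap, pure_complex_smul]; rfl),
      tensorLift_smul (algebraMap T ℂ) _ _ hg, fun m e => rfl⟩
  obtain ⟨A₀, hs, hp⟩ := hA₀
  let A : Hom ((M.tensor E).baseChange ℂ) ((M.baseChange ℂ).tensor E) := Hom.redLift A₀ hs
    (fun x z => by
      induction z using tensor_induction with
      | hz => simp only [map_zero]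
      | hp m e => rw [act_pure, map_add, hp, hp, hp, act_pure, red_act]
      | ha a b ha hb => simp only [map_add, ha, hb])
  have hA : ∀ m e, A.1 ((M.tensor E).red (pure M E m e)) = pure (M.baseChange ℂ) E (M.red m) e :=
    fun m e => (Hom.redLift_red _ _ _ _).trans (hp m e)
  have hK : ∀ e : E, ∃ K : (M.baseChange ℂ).carrier →+ ((M.tensor E).baseChange ℂ).carrier,
      (∀ m, K (M.red m) = (M.tensor E).red (pure M E m e)) := fun e =>
    ⟨redLift ((M.tensor E).red.comp ((pure M E).flip e)) (fun t m => by
      simp only [AddMonoidHom.comp_apply, AddMonoidHom.flip_apply, pure_smul, red_smul]),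
      fun m => redLift_red _ _ m⟩
  choose K hK using hK
  have hK0 : K 0 = 0 := by
    ext z
    obtain ⟨m, rfl⟩ := red_surjective z
    rw [hK, map_zero, map_zero]; rfl
  have hKadd : ∀ e f, K (e + f) = K e + K f := fun e f => by
    ext z
    obtain ⟨m, rfl⟩ := red_surjective z
    rw [AddMonoidHom.add_apply, hK, hK, hK, map_add, map_add]
  let B : Hom ((M.baseChange ℂ).tensor E) ((M.tensor E).baseChange ℂ) := Hom.tensorLift
    (AddMonoidHom.flip ⟨⟨K, hK0⟩, hKadd⟩)
    (fun c z e => by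
      change K e (c • z) = c • K e z
      obtain ⟨m, rfl⟩ := red_surjective z
      have h := red_smul (algebraMap ℂ T c) m
      rw [residue_algebraMap] at h
      rw [← h, hK, hK, pure_smul, red_smul, residue_algebraMap])
    (fun c z e => by
      change K (c • e) z = c • K e z
      obtain ⟨m, rfl⟩ := red_surjective z
      rw [hK, hK, pure_complex_smul, red_smul, residue_algebraMap])
    (fun x z e => by
      change K e ((M.baseChange ℂ).act x z) + K ⁅x, e⁆ z =
        ((M.tensor E).baseChange ℂ).act x (K e z)
      obtain ⟨m, rfl⟩ := red_surjective z
      rw [← red_act, hK, hK, hK, ← red_act, act_pure, map_add])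
  have hB : ∀ m e, B.1 (pure (M.baseChange ℂ) E (M.red m) e) =
      (M.tensor E).red (pure M E m e) := fun m e => hK e m
  refine ⟨Iso.ofInverse A B (fun z => ?_) (Hom.tensor_ext (f := A.comp B) (g := Hom.id _)
    fun z e => ?_)⟩
  · obtain ⟨z, rfl⟩ := red_surjective z
    induction z using tensor_induction with
    | hz => simp only [map_zero]
    | hp m e => rw [hA, hB]
    | ha a b ha hb => simp only [map_add, ha, hb]
  · obtain ⟨m, rfl⟩ := red_surjective z
    rw [Hom.comp_apply, hB, hA]; rfl

end Bimod

/-! ### Homomorphisms out of Verma modules -/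

section Verma

variable {𝔤 : Type u} [LieRing 𝔤] [LieAlgebra ℂ 𝔤] [FiniteDimensional ℂ 𝔤]
  [LieAlgebra.IsSemisimple ℂ 𝔤] {T : Type v} [CommRing T] [Algebra ℂ T]
  {𝔥 𝔟 𝔟' : LieSubalgebra ℂ 𝔤} {φ : SymmetricAlgebra ℂ 𝔥 →ₐ[ℂ] T}
  {μ : Module.Dual ℂ 𝔥}

/-- The universal property of Verma modules, for maps that are semilinear along `σ`. -/
theorem exists_addMonoidHom_verma {T' : Type*} [CommRing T'] [Algebra ℂ T'] (σ : T →ₐ[ℂ] T')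
    (N : Bimod.{u, _, w} 𝔤 T') (n : N.carrier)
    (hn : ∀ (H : 𝔥), ∀ X ∈ commutant 𝔟, N.act ((H : 𝔤) + X) n = σ (weightScalar φ μ H) • n) :
    ∃ g : (verma 𝔟 φ μ).carrier →+ N.carrier, (∀ (t : T) m, g (t • m) = σ t • g m) ∧
      (∀ x m, g ((verma 𝔟 φ μ).act x m) = N.act x (g m)) ∧ g (vermaGen 𝔟 φ μ) = n := by
  let G₀ : T ⊗[ℂ] 𝐔 𝔤 →+ N.carrier := TensorProduct.liftAddHom
    { toFun := fun t =>
        { toFun := fun a => σ t • N.uact a n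
          map_zero' := by rw [map_zero, LinearMap.zero_apply, smul_zero]
          map_add' := fun a b => by rw [map_add, LinearMap.add_apply, smul_add] }
      map_zero' := by ext a; simp
      map_add' := fun s t => by ext a; simp [add_smul] }
    (fun c t a => by
      simp only [AddMonoidHom.coe_mk, ZeroHom.coe_mk]
      rw [Bimod.uact_smul, map_smul, smul_smul, Algebra.smul_def, mul_comm])
  have hG₀ : ∀ t a, G₀ (t ⊗ₜ a) = σ t • N.uact a n := fun t a => rfl
  let G : T ⊗[ℂ] 𝐔 𝔤 →ₛₗ[(σ : T →+* T')] N.carrier :=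
    { G₀ with
      map_smul' := fun t z => by
        change G₀ (t • z) = σ t • G₀ z
        induction z with
        | zero => rw [smul_zero, map_zero, smul_zero]
        | tmul s a => rw [TensorProduct.smul_tmul', hG₀, hG₀, smul_eq_mul, map_mul, mul_smul]
        | add a b ha hb => rw [smul_add, map_add, map_add, smul_add, ha, hb] }
  have hG : ∀ t a, G (t ⊗ₜ a) = σ t • N.uact a n := fun t a => rfl
  have hle : vermaRel 𝔟 φ μ ≤ LinearMap.ker G := by
    rw [vermaRel, Submodule.span_le]
    rintro _ ⟨t, a, H, X, hX, rfl⟩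
    rw [SetLike.mem_coe, LinearMap.mem_ker, map_sub, hG, hG, Bimod.uact_mul, Bimod.uact_ι,
      hn H X hX, map_smul, smul_smul, map_mul, mul_comm, sub_self]
  let g : (verma 𝔟 φ μ).carrier →ₛₗ[(σ : T →+* T')] N.carrier := (vermaRel 𝔟 φ μ).liftQ G hle
  have hg : ∀ z, g (vermaMk 𝔟 φ μ z) = G z := fun z => rfl
  refine ⟨g.toAddMonoidHom, fun t m => g.map_smulₛₗ t m, fun x m => ?_, ?_⟩
  · change g _ = N.act x (g m)
    obtain ⟨z, rfl⟩ := vermaMk_surjective m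
    induction z with
    | zero => simp only [map_zero]
    | tmul t a =>
      rw [verma_act_mk, hg, hg, hG, hG, Bimod.uact_mul, Bimod.uact_ι, map_smul]
    | add a b ha hb => simp only [map_add, ha, hb]
  · change g (vermaGen 𝔟 φ μ) = n
    rw [vermaGen_eq, hg, hG, map_one, one_smul, map_one]
    rfl

lemma verma_ext {T' : Type*} [CommRing T'] [Algebra ℂ T'] (σ : T →+* T')
    {N : Bimod.{u, _, w} 𝔤 T'} {g h : (verma 𝔟 φ μ).carrier →+ N.carrier}
    (hgs : ∀ (t : T) m, g (t • m) = σ t • g m) (hhs : ∀ (t : T) m, h (t • m) = σ t • h m)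
    (hga : ∀ x m, g ((verma 𝔟 φ μ).act x m) = N.act x (g m))
    (hha : ∀ x m, h ((verma 𝔟 φ μ).act x m) = N.act x (h m))
    (hgen : g (vermaGen 𝔟 φ μ) = h (vermaGen 𝔟 φ μ)) (m : (verma 𝔟 φ μ).carrier) :
    g m = h m := by
  let P : Submodule T (verma 𝔟 φ μ).carrier :=
    { carrier := {m | g m = h m}
      zero_mem' := by simp
      add_mem' := fun {a b} (ha : g a = h a) (hb : g b = h b) => by
        change g (a + b) = h (a + b)
        rw [map_add, map_add, ha, hb]
      smul_mem' := fun t a (ha : g a = h a) => by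
        change g (t • a) = h (t • a)
        rw [hgs, hhs, ha] }
  have hP : P = ⊤ := verma_induction_full (P := P) hgen fun x m (hm : g m = h m) => by
    change g _ = h _
    rw [hga, hha, hm]
  have : m ∈ P := hP ▸ Submodule.mem_top
  exact this

lemma Bimod.Hom.verma_ext {N : Bimod.{u, v, max u v} 𝔤 T} {g h : Bimod.Hom (verma 𝔟 φ μ) N}
    (hgen : g.1 (vermaGen 𝔟 φ μ) = h.1 (vermaGen 𝔟 φ μ)) (m : (verma 𝔟 φ μ).carrier) :
    g.1 m = h.1 m :=
  DeformedO.verma_ext (RingHom.id T) (g := g.1.toAddMonoidHom) (h := h.1.toAddMonoidHom)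
    g.1.map_smul h.1.map_smul g.2 h.2 hgen m

lemma exists_hom_verma (N : Bimod.{u, v, max u v} 𝔤 T) (n : N.carrier)
    (hn : ∀ (H : 𝔥), ∀ X ∈ commutant 𝔟, N.act ((H : 𝔤) + X) n = weightScalar φ μ H • n) :
    ∃ g : Bimod.Hom (verma 𝔟 φ μ) N, g.1 (vermaGen 𝔟 φ μ) = n := by
  obtain ⟨g, hs, ha, hv⟩ := exists_addMonoidHom_verma (AlgHom.id ℂ T) N n hn
  exact ⟨Bimod.Hom.ofAddMonoidHom g hs ha, hv⟩

end Verma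

/-! ### Reduction of Verma and nabla modules -/

section Reduction

variable {𝔤 : Type u} [LieRing 𝔤] [LieAlgebra ℂ 𝔤] [FiniteDimensional ℂ 𝔤]
  [LieAlgebra.IsSemisimple ℂ 𝔤] {T : Type u} [CommRing T] [Algebra ℂ T]
  [Algebra T ℂ] [IsScalarTower ℂ T ℂ]
  {𝔥 𝔟 𝔟' : LieSubalgebra ℂ 𝔤} {φ : SymmetricAlgebra ℂ 𝔥 →ₐ[ℂ] T}
  {μ : Module.Dual ℂ 𝔥}

lemma weightScalar_evalZero (H : 𝔥) : weightScalar (evalZero 𝔥) μ H = μ H := by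
  simp [weightScalar, evalZero]

lemma residue_weightScalar (hφ : ∀ H, algebraMap T ℂ (φ (SymmetricAlgebra.ι ℂ 𝔥 H)) = 0) (H : 𝔥) :
    algebraMap T ℂ (weightScalar φ μ H) = weightScalar (evalZero 𝔥) μ H := by
  rw [weightScalar_evalZero, weightScalar, map_add, hφ, add_zero, Bimod.residue_algebraMap]

/-- The reduction of a Verma module. -/
theorem exists_iso_reduce_verma
    (hφ : ∀ H, algebraMap T ℂ (φ (SymmetricAlgebra.ι ℂ 𝔥 H)) = 0) (μ : Module.Dual ℂ 𝔥) :
    ∃ e : Bimod.Iso ((verma 𝔟 φ μ).baseChange ℂ) (verma 𝔟 (evalZero 𝔥) μ),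
      e.1 ((verma 𝔟 φ μ).red (vermaGen 𝔟 φ μ)) = vermaGen 𝔟 (evalZero 𝔥) μ := by
  obtain ⟨g, hs, ha, hv⟩ := exists_addMonoidHom_verma (𝔟 := 𝔟) (φ := φ) (μ := μ)
    (IsScalarTower.toAlgHom ℂ T ℂ) (verma 𝔟 (evalZero 𝔥) μ) (vermaGen 𝔟 (evalZero 𝔥) μ)
    (fun H X hX => by
      rw [verma_act_gen H hX, IsScalarTower.toAlgHom_apply, residue_weightScalar hφ])
  let A : Bimod.Hom ((verma 𝔟 φ μ).baseChange ℂ) (verma 𝔟 (evalZero 𝔥) μ) :=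
    Bimod.Hom.redLift g hs ha
  have hA : ∀ m, A.1 ((verma 𝔟 φ μ).red m) = g m := Bimod.Hom.redLift_red g hs ha
  obtain ⟨B, hB⟩ := exists_hom_verma (𝔟 := 𝔟) (φ := evalZero 𝔥) (μ := μ)
    ((verma 𝔟 φ μ).baseChange ℂ) ((verma 𝔟 φ μ).red (vermaGen 𝔟 φ μ)) (fun H X hX => by
      rw [← Bimod.red_act, verma_act_gen H hX, Bimod.red_smul, residue_weightScalar hφ])
  refine ⟨Bimod.Iso.ofInverse A B (fun z => ?_) (Bimod.Hom.verma_ext (g := A.comp B)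
    (h := Bimod.Hom.id _) ?_), ?_⟩
  · obtain ⟨m, rfl⟩ := Bimod.red_surjective z
    refine verma_ext (algebraMap T ℂ) (N := (verma 𝔟 φ μ).baseChange ℂ)
      (g := (B.comp A).1.toAddMonoidHom.comp (verma 𝔟 φ μ).red) (h := (verma 𝔟 φ μ).red)
      (fun t m => ?_) Bimod.red_smul (fun x m => ?_) Bimod.red_act ?_ m
    · simp only [AddMonoidHom.comp_apply, LinearMap.toAddMonoidHom_coe, Bimod.red_smul, map_smul]
    · simp only [AddMonoidHom.comp_apply, LinearMap.toAddMonoidHom_coe, Bimod.red_act,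
        (B.comp A).2]
    · change B.1 (A.1 _) = _
      rw [hA, hv, hB]
  · rw [Bimod.Hom.comp_apply, hB, hA, hv]
    rfl
  · exact (hA _).trans hv

variable [𝔥.IsCartanSubalgebra]

/-- The reduction of a nabla module. -/
theorem exists_iso_reduce_nabla (D : Triangular 𝔥 𝔟 𝔟')
    (hφ : ∀ H, algebraMap T ℂ (φ (SymmetricAlgebra.ι ℂ 𝔥 H)) = 0) (μ : Module.Dual ℂ 𝔥) :
    ∃ e : Bimod.Iso ((nabla 𝔟' φ μ).baseChange ℂ) (nabla 𝔟' (evalZero 𝔥) μ),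
      ∀ f, nablaEval 𝔟' (evalZero 𝔥) μ (e.1 ((nabla 𝔟' φ μ).red f)) =
        algebraMap T ℂ (nablaEval 𝔟' φ μ f) := by
  have hF : ∀ f : (nabla 𝔟' φ μ).carrier, ∃ g : (nabla 𝔟' (evalZero 𝔥) μ).carrier,
      ∀ a, nablaVal g a = algebraMap T ℂ (nablaVal f a) := by
    intro f
    -- Compose the form with T → ℂ; the characters match because φ vanishes in the residue field.
    let g : (coind 𝔟' (evalZero 𝔥) μ).carrier :=
      ⟨(IsScalarTower.toAlgHom ℂ T ℂ).toLinearMap ∘ₗ nablaVal f, fun H X hX a => by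
        have h1 : nablaVal f (ιU ((H : 𝔤) + X) * a) = weightScalar φ μ H * nablaVal f a :=
          f.1.2 H X hX a
        rw [LinearMap.comp_apply, h1, LinearMap.comp_apply, AlgHom.toLinearMap_apply, map_mul,
          AlgHom.toLinearMap_apply]
        congr 1
        exact residue_weightScalar hφ H⟩
    have hg : ∀ a, coindVal g a = algebraMap T ℂ (nablaVal f a) := fun a => rfl
    refine ⟨⟨g, (mem_iSup_weightSpace_coind D).mpr ?_⟩, hg⟩
    refine ((mem_iSup_weightSpace_coind D).mp f.2).subset fun t ht h0 => ht ?_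
    rw [hg]
    have h0' : nablaVal f (D.mon t) = 0 := h0
    rw [h0', map_zero]
  choose F hF using hF
  let G : (nabla 𝔟' φ μ).carrier →+ (nabla 𝔟' (evalZero 𝔥) μ).carrier :=
    { toFun := F
      map_zero' := nablaVal_injective (LinearMap.ext fun a => by
        rw [hF, map_zero, map_zero, LinearMap.zero_apply, LinearMap.zero_apply, map_zero])
      map_add' := fun f g => nablaVal_injective (LinearMap.ext fun a => by
        rw [hF, map_add, map_add, LinearMap.add_apply, LinearMap.add_apply, map_add, hF, hF]) }
  have hG : ∀ f a, nablaVal (G f) a = algebraMap T ℂ (nablaVal f a) := hF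
  let A : Bimod.Hom ((nabla 𝔟' φ μ).baseChange ℂ) (nabla 𝔟' (evalZero 𝔥) μ) :=
    Bimod.Hom.redLift G
      (fun t f => nablaVal_injective (LinearMap.ext fun a => by
        rw [hG, map_smul, map_smul, LinearMap.smul_apply, LinearMap.smul_apply, hG, smul_eq_mul,
          smul_eq_mul, map_mul]))
      (fun x f => nablaVal_injective (LinearMap.ext fun a => by
        rw [hG, nablaVal_act, nablaVal_act, hG]))
  have hA : ∀ f, A.1 ((nabla 𝔟' φ μ).red f) = G f := Bimod.Hom.redLift_red _ _ _
  refine ⟨Bimod.Iso.ofBijective A ⟨?_, ?_⟩, fun f => ?_⟩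
  · rw [injective_iff_map_eq_zero]
    intro z hz
    obtain ⟨f, rfl⟩ := Bimod.red_surjective z
    rw [hA] at hz
    rw [Bimod.red_eq_zero]
    refine nabla_mem_smul_top D fun t => ?_
    rw [RingHom.mem_ker, nablaCoord_apply, ← hG, hz, map_zero, LinearMap.zero_apply]
  · intro g
    let c := nablaCoord D (evalZero 𝔥) μ g
    -- A preimage is found by lifting the coordinates along ℂ → T.
    refine ⟨(nabla 𝔟' φ μ).red ((nablaCoord D φ μ).symm
      (c.mapRange (algebraMap ℂ T) (map_zero _))), ?_⟩
    rw [hA]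
    apply (nablaCoord D (evalZero 𝔥) μ).injective
    ext t
    rw [nablaCoord_apply, hG, ← nablaCoord_apply, LinearEquiv.apply_symm_apply,
      Finsupp.mapRange_apply, Bimod.residue_algebraMap]
  · refine (congrArg (nablaEval 𝔟' (evalZero 𝔥) μ) (hA f)).trans ?_
    rw [nablaEval_eq, nablaEval_eq, hG]

end Reduction

/-! ### A graded form of Nakayama's lemma -/

/-- The whole sum need not be finitely generated, but each piece is. Independence isolates the
`i`-th component of the inclusion, and the usual lemma of Nakayama applies there. -/
lemma le_of_iSup_le_sup_smul {T V ι : Type*} [CommRing T] [AddCommGroup V] [Module T V]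
    {N A : ι → Submodule T V} (hind : iSupIndep N) (hfg : ∀ i, (N i).FG) (hA : ∀ i, A i ≤ N i)
    {J : Ideal T} (hJ : J ≤ Ideal.jacobson ⊥) (h : ⨆ i, N i ≤ (⨆ i, A i) ⊔ J • ⨆ i, N i) (i : ι) :
    N i ≤ A i := by
  have h1 : ⨆ i, N i ≤ ⨆ i, (A i ⊔ J • N i) := by
    rw [iSup_sup_eq]
    rwa [Submodule.smul_iSup] at h
  have hB : ∀ i, A i ⊔ J • N i ≤ N i := fun i => sup_le (hA i) Submodule.smul_le_right
  refine Submodule.le_of_le_smul_of_le_jacobson_bot (hfg i) hJ fun x hx => ?_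
  have h2 : x ∈ (A i ⊔ J • N i) ⊔ ⨆ j, ⨆ (_ : j ≠ i), N j := by
    refine (iSup_le fun j => ?_ : ⨆ j, (A j ⊔ J • N j) ≤ _) (h1 (Submodule.mem_iSup_of_mem i hx))
    by_cases hj : j = i
    · rw [hj]; exact le_sup_left
    · exact (hB j).trans ((le_iSup₂ (f := fun j (_ : j ≠ i) => N j) j hj).trans le_sup_right)
  obtain ⟨b, hb, c, hc, rfl⟩ := Submodule.mem_sup.mp h2
  have hc' : c ∈ N i := by
    have := Submodule.sub_mem _ hx (hB i hb)
    rwa [add_sub_cancel_left] at this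
  have hc0 : c = 0 := Submodule.disjoint_def.mp (hind i) c hc' hc
  rw [hc0, add_zero]
  exact hb

/-! ### Independence of weight spaces -/

section Independence

variable {𝔤 : Type u} [LieRing 𝔤] [LieAlgebra ℂ 𝔤] [FiniteDimensional ℂ 𝔤]
  [LieAlgebra.IsSemisimple ℂ 𝔤] {T : Type v} [CommRing T] [Algebra ℂ T]
  {𝔥 : LieSubalgebra ℂ 𝔤} {φ : SymmetricAlgebra ℂ 𝔥 →ₐ[ℂ] T}

/-- A product of operators H - (κ + φ)(H) over κ in `s`, each H chosen to separate κ from ν. On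
weight ν every factor is a nonzero complex number, hence a unit, so weights separate over T without
inverting anything else. -/
lemma exists_weight_operator (M : Bimod.{u, v, w} 𝔤 T) (ν : Module.Dual ℂ 𝔥)
    (s : Finset (Module.Dual ℂ 𝔥)) (hs : ν ∉ s) :
    ∃ (L : Module.End T M.carrier) (a : Module.Dual ℂ 𝔥 → T),
      (∀ κ, ∀ m ∈ weightSpace φ M κ, L m = a κ • m) ∧ (∀ κ ∈ s, a κ = 0) ∧ IsUnit (a ν) := by
  classical
  induction s using Finset.induction_on with
  | empty => exact ⟨1, fun _ => 1, by simp, by simp, isUnit_one⟩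
  | insert κ s _ ih =>
    rw [Finset.mem_insert, not_or] at hs
    obtain ⟨L, a, hL, h0, hu⟩ := ih hs.2
    obtain ⟨H, hH⟩ : ∃ H, (ν - κ) H ≠ 0 := by
      by_contra! h
      exact hs.1 (sub_eq_zero.mp (LinearMap.ext h))
    refine ⟨L * (M.act (H : 𝔤) - weightScalar φ κ H • 1),
      fun ξ => (weightScalar φ ξ H - weightScalar φ κ H) * a ξ, fun ξ m hm => ?_, fun ξ hξ => ?_,
      ?_⟩
    · rw [Module.End.mul_apply, LinearMap.sub_apply, hm H, LinearMap.smul_apply,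
        Module.End.one_apply, ← sub_smul, map_smul, hL ξ m hm, smul_smul]
    · rcases Finset.mem_insert.mp hξ with rfl | h
      · simp
      · simp [h0 ξ h]
    · simp only [weightScalar_sub]
      exact ((IsUnit.mk0 _ hH).map _).mul hu

lemma iSupIndep_weightSpace (M : Bimod.{u, v, w} 𝔤 T) : iSupIndep (weightSpace φ M) := by
  classical
  intro ν
  rw [Submodule.disjoint_def]
  intro x hx hx'
  obtain ⟨s, hs⟩ := Submodule.mem_iSup_iff_exists_finset.mp hx'
  obtain ⟨L, a, hL, h0, hu⟩ := exists_weight_operator (φ := φ) M ν (s.erase ν)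
    (Finset.notMem_erase ν s)
  have h1 : ⨆ i ∈ s, ⨆ (_ : i ≠ ν), weightSpace φ M i ≤ LinearMap.ker L := by
    refine iSup₂_le fun κ hκ => iSup_le fun hne m hm => ?_
    rw [LinearMap.mem_ker, hL κ m hm, h0 κ (Finset.mem_erase.mpr ⟨hne, hκ⟩), zero_smul]
  have h2 : a ν • x = 0 := (hL ν x hx).symm.trans (h1 hs)
  exact (hu.smul_eq_zero).mp h2

end Independence

/-! ### Weight spaces of Verma modules -/

section Verma

variable {𝔤 : Type u} [LieRing 𝔤] [LieAlgebra ℂ 𝔤] [FiniteDimensional ℂ 𝔤]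
  [LieAlgebra.IsSemisimple ℂ 𝔤] {T : Type v} [CommRing T] [Algebra ℂ T]
  {𝔥 𝔟 𝔟' : LieSubalgebra ℂ 𝔤} {φ : SymmetricAlgebra ℂ 𝔥 →ₐ[ℂ] T}
  {μ : Module.Dual ℂ 𝔥}

/-- The triangular decomposition with the roles of the Borel subalgebras exchanged. -/
def Triangular.symm (D : Triangular 𝔥 𝔟 𝔟') : Triangular 𝔥 𝔟' 𝔟 where
  le := D.le'
  le' := D.le
  pos := D.neg
  neg := D.pos
  isCompl := D.isCompl'
  isCompl' := D.isCompl
  sup_eq := D.sup_eq'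
  sup_eq' := D.sup_eq

lemma Triangular.ι_mul_mon_mem (D : Triangular 𝔥 𝔟 𝔟') {X : 𝔤} (hX : X ∈ commutant 𝔟)
    (t : Multiset D.pos.I) : ιU X * D.mon t ∈ Submodule.span ℂ (Set.range D.mon) := by
  let 𝔫 := commutantSubalgebra 𝔟
  have hvec : ∀ i, D.pos.vec i ∈ 𝔫 := fun i => by
    have : D.pos.vec i ∈ commutant 𝔟 := D.pos.span_eq.le (Submodule.subset_span ⟨i, rfl⟩)
    exact this
  let y : D.pos.I → 𝔫 := fun i => ⟨D.pos.vec i, hvec i⟩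
  have hy : Submodule.span ℂ (Set.range y) = ⊤ := by
    have h1 : (Submodule.span ℂ (Set.range y)).map 𝔫.toSubmodule.subtype = 𝔫.toSubmodule := by
      rw [Submodule.map_span, ← Set.range_comp]
      exact D.pos.span_eq
    rw [eq_top_iff]
    rintro ⟨x, hx⟩ -
    have hx' : x ∈ 𝔫.toSubmodule := hx
    rw [← h1] at hx'
    obtain ⟨z, hz, rfl⟩ := hx'
    exact hz
  have h1 := PBW.span_words (K := ℂ) hy Multiset.toList (fun s => ⟨s, by simp⟩)
  have h2 : ιU ⟨X, hX⟩ * PBW.word y t.toList ∈ Submodule.span ℂ (Set.range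
    fun s : Multiset D.pos.I => PBW.word (K := ℂ) y s.toList) := h1.ge Submodule.mem_top
  have h3 := Submodule.mem_map_of_mem (f := (envelopingIncl 𝔫).toLinearMap) h2
  rw [Submodule.map_span, ← Set.range_comp, AlgHom.toLinearMap_apply, map_mul, envelopingIncl_ι,
    envelopingIncl_word] at h3
  refine Submodule.span_mono ?_ h3
  rintro _ ⟨s, rfl⟩
  exact ⟨s, (envelopingIncl_word 𝔫 y _).symm⟩

lemma verma_act_cartan_mon (D : Triangular 𝔥 𝔟 𝔟') (s : Multiset D.neg.I) :
    (verma 𝔟 φ μ).uact (D.symm.mon s) (vermaGen 𝔟 φ μ) ∈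
      weightSpace φ (verma 𝔟 φ μ) (μ + D.symm.monWt s) := fun H => by
  rw [← Bimod.uact_ι, ← Bimod.uact_mul, D.symm.ι_mul_mon H s, map_add, LinearMap.add_apply,
    Bimod.uact_mul, Bimod.uact_ι, verma_act_cartan_gen, map_smul, Bimod.uact_smul, ← add_smul]
  congr 1
  simp only [weightScalar, LinearMap.add_apply, map_add]
  ring

/-- A finitely generated piece of a weight space of the Verma module. -/
def vermaPiece (D : Triangular 𝔥 𝔟 𝔟') (φ : SymmetricAlgebra ℂ 𝔥 →ₐ[ℂ] T)
    (μ ν : Module.Dual ℂ 𝔥) : Submodule T (verma 𝔟 φ μ).carrier :=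
  Submodule.span T ((fun s => (verma 𝔟 φ μ).uact (D.symm.mon s) (vermaGen 𝔟 φ μ)) ''
    {s | D.symm.monWt s = ν - μ})

/-- The reason to work with pieces given by generators: finite generation is immediate even if T is
not noetherian, and by `iSup_vermaPiece` they exhaust Δ(μ). -/
lemma vermaPiece_fg (D : Triangular 𝔥 𝔟 𝔟') (ν : Module.Dual ℂ 𝔥) : (vermaPiece D φ μ ν).FG :=
  Submodule.fg_span ((D.symm.finite_monWt _).image _)

lemma vermaPiece_le (D : Triangular 𝔥 𝔟 𝔟') (ν : Module.Dual ℂ 𝔥) :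
    vermaPiece D φ μ ν ≤ weightSpace φ (verma 𝔟 φ μ) ν := by
  rw [vermaPiece, Submodule.span_le]
  rintro _ ⟨s, hs, rfl⟩
  have := verma_act_cartan_mon (φ := φ) (μ := μ) D s
  rwa [show D.symm.monWt s = ν - μ from hs, add_sub_cancel] at this

lemma iSup_vermaPiece (D : Triangular 𝔥 𝔟 𝔟') : ⨆ ν, vermaPiece D φ μ ν = ⊤ := by
  have h0 : ∀ s, (verma 𝔟 φ μ).uact (D.symm.mon s) (vermaGen 𝔟 φ μ) ∈
      ⨆ ν, vermaPiece D φ μ ν := fun s =>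
    Submodule.mem_iSup_of_mem (μ + D.symm.monWt s)
      (Submodule.subset_span ⟨s, by simp, rfl⟩)
  refine verma_induction D ?_ ?_
  · have := h0 0
    rwa [Triangular.mon_zero, map_one, Module.End.one_apply] at this
  · intro y hy m hm
    obtain ⟨H, X, hX, rfl⟩ := D.exists_add hy
    rw [map_add, LinearMap.add_apply]
    induction hm using Submodule.iSup_induction' with
    | mem ν m hm =>
      refine add_mem ?_ ?_
      · rw [vermaPiece_le D ν hm H]
        exact Submodule.smul_mem _ _ (Submodule.mem_iSup_of_mem ν hm)
      · rw [vermaPiece] at hm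
        induction hm using Submodule.span_induction with
        | mem m h =>
          obtain ⟨s, -, rfl⟩ := h
          simp only
          rw [← Bimod.uact_ι, ← Bimod.uact_mul]
          have h1 := D.symm.ι_mul_mon_mem hX s
          generalize ιU X * D.symm.mon s = a at h1
          induction h1 using Submodule.span_induction with
          | mem a h => obtain ⟨r, rfl⟩ := h; exact h0 r
          | zero => rw [map_zero]; exact zero_mem _
          | add a b _ _ ha hb => rw [map_add]; exact add_mem ha hb
          | smul c a _ ha => rw [Bimod.uact_smul]; exact Submodule.smul_mem _ _ ha
        | zero => rw [map_zero]; exact zero_mem _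
        | add a b _ _ ha hb => rw [map_add]; exact add_mem ha hb
        | smul c a _ ha => rw [map_smul]; exact Submodule.smul_mem _ _ ha
    | zero => simp only [map_zero, add_zero]; exact zero_mem _
    | add a b _ _ ha hb =>
      rw [map_add, map_add, add_add_add_comm]
      exact add_mem ha hb

/-! ### The canonical map -/

variable [𝔥.IsCartanSubalgebra]

/-- The generator goes to the form that is 1 on the trivial monomial and 0 on the others. The
commutant of 𝔟 kills it because a monomial times an element of the commutant has no constant term.
-/
lemma exists_canonicalMap (D : Triangular 𝔥 𝔟 𝔟') (φ : SymmetricAlgebra ℂ 𝔥 →ₐ[ℂ] T)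
    (μ : Module.Dual ℂ 𝔥) : ∃ c : Bimod.Hom (verma 𝔟 φ μ) (nabla 𝔟' φ μ),
      nablaEval 𝔟' φ μ (c.1 (vermaGen 𝔟 φ μ)) = 1 := by
  classical
  let n := (nablaCoord D φ μ).symm (Finsupp.single 0 1)
  have hn : ∀ t, nablaVal n (D.mon t) = if t = 0 then 1 else 0 := fun t => by
    rw [← nablaCoord_apply, LinearEquiv.apply_symm_apply, Finsupp.single_apply]
    simp only [eq_comm]
  obtain ⟨c, hc⟩ := exists_hom_verma (𝔟 := 𝔟) (φ := φ) (μ := μ) (nabla 𝔟' φ μ) n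
    (fun H X hX => by
      apply (nablaCoord D φ μ).injective
      ext t
      have hX0 : nablaVal n (D.mon t * ιU X) = 0 := by
        have h2 := D.mon_mul_mem hX t
        generalize D.mon t * ιU X = z at h2
        induction h2 using Submodule.span_induction with
        | mem z h => obtain ⟨s, hs, rfl⟩ := h; rw [hn, if_neg hs]
        | zero => rw [map_zero]
        | add a b _ _ ha hb => rw [map_add, ha, hb, add_zero]
        | smul c a _ ha => rw [map_smul, ha, smul_zero]
      rw [map_add, LinearMap.add_apply, map_add, Finsupp.add_apply, nablaCoord_act_cartan, map_smul,
        Finsupp.smul_apply, nablaCoord_apply, nablaCoord_apply, nablaVal_act, hX0, add_zero, hn,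
        smul_eq_mul]
      split_ifs with h
      · rw [h]; simp [Triangular.monWt]
      · rw [mul_zero, mul_zero])
  refine ⟨c, ?_⟩
  rw [hc, nablaEval_eq, ← D.mon_zero, hn, if_pos rfl]

/-- The generator must go to weight μ, and by pointedness only the trivial monomial contributes to
that weight of ∇(μ). Hence the canonical map is unique, and its reduction can be recognised. -/
lemma hom_verma_nabla_ext (D : Triangular 𝔥 𝔟 𝔟') {g h : Bimod.Hom (verma 𝔟 φ μ) (nabla 𝔟' φ μ)}
    (hgh : nablaEval 𝔟' φ μ (g.1 (vermaGen 𝔟 φ μ)) = nablaEval 𝔟' φ μ (h.1 (vermaGen 𝔟 φ μ)))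
    (m : (verma 𝔟 φ μ).carrier) : g.1 m = h.1 m := by
  have h1 : ∀ g : Bimod.Hom (verma 𝔟 φ μ) (nabla 𝔟' φ μ), ∀ t, t ≠ 0 →
      nablaCoord D φ μ (g.1 (vermaGen 𝔟 φ μ)) t = 0 := by
    intro g t ht
    by_contra hne
    have h2 : g.1 (vermaGen 𝔟 φ μ) ∈ weightSpace φ (nabla 𝔟' φ μ) μ := fun H => by
      rw [← g.2, verma_act_cartan_gen, map_smul]
    have h3 := (mem_weightSpace_nabla D).mp h2 t hne
    exact ht (D.pos.pointed t (by simpa [Triangular.monWt] using h3))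
  refine Bimod.Hom.verma_ext ((nablaCoord D φ μ).injective (Finsupp.ext fun t => ?_)) m
  by_cases ht : t = 0
  · rw [ht, ← nablaEval_eq_coord, ← nablaEval_eq_coord, hgh]
  · rw [h1 g t ht, h1 h t ht]

lemma nabla_single_mem (D : Triangular 𝔥 𝔟 𝔟') (t : Multiset D.pos.I) :
    (nablaCoord D φ μ).symm (Finsupp.single t 1) ∈
      weightSpace φ (nabla 𝔟' φ μ) (μ - D.monWt t) := by
  classical
  rw [mem_weightSpace_nabla D]
  intro s hs
  rw [LinearEquiv.apply_symm_apply, Finsupp.single_apply] at hs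
  by_cases h : t = s
  · rw [h]
  · rw [if_neg h] at hs; exact absurd rfl hs

lemma iSup_weightSpace_nabla (D : Triangular 𝔥 𝔟 𝔟') :
    ⨆ ν, weightSpace φ (nabla 𝔟' φ μ) ν = ⊤ := by
  refine Submodule.eq_top_iff'.mpr fun f => ?_
  rw [nabla_eq_sum D f]
  exact Submodule.sum_mem _ fun t _ => Submodule.smul_mem _ _
    (Submodule.mem_iSup_of_mem _ (nabla_single_mem D t))

lemma weightSpace_nabla_fg (D : Triangular 𝔥 𝔟 𝔟') (ν : Module.Dual ℂ 𝔥) :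
    (weightSpace φ (nabla 𝔟' φ μ) ν).FG := by
  have h : weightSpace φ (nabla 𝔟' φ μ) ν = Submodule.span T
      ((fun t => (nablaCoord D φ μ).symm (Finsupp.single t 1)) '' {t | D.monWt t = μ - ν}) := by
    refine le_antisymm (fun f hf => ?_) ?_
    · rw [nabla_eq_sum D f]
      refine Submodule.sum_mem _ fun t ht => Submodule.smul_mem _ _
        (Submodule.subset_span ⟨t, ?_, rfl⟩)
      have := (mem_weightSpace_nabla D).mp hf t (Finsupp.mem_support_iff.mp ht)
      change D.monWt t = μ - ν
      rw [← this]; abel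
    · rw [Submodule.span_le]
      rintro _ ⟨t, ht, rfl⟩
      have := nabla_single_mem (φ := φ) (μ := μ) D t
      rwa [show D.monWt t = μ - ν from ht, sub_sub_cancel] at this
  rw [h]
  exact Submodule.fg_span ((D.finite_monWt _).image _)

/-- A homomorphism from a Verma module to a nabla module that is bijective modulo an ideal in the
radical is bijective. -/
theorem bijective_of_bijective_mod (D : Triangular 𝔥 𝔟 𝔟') {J : Ideal T}
    (hJ : J ≤ Ideal.jacobson ⊥) (c : Bimod.Hom (verma 𝔟 φ μ) (nabla 𝔟' φ μ))
    (hsurj : ∀ n, ∃ m, n - c.1 m ∈ J • (⊤ : Submodule T (nabla 𝔟' φ μ).carrier))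
    (hinj : ∀ m, c.1 m = 0 → m ∈ J • (⊤ : Submodule T (verma 𝔟 φ μ).carrier)) :
    Function.Bijective c.1 := by
  have hcw : ∀ ν, (vermaPiece D φ μ ν).map c.1 ≤ weightSpace φ (nabla 𝔟' φ μ) ν := by
    rintro ν _ ⟨m, hm, rfl⟩ H
    rw [← c.2, vermaPiece_le D ν hm H, map_smul]
  -- Surjectivity, weight by weight, with preimages in the pieces.
  have h1 := le_of_iSup_le_sup_smul (iSupIndep_weightSpace (φ := φ) (nabla 𝔟' φ μ))
    (weightSpace_nabla_fg D) hcw hJ (by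
      rw [iSup_weightSpace_nabla D, ← Submodule.map_iSup, iSup_vermaPiece D]
      intro n _
      obtain ⟨m, hm⟩ := hsurj n
      rw [← add_sub_cancel (c.1 m) n]
      exact Submodule.add_mem_sup ⟨m, trivial, rfl⟩ hm)
  choose y hy hcy using fun t => h1 _ (nabla_single_mem (φ := φ) (μ := μ) D t)
  -- As ∇(μ) is free on its coordinates, lifting basis vectors gives a section of `c` that preserves
  -- weights.
  let s : (nabla 𝔟' φ μ).carrier →ₗ[T] (verma 𝔟 φ μ).carrier :=
    Finsupp.linearCombination T y ∘ₗ (nablaCoord D φ μ).toLinearMap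
  have hs : ∀ f, s f = ∑ t ∈ (nablaCoord D φ μ f).support, nablaCoord D φ μ f t • y t :=
    fun f => Finsupp.linearCombination_apply T _
  have hcs : ∀ f, c.1 (s f) = f := fun f => by
    rw [hs, map_sum]
    simp only [map_smul, hcy]
    exact (nabla_eq_sum D f).symm
  -- The projector onto the kernel of `c`. Its image lies in J Δ(μ) by hypothesis, and applying q
  -- once more puts it in J q(Δ(μ)); Nakayama on the pieces then kills it.
  let q : (verma 𝔟 φ μ).carrier →ₗ[T] (verma 𝔟 φ μ).carrier := LinearMap.id - s ∘ₗ c.1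
  have hq : ∀ m, q m = m - s (c.1 m) := fun m => rfl
  have hqp : ∀ ν, (vermaPiece D φ μ ν).map q ≤ vermaPiece D φ μ ν := by
    rintro ν _ ⟨m, hm, rfl⟩
    rw [hq, hs]
    refine sub_mem hm (Submodule.sum_mem _ fun t ht => Submodule.smul_mem _ _ ?_)
    have h2 := (mem_weightSpace_nabla D).mp (hcw ν ⟨m, hm, rfl⟩) t (Finsupp.mem_support_iff.mp ht)
    exact h2 ▸ hy t
  have h2 := le_of_iSup_le_sup_smul (A := fun _ => ⊥)
    ((iSupIndep_weightSpace (φ := φ) (verma 𝔟 φ μ)).mono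
      fun ν => (hqp ν).trans (vermaPiece_le D ν))
    (fun ν => (vermaPiece_fg D ν).map q) (fun _ => bot_le) hJ (by
      rw [← Submodule.map_iSup, iSup_vermaPiece D]
      rintro _ ⟨m, -, rfl⟩
      refine Submodule.mem_sup_right ?_
      have h3 : c.1 (q m) = 0 := by rw [hq, map_sub, hcs, sub_self]
      have h4 : q (q m) = q m := by rw [hq (q m), h3, map_zero, sub_zero]
      have h5 := Submodule.mem_map_of_mem (f := q) (hinj _ h3)
      rwa [h4, Submodule.map_smul''] at h5)
  have hq0 : ∀ m, q m = 0 := fun m => by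
    have h3 : (⊤ : Submodule T (verma 𝔟 φ μ).carrier).map q ≤ ⊥ := by
      rw [← iSup_vermaPiece D, Submodule.map_iSup]
      exact iSup_le h2
    exact h3 ⟨m, trivial, rfl⟩
  refine ⟨?_, fun f => ⟨s f, hcs f⟩⟩
  rw [injective_iff_map_eq_zero]
  intro m hm
  have := hq0 m
  rwa [hq, hm, map_zero, sub_zero] at this

end Verma

/-! ### Reducing and lifting the condition that Δ(μ) → ∇(μ) is an isomorphism. -/

section Reduction

variable {𝔤 : Type u} [LieRing 𝔤] [LieAlgebra ℂ 𝔤] [FiniteDimensional ℂ 𝔤]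
  [LieAlgebra.IsSemisimple ℂ 𝔤] {T : Type u} [CommRing T] [Algebra ℂ T]
  [Algebra T ℂ] [IsScalarTower ℂ T ℂ]
  {𝔥 𝔟 𝔟' : LieSubalgebra ℂ 𝔤} [𝔥.IsCartanSubalgebra] {φ : SymmetricAlgebra ℂ 𝔥 →ₐ[ℂ] T}
  {μ : Module.Dual ℂ 𝔥}

lemma CanonicalIsIso.reduce (D : Triangular 𝔥 𝔟 𝔟')
    (hφ : ∀ H, algebraMap T ℂ (φ (SymmetricAlgebra.ι ℂ 𝔥 H)) = 0) (h : CanonicalIsIso 𝔟 𝔟' φ μ) :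
    CanonicalIsIso 𝔟 𝔟' (evalZero 𝔥) μ := by
  obtain ⟨e, he⟩ := h
  obtain ⟨a, ha⟩ := exists_iso_reduce_verma (𝔟 := 𝔟) hφ μ
  obtain ⟨b, hb⟩ := exists_iso_reduce_nabla D hφ μ
  refine ⟨(a.symm.trans e.reduce).trans b, ?_⟩
  change nablaEval 𝔟' (evalZero 𝔥) μ (b.1 (e.reduce.1 (a.symm.1 _))) = 1
  rw [← ha, Bimod.Iso.symm_apply_apply, Bimod.Iso.reduce_red, hb, he, map_one]

/-- The canonical map exists over T without any hypothesis. Its reduction has the same normalisation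
as the given isomorphism over ℂ, so they agree by uniqueness, and bijectivity modulo the kernel
lifts. -/
lemma CanonicalIsIso.of_reduce (D : Triangular 𝔥 𝔟 𝔟')
    (hφ : ∀ H, algebraMap T ℂ (φ (SymmetricAlgebra.ι ℂ 𝔥 H)) = 0)
    (hJ : RingHom.ker (algebraMap T ℂ) ≤ Ideal.jacobson ⊥)
    (h : CanonicalIsIso 𝔟 𝔟' (evalZero 𝔥) μ) : CanonicalIsIso 𝔟 𝔟' φ μ := by
  obtain ⟨e, he⟩ := h
  obtain ⟨a, ha⟩ := exists_iso_reduce_verma (𝔟 := 𝔟) hφ μ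
  obtain ⟨b, hb⟩ := exists_iso_reduce_nabla D hφ μ
  obtain ⟨c, hc⟩ := exists_canonicalMap D φ μ
  have h1 : ∀ z, (b.toHom.comp (c.reduce.comp a.symm.toHom)).1 z = e.toHom.1 z := by
    refine hom_verma_nabla_ext D ?_
    rw [Bimod.Iso.toHom_apply, he, Bimod.Hom.comp_apply, Bimod.Hom.comp_apply,
      Bimod.Iso.toHom_apply, Bimod.Iso.toHom_apply, ← ha, Bimod.Iso.symm_apply_apply,
      Bimod.Hom.reduce_red, hb, hc, map_one]
  have h2 : ∀ m, b.1 ((nabla 𝔟' φ μ).red (c.1 m)) = e.1 (a.1 ((verma 𝔟 φ μ).red m)) := by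
    intro m
    have := h1 (a.1 ((verma 𝔟 φ μ).red m))
    rwa [Bimod.Hom.comp_apply, Bimod.Hom.comp_apply, Bimod.Iso.toHom_apply, Bimod.Iso.toHom_apply,
      Bimod.Iso.symm_apply_apply, Bimod.Hom.reduce_red] at this
  have hbij : Function.Bijective c.1 := by
    refine bijective_of_bijective_mod D hJ c (fun n => ?_) (fun m hm => ?_)
    · obtain ⟨m, hm⟩ := Bimod.red_surjective (a.symm.1 (e.symm.1 (b.1 ((nabla 𝔟' φ μ).red n))))
      refine ⟨m, ?_⟩
      rw [← Bimod.red_eq_zero, map_sub, sub_eq_zero]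
      apply b.1.injective
      rw [h2, hm, Bimod.Iso.apply_symm_apply, Bimod.Iso.apply_symm_apply]
    · rw [← Bimod.red_eq_zero]
      have := h2 m
      rw [hm, map_zero, map_zero] at this
      exact a.1.injective (e.1.injective (by rw [← this, map_zero, map_zero]))
  exact ⟨Bimod.Iso.ofBijective c hbij, hc⟩

end Reduction

/-! ### Homomorphisms from `Δ(μ) ⊗ F` to nabla modules -/

section TensorNabla

variable {𝔤 : Type u} [LieRing 𝔤] [LieAlgebra ℂ 𝔤] [FiniteDimensional ℂ 𝔤]
  [LieAlgebra.IsSemisimple ℂ 𝔤] {T : Type u} [CommRing T] [Algebra ℂ T]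
  {𝔥 𝔟 𝔟' : LieSubalgebra ℂ 𝔤} [𝔥.IsCartanSubalgebra] {φ : SymmetricAlgebra ℂ 𝔥 →ₐ[ℂ] T}
  {lam μ : Module.Dual ℂ 𝔥}
  {F : Type u} [AddCommGroup F] [Module ℂ F] [LieRingModule 𝔤 F] [LieModule ℂ 𝔤 F]

lemma nablaEval_act {T₀ : Type v} [CommRing T₀] [Algebra ℂ T₀]
    {φ₀ : SymmetricAlgebra ℂ 𝔥 →ₐ[ℂ] T₀} (D : Triangular 𝔥 𝔟 𝔟') (y : 𝔟')
    (f : (nabla 𝔟' φ₀ μ).carrier) :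
    nablaEval 𝔟' φ₀ μ ((nabla 𝔟' φ₀ μ).act (y : 𝔤) f) =
      D.char φ₀ μ y * nablaEval 𝔟' φ₀ μ f := by
  rw [nablaEval_eq, nablaVal_act, one_mul, nablaEval_eq, ← nablaVal_mul D, mul_one]

lemma nablaEval_add {T₀ : Type v} [CommRing T₀] [Algebra ℂ T₀]
    {φ₀ : SymmetricAlgebra ℂ 𝔥 →ₐ[ℂ] T₀} (f g : (nabla 𝔟' φ₀ μ).carrier) :
    nablaEval 𝔟' φ₀ μ (f + g) = nablaEval 𝔟' φ₀ μ f + nablaEval 𝔟' φ₀ μ g := rfl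

lemma nablaEval_zero {T₀ : Type v} [CommRing T₀] [Algebra ℂ T₀]
    {φ₀ : SymmetricAlgebra ℂ 𝔥 →ₐ[ℂ] T₀} :
    nablaEval 𝔟' φ₀ μ (0 : (nabla 𝔟' φ₀ μ).carrier) = 0 := rfl

lemma nablaEval_smul {T₀ : Type v} [CommRing T₀] [Algebra ℂ T₀]
    {φ₀ : SymmetricAlgebra ℂ 𝔥 →ₐ[ℂ] T₀} (t : T₀) (f : (nabla 𝔟' φ₀ μ).carrier) :
    nablaEval 𝔟' φ₀ μ (t • f) = t * nablaEval 𝔟' φ₀ μ f := rfl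

/-- A semilinear homomorphism to a nabla module is determined by its values at `1` on `v ⊗ F`, for
the highest weight vector `v`. -/
theorem tensor_nabla_eq_zero {T₀ : Type v} [CommRing T₀] [Algebra ℂ T₀]
    {φ₀ : SymmetricAlgebra ℂ 𝔥 →ₐ[ℂ] T₀} (D : Triangular 𝔥 𝔟 𝔟') (σ : T →+* T₀)
    (Θ : ((verma 𝔟 φ lam).tensor F).carrier →+ (nabla 𝔟' φ₀ μ).carrier)
    (hs : ∀ (t : T) z, Θ (t • z) = σ t • Θ z)
    (ha : ∀ x z, Θ (((verma 𝔟 φ lam).tensor F).act x z) = (nabla 𝔟' φ₀ μ).act x (Θ z))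
    (h0 : ∀ f, nablaEval 𝔟' φ₀ μ (Θ (Bimod.pure _ F (vermaGen 𝔟 φ lam) f)) = 0)
    (z : ((verma 𝔟 φ lam).tensor F).carrier) : Θ z = 0 := by
  -- Vanishing is required for all `f` at once: an element of 𝔟' moved off the Verma factor acts
  -- either through the character or on `f`.
  let P : Submodule T (verma 𝔟 φ lam).carrier :=
    { carrier := {m | ∀ f, nablaEval 𝔟' φ₀ μ (Θ (Bimod.pure _ F m f)) = 0}
      zero_mem' := fun f => by rw [map_zero, AddMonoidHom.zero_apply, map_zero, nablaEval_zero]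
      add_mem' := fun {a b} ha hb f => by
        rw [map_add, AddMonoidHom.add_apply, map_add, nablaEval_add, ha f, hb f, add_zero]
      smul_mem' := fun t a ha f => by
        rw [Bimod.pure_smul, hs, nablaEval_smul, ha f, mul_zero] }
  have hP : P = ⊤ := by
    refine verma_induction D (P := P) h0 fun y hy m hm f => ?_
    have h1 := ha y (Bimod.pure _ F m f)
    rw [Bimod.act_pure, map_add] at h1
    have h2 := congrArg (nablaEval 𝔟' φ₀ μ) h1
    rw [nablaEval_add, nablaEval_act D ⟨y, hy⟩, hm, hm, mul_zero, add_zero] at h2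
    exact h2
  have hev : ∀ z, nablaEval 𝔟' φ₀ μ (Θ z) = 0 := fun z => by
    induction z using Bimod.tensor_induction with
    | hz => rw [map_zero, nablaEval_zero]
    | hp m f =>
      have : m ∈ P := hP ▸ Submodule.mem_top
      exact this f
    | ha a b ha hb => rw [map_add, nablaEval_add, ha, hb, add_zero]
  -- The value at a product a x is the value at a of the translate by x, so vanishing at 1 on the
  -- whole module propagates to every monomial.
  have hmon : ∀ (l : List D.pos.I) z, nablaVal (Θ z) (PBW.word D.pos.vec l) = 0 := by
    intro l
    induction l using List.reverseRecOn with
    | nil => intro z; rw [PBW.word_nil]; exact hev z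
    | append_singleton l i ih =>
      intro z
      rw [PBW.word_append, PBW.word_cons, PBW.word_nil, mul_one, ← nablaVal_act, ← ha]
      exact ih _
  apply (nablaCoord D φ₀ μ).injective
  ext t
  rw [nablaCoord_apply, map_zero]
  exact hmon _ z

/-- The generator has weight λ + φ and evaluation has weight μ + φ, so φ cancels. The resulting form
on F sees 𝔥 through complex numbers only, which is the source of compatibility with base change. -/
lemma nablaEval_tensor_cartan {T₀ : Type v} [CommRing T₀] [Algebra ℂ T₀]
    {φ₀ : SymmetricAlgebra ℂ 𝔥 →ₐ[ℂ] T₀} (D : Triangular 𝔥 𝔟 𝔟') (σ : T →+* T₀)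
    (hσ : ∀ H, σ (weightScalar φ lam H) = weightScalar φ₀ lam H)
    (Θ : ((verma 𝔟 φ lam).tensor F).carrier →+ (nabla 𝔟' φ₀ μ).carrier)
    (hs : ∀ (t : T) z, Θ (t • z) = σ t • Θ z)
    (ha : ∀ x z, Θ (((verma 𝔟 φ lam).tensor F).act x z) = (nabla 𝔟' φ₀ μ).act x (Θ z))
    (H : 𝔥) (f : F) :
    nablaEval 𝔟' φ₀ μ (Θ (Bimod.pure _ F (vermaGen 𝔟 φ lam) ⁅(H : 𝔤), f⁆)) =
      algebraMap ℂ T₀ ((μ - lam) H) *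
        nablaEval 𝔟' φ₀ μ (Θ (Bimod.pure _ F (vermaGen 𝔟 φ lam) f)) := by
  have h1 := ha H (Bimod.pure _ F (vermaGen 𝔟 φ lam) f)
  rw [Bimod.act_pure, map_add, verma_act_cartan_gen, Bimod.pure_smul, hs, hσ] at h1
  have h2 := congrArg (nablaEval 𝔟' φ₀ μ) h1
  rw [nablaEval_add, nablaEval_smul, nablaEval_act D ⟨H, D.le' H.2⟩, D.char_cartan,
    ← eq_sub_iff_add_eq', ← sub_mul, weightScalar_sub] at h2
  exact h2

lemma iSup_weightSpace_verma : ⨆ ν, weightSpace φ (verma 𝔟 φ lam) ν = ⊤ :=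
  verma_induction_full (Submodule.mem_iSup_of_mem lam fun H => verma_act_cartan_gen H)
    fun y m hm => act_mem_iSup_weightSpace φ _ y m hm

/-- `Δ(μ) ⊗ F` is spanned by generalised weight vectors. -/
lemma span_isGenWeight_tensor [FiniteDimensional ℂ F] :
    Submodule.span T {m | IsGenWeight φ ((verma 𝔟 φ lam).tensor F) m} = ⊤ := by
  have key : ∀ (ν : Module.Dual ℂ 𝔥), ∀ m ∈ weightSpace φ (verma 𝔟 φ lam) ν, ∀ (χ : 𝔥 → ℂ),
      ∀ f ∈ LieModule.genWeightSpace F χ,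
      IsGenWeight φ ((verma 𝔟 φ lam).tensor F) (Bimod.pure _ F m f) := by
    intro ν m hm χ f hf
    refine ⟨fun H => ν H + χ H, fun H => ?_⟩
    obtain ⟨k, hk⟩ := (LieModule.mem_genWeightSpace F χ f).mp hf H
    refine ⟨k, ?_⟩
    have h1 : ∀ (k : ℕ) (f : F), ((((verma 𝔟 φ lam).tensor F).act (H : 𝔤) -
        (algebraMap ℂ T (ν H + χ H) + φ (SymmetricAlgebra.ι ℂ 𝔥 H)) •
          (1 : Module.End T ((verma 𝔟 φ lam).tensor F).carrier)) ^ k) (Bimod.pure _ F m f) =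
        Bimod.pure _ F m (((LieModule.toEnd ℂ 𝔥 F H - χ H • 1) ^ k) f) := by
      intro k
      induction k with
      | zero => intro f; rfl
      | succ k ih =>
        intro f
        rw [pow_succ, pow_succ, Module.End.mul_apply, Module.End.mul_apply, ← ih]
        congr 1
        have h2 : (LieModule.toEnd ℂ 𝔥 F H - χ H • 1) f = ⁅(H : 𝔤), f⁆ - χ H • f := rfl
        rw [h2, LinearMap.sub_apply, LinearMap.smul_apply, Module.End.one_apply, Bimod.act_pure,
          hm H, Bimod.pure_smul, map_sub, Bimod.pure_complex_smul, weightScalar, map_add,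
          add_smul, add_smul, add_smul]
        abel
    rw [h1, hk, map_zero]
  refine Submodule.eq_top_iff'.mpr fun z => ?_
  induction z using Bimod.tensor_induction with
  | hz => exact zero_mem _
  | ha a b ha hb => exact add_mem ha hb
  | hp m f =>
    have hm : m ∈ ⨆ ν, weightSpace φ (verma 𝔟 φ lam) ν :=
      (iSup_weightSpace_verma (𝔟 := 𝔟) (φ := φ) (lam := lam)).ge Submodule.mem_top
    induction hm using Submodule.iSup_induction' with
    | zero => rw [map_zero]; exact zero_mem _
    | add a b _ _ ha hb => rw [map_add]; exact add_mem ha hb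
    | mem ν m hm =>
      -- Only the generalised weight decomposition of F under 𝔥 is needed here.
      have hf : f ∈ ⨆ χ : 𝔥 → ℂ, (LieModule.genWeightSpace F χ).toSubmodule := by
        rw [← LieSubmodule.iSup_toSubmodule, LieModule.iSup_genWeightSpace_eq_top ℂ 𝔥 F]
        trivial
      induction hf using Submodule.iSup_induction' with
      | zero => rw [map_zero]; exact zero_mem _
      | add a b _ _ ha hb => rw [map_add]; exact add_mem ha hb
      | mem χ f hf => exact Submodule.subset_span (key ν m hm χ f hf)

/-- The `𝔟'`-module of linear forms on `F`, twisted by the character `μ`. -/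
def Triangular.formBimod (D : Triangular 𝔥 𝔟 𝔟') (φ : SymmetricAlgebra ℂ 𝔥 →ₐ[ℂ] T)
    (μ : Module.Dual ℂ 𝔥) (F : Type u) [AddCommGroup F] [Module ℂ F] [LieRingModule 𝔤 F]
    [LieModule ℂ 𝔤 F] : Bimod.{u, u, u} 𝔟' T where
  carrier := F →ₗ[ℂ] T
  act :=
    { toFun := fun y =>
        { toFun := fun ψ => D.char φ μ y • ψ - ψ ∘ₗ LieModule.toEnd ℂ 𝔤 F (y : 𝔤)
          map_add' := fun ψ χ => by ext f; simp; ring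
          map_smul' := fun t ψ => by ext f; simp [mul_sub]; ring }
      map_add' := fun x y => by ext ψ f; simp [add_mul]; ring
      map_smul' := fun c y => by ext ψ f; simp [Algebra.smul_def, mul_sub, mul_assoc] }
  act_lie x y := by
    ext ψ f
    simp [D.char_lie, mul_sub]
    ring

/-- The linear form underlying an element of `formBimod`. -/
def Triangular.formVal (D : Triangular 𝔥 𝔟 𝔟') :
    (D.formBimod φ μ F).carrier →ₗ[T] (F →ₗ[ℂ] T) := LinearMap.id

lemma Triangular.formVal_act (D : Triangular 𝔥 𝔟 𝔟') (y : 𝔟') (ψ : (D.formBimod φ μ F).carrier)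
    (f : F) : D.formVal ((D.formBimod φ μ F).act y ψ) f =
      D.char φ μ y * D.formVal ψ f - D.formVal ψ ⁅(y : 𝔤), f⁆ := rfl

/-- Existence of homomorphisms with given values at `1` on `v ⊗ F`. -/
theorem exists_hom_tensor_nabla [FiniteDimensional ℂ F] (D : Triangular 𝔥 𝔟 𝔟') (ψ : F →ₗ[ℂ] T)
    (hψ : ∀ (H : 𝔥) f, ψ ⁅(H : 𝔤), f⁆ = algebraMap ℂ T ((μ - lam) H) * ψ f) :
    ∃ Ψ : Bimod.Hom ((verma 𝔟 φ lam).tensor F) (nabla 𝔟' φ μ),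
      ∀ f, nablaEval 𝔟' φ μ (Ψ.1 (Bimod.pure _ F (vermaGen 𝔟 φ lam) f)) = ψ f := by
  obtain ⟨ψ', hψ'⟩ : ∃ ψ' : (D.formBimod φ μ F).carrier, D.formVal ψ' = ψ := ⟨ψ, rfl⟩
  have hinj : Function.Injective (D.formVal (φ := φ) (μ := μ) (F := F)) := fun _ _ h => h
  -- By the hypothesis on ψ, the form has 𝔥-weight λ + φ in the 𝔟'-module of forms on F twisted by
  -- μ. It therefore extends to a 𝔟'-map from Δ(λ), and uncurrying gives a semi-invariant form on
  -- Δ(λ) ⊗ F.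
  obtain ⟨g, hgv, hga⟩ := exists_vermaMap (φ := φ) (μ := lam) D (D.formBimod φ μ F) ψ' (fun H => by
    refine hinj (LinearMap.ext fun f => ?_)
    rw [D.formVal_act, D.char_cartan, map_smul, LinearMap.smul_apply, hψ', hψ,
      ← weightScalar_sub (φ := φ), ← sub_mul, sub_sub_cancel, smul_eq_mul])
  let g' : (verma 𝔟 φ lam).carrier →ₗ[T] (F →ₗ[ℂ] T) := D.formVal ∘ₗ g
  have hg' : ∀ (y : 𝔟') n f, g' ((verma 𝔟 φ lam).act (y : 𝔤) n) f =
      D.char φ μ y * g' n f - g' n ⁅(y : 𝔤), f⁆ := fun y n f => by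
    change D.formVal (g _) f = _
    rw [hga, D.formVal_act]
    rfl
  let ψ₀ : ((verma 𝔟 φ lam).tensor F).carrier →+ T := Bimod.tensorLift
    { toFun := fun m => (g' m).toAddMonoidHom
      map_zero' := by ext f; simp
      map_add' := fun m n => by ext f; simp }
    (fun c m f => by
      simp [Algebra.smul_def])
  have hψ₀ : ∀ m f, ψ₀ (Bimod.pure _ F m f) = g' m f := fun m f => rfl
  let ψ₁ : ((verma 𝔟 φ lam).tensor F).carrier →ₗ[T] T :=
    { ψ₀ with
      map_smul' := Bimod.tensorLift_smul (RingHom.id T) _ _ (fun t m f => by simp) }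
  have hψ₁ : ∀ m f, ψ₁ (Bimod.pure _ F m f) = g' m f := fun m f => rfl
  obtain ⟨Ψ, hΨ, hΨ'⟩ := exists_hom_nabla (φ := φ) (μ := μ) D
    (M := (verma 𝔟 φ lam).tensor F) span_isGenWeight_tensor ψ₁ (fun y z => by
      induction z using Bimod.tensor_induction with
      | hz => simp only [map_zero, mul_zero]
      | hp m f => rw [Bimod.act_pure, map_add, hψ₁, hψ₁, hψ₁, hg', sub_add_cancel]
      | ha a b ha hb => rw [map_add, map_add, map_add, ha, hb, mul_add])
  refine ⟨⟨Ψ, hΨ⟩, fun f => ?_⟩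
  rw [hΨ', hψ₁]
  change D.formVal (g _) f = _
  rw [hgv, hψ']

end TensorNabla

/-! ### Reduction of homomorphism spaces -/

namespace Bimod

section HomModule

variable {𝔤 : Type u} [LieRing 𝔤] [LieAlgebra ℂ 𝔤] {T : Type v} [CommRing T] [Algebra ℂ T]

/-- The `T`-module of homomorphisms of bimodules. -/
def homModule (M N : Bimod.{u, v, w} 𝔤 T) : Submodule T (M.carrier →ₗ[T] N.carrier) where
  carrier := {f | ∀ x m, f (M.act x m) = N.act x (f m)}
  zero_mem' x m := by simp
  add_mem' {f g} hf hg x m := by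
    rw [LinearMap.add_apply, hf, hg, LinearMap.add_apply, map_add]
  smul_mem' t f hf x m := by
    rw [LinearMap.smul_apply, hf, LinearMap.smul_apply, map_smul]

variable [Algebra T ℂ] [IsScalarTower ℂ T ℂ]

/-- The homomorphisms `M → N` form a free module of finite rank that is compatible with
reduction. -/
def FreeHom (M N : Bimod.{u, v, w} 𝔤 T) : Prop :=
  ∃ (k : ℕ) (e : homModule M N ≃ₗ[T] (Fin k → T)),
    (∀ f : homModule M N, (∀ m, N.red (f.1 m) = 0) →
      ∀ i, e f i ∈ RingHom.ker (algebraMap T ℂ)) ∧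
    ∀ θ : M.carrier →+ (N.baseChange ℂ).carrier,
      (∀ (t : T) m, θ (t • m) = algebraMap T ℂ t • θ m) →
      (∀ x m, θ (M.act x m) = (N.baseChange ℂ).act x (θ m)) →
      ∃ f : homModule M N, ∀ m, N.red (f.1 m) = θ m

variable {M N M' N' : Bimod.{u, v, w} 𝔤 T}

/-- The two clauses of `FreeHom` say that the map from Hom(M, N) modulo the kernel to homomorphisms
between the reductions is injective and surjective. They pass through `L` as soon as `L` is
compatible with reduction. -/
lemma FreeHom.congr (h : FreeHom M N) (L : homModule M' N' ≃ₗ[T] homModule M N)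
    (hL : ∀ f, (∀ m, N'.red (f.1 m) = 0) → ∀ m, N.red ((L f).1 m) = 0)
    (hlift : ∀ θ' : M'.carrier →+ (N'.baseChange ℂ).carrier,
      (∀ (t : T) m, θ' (t • m) = algebraMap T ℂ t • θ' m) →
      (∀ x m, θ' (M'.act x m) = (N'.baseChange ℂ).act x (θ' m)) →
      ∃ θ : M.carrier →+ (N.baseChange ℂ).carrier,
        (∀ (t : T) m, θ (t • m) = algebraMap T ℂ t • θ m) ∧
        (∀ x m, θ (M.act x m) = (N.baseChange ℂ).act x (θ m)) ∧
        ∀ f, (∀ m, N.red ((L f).1 m) = θ m) → ∀ m, N'.red (f.1 m) = θ' m) :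
    FreeHom M' N' := by
  obtain ⟨k, e, he, hl⟩ := h
  refine ⟨k, L.trans e, fun f hf i => he (L f) (hL f hf) i, fun θ' hs ha => ?_⟩
  obtain ⟨θ, hs', ha', hθ⟩ := hlift θ' hs ha
  obtain ⟨f, hf⟩ := hl θ hs' ha'
  exact ⟨L.symm f, hθ _ (by rwa [L.apply_symm_apply])⟩

lemma FreeHom.congr_left (h : FreeHom M N) (a : Iso M' M) : FreeHom M' N := by
  let L : homModule M' N ≃ₗ[T] homModule M N := LinearEquiv.ofLinearMap
    { toFun := fun f => ⟨f.1 ∘ₗ a.symm.1.toLinearMap, fun x m => by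
        rw [LinearMap.comp_apply, LinearEquiv.coe_coe, a.symm.2, f.2]; rfl⟩
      map_add' := fun f g => rfl
      map_smul' := fun t f => rfl }
    { toFun := fun f => ⟨f.1 ∘ₗ a.1.toLinearMap, fun x m => by
        rw [LinearMap.comp_apply, LinearEquiv.coe_coe, a.2, f.2]; rfl⟩
      map_add' := fun f g => rfl
      map_smul' := fun t f => rfl }
    (LinearMap.ext fun f => Subtype.ext (LinearMap.ext fun m =>
      congrArg f.1 (a.apply_symm_apply m)))
    (LinearMap.ext fun f => Subtype.ext (LinearMap.ext fun m =>
      congrArg f.1 (a.symm_apply_apply m)))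
  have hL : ∀ f m, (L f).1 m = f.1 (a.symm.1 m) := fun f m => rfl
  refine h.congr L (fun f hf m => hf _) fun θ' hs ha => ?_
  refine ⟨θ'.comp a.symm.1.toLinearMap.toAddMonoidHom, fun t m => ?_, fun x m => ?_,
    fun f hf m => ?_⟩
  · simp [hs]
  · simp [a.symm.2, ha]
  · have := hf (a.1 m)
    rw [hL, a.symm_apply_apply] at this
    refine this.trans ?_
    change θ' (a.symm.1 (a.1 m)) = θ' m
    rw [a.symm_apply_apply]

lemma FreeHom.congr_right (h : FreeHom M N) (a : Iso N' N) : FreeHom M N' := by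
  let L : homModule M N' ≃ₗ[T] homModule M N := LinearEquiv.ofLinearMap
    { toFun := fun f => ⟨a.1.toLinearMap ∘ₗ f.1, fun x m => by
        rw [LinearMap.comp_apply, LinearEquiv.coe_coe, f.2, a.2]; rfl⟩
      map_add' := fun f g => Subtype.ext (LinearMap.ext fun m => map_add a.1 _ _)
      map_smul' := fun t f => Subtype.ext (LinearMap.ext fun m => map_smul a.1 _ _) }
    { toFun := fun f => ⟨a.symm.1.toLinearMap ∘ₗ f.1, fun x m => by
        rw [LinearMap.comp_apply, LinearEquiv.coe_coe, f.2, a.symm.2]; rfl⟩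
      map_add' := fun f g => Subtype.ext (LinearMap.ext fun m => map_add a.symm.1 _ _)
      map_smul' := fun t f => Subtype.ext (LinearMap.ext fun m => map_smul a.symm.1 _ _) }
    (LinearMap.ext fun f => Subtype.ext (LinearMap.ext fun m => a.apply_symm_apply _))
    (LinearMap.ext fun f => Subtype.ext (LinearMap.ext fun m => a.symm_apply_apply _))
  have hL : ∀ f m, N.red ((L f).1 m) = a.reduce.1 (N'.red (f.1 m)) := fun f m =>
    (a.reduce_red _).symm
  refine h.congr L (fun f hf m => by rw [hL, hf, map_zero]) fun θ' hs ha => ?_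
  refine ⟨a.reduce.1.toLinearMap.toAddMonoidHom.comp θ', fun t m => ?_, fun x m => ?_,
    fun f hf m => ?_⟩
  · simp [hs]
  · simp [a.reduce.2, ha]
  · have := hf m
    rw [hL] at this
    exact a.reduce.1.injective this

end HomModule

/-! ### Adjunction -/

section Adjunction

variable {𝔤 : Type u} [LieRing 𝔤] [LieAlgebra ℂ 𝔤] {T : Type v} [CommRing T] [Algebra ℂ T]
  {M N : Bimod.{u, v, w} 𝔤 T} {E : Type w} [AddCommGroup E] [Module ℂ E]
  [LieRingModule 𝔤 E] [LieModule ℂ 𝔤 E]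

/-- Contraction `N ⊗ E → N` with a linear form on `E`. -/
def contract (N : Bimod.{u, v, w} 𝔤 T) (ξ : Module.Dual ℂ E) :
    (N.tensor E).carrier →ₗ[T] N.carrier :=
  let g : N.carrier →+ E →+ N.carrier :=
    { toFun := fun n =>
        { toFun := fun e => algebraMap ℂ T (ξ e) • n
          map_zero' := by simp
          map_add' := fun e f => by simp [add_smul] }
      map_zero' := by ext e; simp
      map_add' := fun m n => by ext e; simp }
  { tensorLift g (fun c n e => by simp [g, smul_smul, mul_comm]) with
    map_smul' := tensorLift_smul (RingHom.id T) g _ (fun t n e => smul_comm _ _ _) }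

lemma contract_pure (ξ : Module.Dual ℂ E) (n : N.carrier) (e : E) :
    N.contract ξ (pure N E n e) = algebraMap ℂ T (ξ e) • n := rfl

lemma contract_zero (z : (N.tensor E).carrier) : N.contract (0 : Module.Dual ℂ E) z = 0 := by
  induction z using tensor_induction with
  | hz => rw [map_zero]
  | hp n e => rw [contract_pure, LinearMap.zero_apply, map_zero, zero_smul]
  | ha a b ha hb => rw [map_add, ha, hb, add_zero]

lemma contract_add (ξ ζ : Module.Dual ℂ E) (z : (N.tensor E).carrier) :
    N.contract (ξ + ζ) z = N.contract ξ z + N.contract ζ z := by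
  induction z using tensor_induction with
  | hz => simp only [map_zero, add_zero]
  | hp n e => simp only [contract_pure, LinearMap.add_apply, map_add, add_smul]
  | ha a b ha hb => rw [map_add, map_add, map_add, ha, hb, add_add_add_comm]

lemma contract_smul (c : ℂ) (ξ : Module.Dual ℂ E) (z : (N.tensor E).carrier) :
    N.contract (c • ξ) z = algebraMap ℂ T c • N.contract ξ z := by
  induction z using tensor_induction with
  | hz => simp only [map_zero, smul_zero]
  | hp n e => simp only [contract_pure, LinearMap.smul_apply, smul_eq_mul, map_mul, mul_smul]
  | ha a b ha hb => rw [map_add, map_add, ha, hb, smul_add]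

lemma contract_act (x : 𝔤) (ξ : Module.Dual ℂ E) (z : (N.tensor E).carrier) :
    N.contract ξ ((N.tensor E).act x z) + N.contract ⁅x, ξ⁆ z = N.act x (N.contract ξ z) := by
  induction z using tensor_induction with
  | hz => simp only [map_zero, add_zero]
  | hp n e =>
    rw [act_pure, map_add, contract_pure, contract_pure, contract_pure, contract_pure,
      Module.Dual.lie_apply, map_neg, neg_smul, add_neg_cancel_right, map_smul]
  | ha a b ha hb => rw [map_add, map_add, map_add, map_add, map_add, ← ha, ← hb, add_add_add_comm]

lemma sum_pure_contract {ι : Type*} [Fintype ι] (b : Module.Basis ι ℂ E)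
    (z : (N.tensor E).carrier) : ∑ i, pure N E (N.contract (b.coord i) z) (b i) = z := by
  induction z using tensor_induction with
  | hz => simp
  | hp n e =>
    conv_rhs => rw [← b.sum_repr e, map_sum]
    refine Finset.sum_congr rfl fun i _ => ?_
    rw [contract_pure, pure_smul, pure_complex_smul, Module.Basis.coord_apply]
  | ha a b' ha hb =>
    conv_rhs => rw [← ha, ← hb, ← Finset.sum_add_distrib]
    refine Finset.sum_congr rfl fun i _ => ?_
    rw [map_add, map_add, AddMonoidHom.add_apply]

variable [FiniteDimensional ℂ E]

lemma contract_ext {z z' : (N.tensor E).carrier}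
    (h : ∀ ξ : Module.Dual ℂ E, N.contract ξ z = N.contract ξ z') : z = z' := by
  rw [← sum_pure_contract (Module.finBasis ℂ E) z, ← sum_pure_contract (Module.finBasis ℂ E) z']
  simp only [h]

lemma contract_sum {ι : Type*} [Fintype ι] (b : Module.Basis ι ℂ E) (ξ : Module.Dual ℂ E)
    (n : Module.Dual ℂ E →+ N.carrier) (hn : ∀ (c : ℂ) ξ, n (c • ξ) = algebraMap ℂ T c • n ξ) :
    N.contract ξ (∑ i, pure N E (n (b.coord i)) (b i)) = n ξ := by
  have hξ : ξ = ∑ i, ξ (b i) • b.coord i := by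
    refine b.ext fun j => ?_
    classical
    simp
  rw [map_sum]
  conv_rhs => rw [hξ, map_sum]
  refine Finset.sum_congr rfl fun i _ => ?_
  rw [contract_pure, hn]

/-- The homomorphism `M ⊗ E* → N` adjoint to a homomorphism `M → N ⊗ E`. -/
def Hom.adjoint (f : Hom M (N.tensor E)) : Hom (M.tensor (Module.Dual ℂ E)) N :=
  Hom.tensorLift (M := M) (E := Module.Dual ℂ E) (N := N)
    { toFun := fun m =>
        { toFun := fun ξ => N.contract ξ (f.1 m)
          map_zero' := contract_zero _
          map_add' := fun ξ ζ => contract_add ξ ζ _ }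
      map_zero' := AddMonoidHom.ext fun ξ => by
        change N.contract ξ (f.1 0) = 0
        rw [map_zero, map_zero]
      map_add' := fun m n => AddMonoidHom.ext fun ξ => by
        change N.contract ξ (f.1 (m + n)) = N.contract ξ (f.1 m) + N.contract ξ (f.1 n)
        rw [map_add, map_add] }
    (fun t m ξ => by
      change N.contract ξ (f.1 (t • m)) = t • N.contract ξ (f.1 m)
      rw [map_smul, map_smul])
    (fun c m ξ => contract_smul c ξ _)
    (fun x m ξ => by
      change N.contract ξ (f.1 (M.act x m)) + N.contract ⁅x, ξ⁆ (f.1 m) =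
        N.act x (N.contract ξ (f.1 m))
      rw [f.2, contract_act])

variable (M N E) in
/-- The adjunction between tensoring with a representation and with its dual. -/
def adjunction : homModule M (N.tensor E) →ₗ[T] homModule (M.tensor (Module.Dual ℂ E)) N where
  toFun f := ⟨(Hom.adjoint ⟨f.1, f.2⟩).1, (Hom.adjoint ⟨f.1, f.2⟩).2⟩
  map_add' f g := Subtype.ext (LinearMap.ext fun z => by
    induction z using tensor_induction with
    | hz => rw [map_zero, map_zero]
    | hp m ξ => exact map_add (N.contract ξ) (f.1 m) (g.1 m)
    | ha a b ha hb => rw [map_add, map_add, ha, hb])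
  map_smul' t f := Subtype.ext (LinearMap.ext fun z => by
    induction z using tensor_induction with
    | hz => rw [map_zero, map_zero]
    | hp m ξ => exact map_smul (N.contract ξ) t (f.1 m)
    | ha a b ha hb => rw [map_add, map_add, ha, hb])

lemma adjunction_pure (f : homModule M (N.tensor E)) (m : M.carrier) (ξ : Module.Dual ℂ E) :
    (adjunction M N E f).1 (pure M _ m ξ) = N.contract ξ (f.1 m) := rfl

lemma adjunction_bijective : Function.Bijective (adjunction M N E) := by
  constructor
  · intro f g h
    refine Subtype.ext (LinearMap.ext fun m => contract_ext fun ξ => ?_)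
    rw [← adjunction_pure, ← adjunction_pure, h]
  · intro f
    let b := Module.finBasis ℂ E
    have hs : ∀ (m : M.carrier) (c : ℂ) (ξ : Module.Dual ℂ E),
        f.1 (pure M _ m (c • ξ)) = algebraMap ℂ T c • f.1 (pure M _ m ξ) := fun m c ξ => by
      rw [pure_complex_smul, map_smul]
    -- The inverse of the adjunction, through the canonical element of E* ⊗ E.
    let g₀ : M.carrier →ₗ[T] (N.tensor E).carrier :=
      { toFun := fun m => ∑ i, pure N E (f.1 (pure M _ m (b.coord i))) (b i)
        map_add' := fun m n => by
          rw [← Finset.sum_add_distrib]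
          refine Finset.sum_congr rfl fun i _ => ?_
          rw [map_add, AddMonoidHom.add_apply, map_add, map_add, AddMonoidHom.add_apply]
        map_smul' := fun t m => by
          rw [Finset.smul_sum]
          refine Finset.sum_congr rfl fun i _ => ?_
          rw [pure_smul, map_smul, pure_smul, RingHom.id_apply] }
    have hg₀ : ∀ m ξ, N.contract ξ (g₀ m) = f.1 (pure M _ m ξ) := fun m ξ =>
      contract_sum b ξ (f.1.toAddMonoidHom.comp (pure M _ m)) (hs m)
    refine ⟨⟨g₀, fun x m => contract_ext fun ξ => ?_⟩, Subtype.ext (LinearMap.ext fun z => ?_)⟩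
    · have h1 := contract_act x ξ (g₀ m)
      rw [hg₀, hg₀, ← f.2, act_pure, map_add] at h1
      rw [hg₀]
      exact (add_right_cancel h1).symm
    · induction z using tensor_induction with
      | hz => rw [map_zero, map_zero]
      | hp m ξ => exact hg₀ m ξ
      | ha a b ha hb => rw [map_add, map_add, ha, hb]

variable [Algebra T ℂ] [IsScalarTower ℂ T ℂ]

/-- Contractions descend to the reductions as the maps `K ξ`. They translate the adjunction over T
into the one over ℂ and carry both clauses of `FreeHom` across. -/
lemma FreeHom.adjoint (h : FreeHom (M.tensor (Module.Dual ℂ E)) N) : FreeHom M (N.tensor E) := by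
  let L := LinearEquiv.ofBijective (adjunction M N E) adjunction_bijective
  have hL : ∀ f m ξ, (L f).1 (pure M _ m ξ) = N.contract ξ (f.1 m) := fun f m ξ => rfl
  have hred0 : ∀ (z : (N.tensor E).carrier), (N.tensor E).red z = 0 → ∀ ξ : Module.Dual ℂ E,
      N.red (N.contract ξ z) = 0 := fun z hz ξ => by
    rw [red_eq_zero] at hz ⊢
    have := Submodule.mem_map_of_mem (f := N.contract ξ) hz
    rw [Submodule.map_smul''] at this
    exact Submodule.smul_mono le_rfl le_top this
  have hK : ∀ ξ : Module.Dual ℂ E,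
      ∃ K : ((N.tensor E).baseChange ℂ).carrier →+ (N.baseChange ℂ).carrier,
        ∀ z, K ((N.tensor E).red z) = N.red (N.contract ξ z) := fun ξ =>
    ⟨redLift (N.red.comp (N.contract ξ).toAddMonoidHom) (fun t m => by
      simp only [AddMonoidHom.comp_apply, LinearMap.toAddMonoidHom_coe, map_smul, red_smul]),
      redLift_red _ _⟩
  choose K hK using hK
  have hKs : ∀ ξ (c : ℂ) w, K ξ (c • w) = c • K ξ w := fun ξ c w => by
    obtain ⟨z, rfl⟩ := red_surjective w
    have h := red_smul (algebraMap ℂ T c) z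
    rw [residue_algebraMap] at h
    rw [← h, hK, hK, map_smul, red_smul, residue_algebraMap]
  -- Expanding in a basis of E shows that the reduced contractions are jointly injective.
  have hKext : ∀ w w', (∀ ξ, K ξ w = K ξ w') → w = w' := fun w w' hw => by
    obtain ⟨z, rfl⟩ := red_surjective w
    obtain ⟨z', rfl⟩ := red_surjective w'
    rw [← sub_eq_zero, ← map_sub, ← sum_pure_contract (Module.finBasis ℂ E) (z - z'), map_sum]
    refine Finset.sum_eq_zero fun i _ => ?_
    have h1 : N.red (N.contract ((Module.finBasis ℂ E).coord i) (z - z')) = 0 := by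
      rw [← hK, map_sub, map_sub, hw, sub_self]
    rw [red_eq_zero] at h1 ⊢
    generalize N.contract ((Module.finBasis ℂ E).coord i) (z - z') = n at h1
    induction h1 using Submodule.smul_induction_on' with
    | smul t ht m _ => rw [pure_smul]; exact Submodule.smul_mem_smul ht trivial
    | add a _ b _ ha hb => rw [map_add]; exact add_mem ha hb
  refine h.congr L (fun f hf z => ?_) fun θ' hs ha => ?_
  · induction z using tensor_induction with
    | hz => rw [map_zero, map_zero]
    | hp m ξ => rw [hL]; exact hred0 _ (hf m) ξ
    | ha a b ha hb => rw [map_add, map_add, ha, hb, add_zero]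
  · have hθ : ∃ θ : (M.tensor (Module.Dual ℂ E)).carrier →+ (N.baseChange ℂ).carrier,
        (∀ (t : T) z, θ (t • z) = algebraMap T ℂ t • θ z) ∧
        ∀ m ξ, θ (pure M _ m ξ) = K ξ (θ' m) := by
      let g : M.carrier →+ Module.Dual ℂ E →+ (N.baseChange ℂ).carrier :=
        { toFun := fun m =>
            { toFun := fun ξ => K ξ (θ' m)
              map_zero' := by
                obtain ⟨z, hz⟩ := red_surjective (θ' m)
                rw [← hz, hK, contract_zero, map_zero]
              map_add' := fun ξ ζ => by
                obtain ⟨z, hz⟩ := red_surjective (θ' m)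
                rw [← hz, hK, hK, hK, contract_add, map_add] }
          map_zero' := by ext ξ; simp
          map_add' := fun m n => by ext ξ; simp }
      have hgs : ∀ (t : T) m ξ, g (t • m) ξ = algebraMap T ℂ t • g m ξ := fun t m ξ => by
        change K ξ (θ' (t • m)) = algebraMap T ℂ t • K ξ (θ' m)
        rw [hs, hKs]
      refine ⟨tensorLift g (fun c m ξ => ?_), tensorLift_smul (algebraMap T ℂ) g _ hgs,
        fun m ξ => rfl⟩
      rw [hgs, residue_algebraMap]
      change c • K ξ (θ' m) = K (c • ξ) (θ' m)
      obtain ⟨z, hz⟩ := red_surjective (θ' m)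
      rw [← hz, hK, hK, contract_smul, red_smul, residue_algebraMap]
    obtain ⟨θ, hθs, hθ⟩ := hθ
    refine ⟨θ, hθs, fun x z => ?_, fun f hf m => hKext _ _ fun ξ => ?_⟩
    · induction z using tensor_induction with
      | hz => simp only [map_zero]
      | hp m ξ =>
        rw [act_pure, map_add, hθ, hθ, hθ, ha]
        obtain ⟨z, hz⟩ := red_surjective (θ' m)
        rw [← hz, ← red_act, hK, hK, hK, ← red_act, ← map_add, contract_act]
      | ha a b ha hb => simp only [map_add, ha, hb]
    · rw [hK, ← hL, hf, hθ]

end Adjunction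

end Bimod

/-! ### Homomorphisms between the basic tilting modules -/

section Tilting

variable {𝔤 : Type u} [LieRing 𝔤] [LieAlgebra ℂ 𝔤] [FiniteDimensional ℂ 𝔤]
  [LieAlgebra.IsSemisimple ℂ 𝔤] {T : Type u} [CommRing T] [Algebra ℂ T]
  [Algebra T ℂ] [IsScalarTower ℂ T ℂ]
  {𝔥 𝔟 𝔟' : LieSubalgebra ℂ 𝔤} [𝔥.IsCartanSubalgebra] {φ : SymmetricAlgebra ℂ 𝔥 →ₐ[ℂ] T}
  {lam μ : Module.Dual ℂ 𝔥}

/-- A homomorphism is determined by the form it induces on v ⊗ F, and exactly the forms of 𝔥-weight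
μ - λ occur. These are the T-valued forms on the coinvariants F/F', so a complex basis of F/F'
yields coordinates. -/
theorem freeHom_tensor_nabla (D : Triangular 𝔥 𝔟 𝔟')
    (hφ : ∀ H, algebraMap T ℂ (φ (SymmetricAlgebra.ι ℂ 𝔥 H)) = 0)
    (F : Type u) [AddCommGroup F] [Module ℂ F] [LieRingModule 𝔤 F] [LieModule ℂ 𝔤 F]
    [FiniteDimensional ℂ F] :
    Bimod.FreeHom ((verma 𝔟 φ lam).tensor F) (nabla 𝔟' φ μ) := by
  let F' : Submodule ℂ F := Submodule.span ℂ
    {z | ∃ (H : 𝔥) (f : F), z = ⁅(H : 𝔤), f⁆ - (μ - lam) H • f}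
  let b := Module.finBasis ℂ (F ⧸ F')
  choose f hf using fun i => F'.mkQ_surjective (b i)
  let v := Bimod.pure (verma 𝔟 φ lam) F (vermaGen 𝔟 φ lam)
  have hfac : ∀ {V : Type u} [AddCommGroup V] [Module ℂ V] (ψ : F →ₗ[ℂ] V),
      (∀ (H : 𝔥) f, ψ ⁅(H : 𝔤), f⁆ = (μ - lam) H • ψ f) → (∀ i, ψ (f i) = 0) → ∀ g, ψ g = 0 := by
    intro V _ _ ψ hψ h0 g
    have hle : F' ≤ LinearMap.ker ψ := by
      rw [Submodule.span_le]
      rintro _ ⟨H, f, rfl⟩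
      rw [SetLike.mem_coe, LinearMap.mem_ker, map_sub, hψ, map_smul, sub_self]
    have h1 : F'.liftQ ψ hle = 0 := b.ext fun i => by
      rw [← hf i, Submodule.mkQ_apply, Submodule.liftQ_apply, h0, LinearMap.zero_apply]
    have h2 := LinearMap.congr_fun h1 (F'.mkQ g)
    rwa [Submodule.mkQ_apply, Submodule.liftQ_apply] at h2
  let ev : (nabla 𝔟' φ μ).carrier →ₗ[T] T :=
    { toFun := nablaEval 𝔟' φ μ
      map_add' := nablaEval_add
      map_smul' := nablaEval_smul }
  have hev : ∀ n, ev n = nablaEval 𝔟' φ μ n := fun n => rfl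
  let C : Bimod.homModule ((verma 𝔟 φ lam).tensor F) (nabla 𝔟' φ μ) →ₗ[T]
      (Fin (Module.finrank ℂ (F ⧸ F')) → T) :=
    { toFun := fun Ψ i => ev (Ψ.1 (v (f i)))
      map_add' := fun Ψ Ψ' => funext fun i => map_add ev (Ψ.1 _) (Ψ'.1 _)
      map_smul' := fun t Ψ => funext fun i => map_smul ev t (Ψ.1 _) }
  have hC : ∀ Ψ i, C Ψ i = ev (Ψ.1 (v (f i))) := fun Ψ i => rfl
  have hbij : Function.Bijective C := by
    constructor
    · rw [injective_iff_map_eq_zero]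
      intro Ψ hΨ
      have h1 := hfac
        ({ toFun := fun g => ev (Ψ.1 (v g))
           map_add' := fun g h => by rw [map_add, map_add, map_add]
           map_smul' := fun c g => by
            rw [Bimod.pure_complex_smul, map_smul, map_smul, algebraMap_smul, RingHom.id_apply] } :
          F →ₗ[ℂ] T)
        (fun H g => by
          have := nablaEval_tensor_cartan (φ := φ) (lam := lam) (μ := μ) (F := F) D (RingHom.id T)
            (fun H => rfl) Ψ.1.toAddMonoidHom Ψ.1.map_smul Ψ.2 H g
          rw [← Algebra.smul_def] at this
          exact this)
        (fun i => congrFun hΨ i)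
      refine Subtype.ext (LinearMap.ext fun z => ?_)
      exact tensor_nabla_eq_zero D (RingHom.id T) Ψ.1.toAddMonoidHom Ψ.1.map_smul Ψ.2 h1 z
    · intro c
      have h0 : ∀ (H : 𝔥) g, F'.mkQ ⁅(H : 𝔤), g⁆ = (μ - lam) H • F'.mkQ g := fun H g => by
        rw [← sub_eq_zero, ← map_smul, ← map_sub, Submodule.mkQ_apply,
          Submodule.Quotient.mk_eq_zero]
        exact Submodule.subset_span ⟨H, g, rfl⟩
      obtain ⟨Ψ, hΨ⟩ := exists_hom_tensor_nabla (φ := φ) (lam := lam) (μ := μ) D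
        (b.constr ℂ c ∘ₗ F'.mkQ) (fun H g => by
          rw [LinearMap.comp_apply, h0, map_smul, ← Algebra.smul_def]
          rfl)
      refine ⟨⟨Ψ.1, Ψ.2⟩, funext fun i => ?_⟩
      refine (hΨ (f i)).trans ?_
      rw [LinearMap.comp_apply, hf, Module.Basis.constr_basis]
  refine ⟨_, LinearEquiv.ofBijective C hbij, fun Ψ hΨ i => ?_, fun θ hs ha => ?_⟩
  · rw [LinearEquiv.ofBijective_apply, hC]
    have h1 := Submodule.mem_map_of_mem (f := ev) (Bimod.red_eq_zero.mp (hΨ (v (f i))))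
    rw [Submodule.map_smul''] at h1
    have h2 := Submodule.smul_mono (le_refl (RingHom.ker (algebraMap T ℂ))) le_top h1
    rwa [smul_eq_mul, Ideal.mul_top] at h2
  · obtain ⟨e, he⟩ := exists_iso_reduce_nabla (μ := μ) D hφ
    let Θ : ((verma 𝔟 φ lam).tensor F).carrier →+ (nabla 𝔟' (evalZero 𝔥) μ).carrier :=
      e.1.toLinearMap.toAddMonoidHom.comp θ
    have hΘ : ∀ z, Θ z = e.1 (θ z) := fun z => rfl
    have hΘs : ∀ (t : T) z, Θ (t • z) = algebraMap T ℂ t • Θ z := fun t z => by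
      rw [hΘ, hΘ, hs, map_smul]
    have hΘa : ∀ x z, Θ (((verma 𝔟 φ lam).tensor F).act x z) =
        (nabla 𝔟' (evalZero 𝔥) μ).act x (Θ z) := fun x z => by
      rw [hΘ, hΘ, ha, e.2]
    let ψ₀ : F →ₗ[ℂ] ℂ :=
      { toFun := fun g => nablaEval 𝔟' (evalZero 𝔥) μ (Θ (v g))
        map_add' := fun g h => by rw [map_add, map_add, nablaEval_add]
        map_smul' := fun c g => by
          rw [Bimod.pure_complex_smul, hΘs, Bimod.residue_algebraMap, nablaEval_smul]
          rfl }
    have hψ₀ : ∀ g, ψ₀ g = nablaEval 𝔟' (evalZero 𝔥) μ (Θ (v g)) := fun g => rfl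
    -- The form over ℂ becomes a form over T through ℂ → T; its weight condition is unchanged
    -- because it only involves complex scalars.
    obtain ⟨Ψ, hΨ⟩ := exists_hom_tensor_nabla (φ := φ) (lam := lam) (μ := μ) D
      (Algebra.linearMap ℂ T ∘ₗ ψ₀) (fun H g => by
        rw [LinearMap.comp_apply, LinearMap.comp_apply, hψ₀, hψ₀,
          nablaEval_tensor_cartan D (algebraMap T ℂ) (residue_weightScalar hφ) Θ hΘs hΘa]
        exact map_mul (algebraMap ℂ T) ((μ - lam) H) (ψ₀ g))
    refine ⟨⟨Ψ.1, Ψ.2⟩, fun z => ?_⟩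
    -- The error of the lift induces the zero form on v ⊗ F, hence vanishes.
    let Θ' : ((verma 𝔟 φ lam).tensor F).carrier →+ (nabla 𝔟' (evalZero 𝔥) μ).carrier :=
      (e.1.toLinearMap.toAddMonoidHom.comp ((nabla 𝔟' φ μ).red.comp Ψ.1.toAddMonoidHom)) - Θ
    have hΘ' : ∀ z, Θ' z = e.1 ((nabla 𝔟' φ μ).red (Ψ.1 z)) - e.1 (θ z) := fun z => rfl
    have h0 := tensor_nabla_eq_zero D (algebraMap T ℂ) Θ'
      (fun t z => by
        rw [hΘ', hΘ', map_smul, Bimod.red_smul, map_smul, hs, map_smul, smul_sub])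
      (fun x z => by
        rw [hΘ', hΘ', Ψ.2, Bimod.red_act, e.2, ha, e.2, map_sub])
      (fun g => by
        rw [hΘ', sub_eq_add_neg, nablaEval_add, he]
        have h1 : nablaEval 𝔟' (evalZero 𝔥) μ (-e.1 (θ (v g))) = - ψ₀ g := rfl
        rw [h1, hΨ, LinearMap.comp_apply, Algebra.linearMap_apply, Bimod.residue_algebraMap,
          add_neg_cancel]) z
    rw [hΘ', sub_eq_zero] at h0
    exact e.1.injective h0

/-- Replace Δ(μ) by ∇(μ), move F to the source by duality, and absorb both representations into E ⊗
F*. -/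
theorem freeHom_tensor_tensor (D : Triangular 𝔥 𝔟 𝔟')
    (hφ : ∀ H, algebraMap T ℂ (φ (SymmetricAlgebra.ι ℂ 𝔥 H)) = 0)
    (E F : Type u) [AddCommGroup E] [Module ℂ E] [LieRingModule 𝔤 E] [LieModule ℂ 𝔤 E]
    [FiniteDimensional ℂ E] [AddCommGroup F] [Module ℂ F] [LieRingModule 𝔤 F] [LieModule ℂ 𝔤 F]
    [FiniteDimensional ℂ F] (hμ : CanonicalIsIso 𝔟 𝔟' φ μ) :
    Bimod.FreeHom ((verma 𝔟 φ lam).tensor E) ((verma 𝔟 φ μ).tensor F) := by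
  obtain ⟨e, -⟩ := hμ
  obtain ⟨a⟩ := Bimod.nonempty_iso_tensor_assoc (E := E) (F := Module.Dual ℂ F) (verma 𝔟 φ lam)
  exact ((freeHom_tensor_nabla D hφ (E ⊗[ℂ] Module.Dual ℂ F)).congr_left a).adjoint.congr_right
    (e.tensor F)

end Tilting

/-! ### Finite algebras over a complete local ring -/

section Algebras

variable {T : Type*} [CommRing T] {A : Type*} [Ring A] [Algebra T A]

lemma mul_mem_smul_top_right {J : Ideal T} {x : A} (hx : x ∈ J • (⊤ : Submodule T A)) (y : A) :
    x * y ∈ J • (⊤ : Submodule T A) := by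
  have h := Submodule.mem_map_of_mem (f := LinearMap.mulRight T y) hx
  rw [Submodule.map_smul''] at h
  exact Submodule.smul_mono le_rfl le_top h

lemma mul_mem_smul_top_left {J : Ideal T} (y : A) {x : A} (hx : x ∈ J • (⊤ : Submodule T A)) :
    y * x ∈ J • (⊤ : Submodule T A) := by
  have h := Submodule.mem_map_of_mem (f := LinearMap.mulLeft T y) hx
  rw [Submodule.map_smul''] at h
  exact Submodule.smul_mono le_rfl le_top h

lemma mul_mem_mul_smul_top {J K : Ideal T} {x y : A} (hx : x ∈ J • (⊤ : Submodule T A))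
    (hy : y ∈ K • (⊤ : Submodule T A)) : x * y ∈ (J * K) • (⊤ : Submodule T A) := by
  have h := Submodule.mem_map_of_mem (f := LinearMap.mulLeft T x) hy
  rw [Submodule.map_smul''] at h
  have h1 : (⊤ : Submodule T A).map (LinearMap.mulLeft T x) ≤ J • ⊤ := by
    rintro _ ⟨z, -, rfl⟩
    exact mul_mem_smul_top_right hx z
  rw [mul_comm, Submodule.mul_smul]
  exact Submodule.smul_mono le_rfl h1 h

/-- In a finite algebra, elements congruent to `1` modulo an ideal in the radical of the base ring
are units. -/
lemma isUnit_of_sub_one_mem [Module.Finite T A] {J : Ideal T} (hJ : J ≤ Ideal.jacobson ⊥) {u : A}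
    (hu : u - 1 ∈ J • (⊤ : Submodule T A)) : IsUnit u := by
  -- From w = u w - (u - 1) w the right ideal u A is everything modulo J A, so Nakayama makes it
  -- everything; the other side is symmetric.
  have h1 : (⊤ : Submodule T A) ≤ LinearMap.range (LinearMap.mulLeft T u) := by
    refine Submodule.le_of_le_smul_of_le_jacobson_bot Module.Finite.fg_top hJ fun w _ => ?_
    have h : w = u * w - (u - 1) * w := by noncomm_ring
    rw [h]
    exact sub_mem (Submodule.mem_sup_left ⟨w, rfl⟩)
      (Submodule.mem_sup_right (mul_mem_smul_top_right hu w))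
  have h2 : (⊤ : Submodule T A) ≤ LinearMap.range (LinearMap.mulRight T u) := by
    refine Submodule.le_of_le_smul_of_le_jacobson_bot Module.Finite.fg_top hJ fun w _ => ?_
    have h : w = w * u - w * (u - 1) := by noncomm_ring
    rw [h]
    exact sub_mem (Submodule.mem_sup_left ⟨w, rfl⟩)
      (Submodule.mem_sup_right (mul_mem_smul_top_left w hu))
  obtain ⟨w, hw⟩ := h1 (Submodule.mem_top (x := 1))
  obtain ⟨w', hw'⟩ := h2 (Submodule.mem_top (x := 1))
  exact isUnit_iff_exists_and_exists.mpr ⟨⟨w, hw⟩, ⟨w', hw'⟩⟩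

lemma mem_smul_top_iff_coord {V : Type*} [AddCommGroup V] [Module T V] {k : ℕ}
    (e : V ≃ₗ[T] (Fin k → T)) {J : Ideal T} {y : V} :
    y ∈ J • (⊤ : Submodule T V) ↔ ∀ i, e y i ∈ J := by
  constructor
  · intro h i
    induction h using Submodule.smul_induction_on' with
    | smul t ht m _ => rw [map_smul, Pi.smul_apply]; exact J.mul_mem_right _ ht
    | add a _ b _ ha hb => rw [map_add, Pi.add_apply]; exact add_mem ha hb
  · intro h
    have h1 : y = ∑ i, e y i • e.symm (Pi.single i 1) := by
      apply e.injective
      rw [map_sum]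
      simp only [map_smul, LinearEquiv.apply_symm_apply]
      exact pi_eq_sum_univ' (e y)
    rw [h1]
    exact Submodule.sum_mem _ fun i _ => Submodule.smul_mem_smul (h i) trivial

/-- Idempotents lift along the reduction of a free algebra of finite rank over a complete ring. -/
theorem exists_isIdempotentElem_sub_mem {J : Ideal T} [IsAdicComplete J T] {k : ℕ}
    (e : A ≃ₗ[T] (Fin k → T)) {a : A} (ha : a * a - a ∈ J • (⊤ : Submodule T A)) :
    ∃ b : A, b * b = b ∧ b - a ∈ J • (⊤ : Submodule T A) := by
  -- The iteration x ↦ 3x² - 2x³ turns the error e = x² - x into e²(4e - 3) and moves x by (1 -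
  -- 2x)e. Only a gain of one power of J per step is recorded.
  let s : ℕ → A := fun n => Nat.rec a (fun _ x => 3 * (x * x) - 2 * (x * x * x)) n
  have hs0 : s 0 = a := rfl
  have hs : ∀ n, s (n + 1) = 3 * (s n * s n) - 2 * (s n * s n * s n) := fun n => rfl
  have hx : ∀ n, s n * s n - s n ∈ J ^ (n + 1) • (⊤ : Submodule T A) := by
    intro n
    induction n with
    | zero => rwa [hs0, zero_add, pow_one]
    | succ n ih =>
      have h1 : s (n + 1) * s (n + 1) - s (n + 1) =
          (s n * s n - s n) * (s n * s n - s n) * (4 * (s n * s n - s n) - 3) := by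
        rw [hs]; noncomm_ring
      rw [h1]
      refine mul_mem_smul_top_right ?_ _
      refine Submodule.smul_mono ?_ le_rfl (mul_mem_mul_smul_top ih ih)
      rw [← pow_add]
      exact Ideal.pow_le_pow_right (by omega)
  have hd : ∀ n, s (n + 1) - s n ∈ J ^ (n + 1) • (⊤ : Submodule T A) := fun n => by
    have h1 : s (n + 1) - s n = (1 - 2 * s n) * (s n * s n - s n) := by
      rw [hs]; noncomm_ring
    rw [h1]
    exact mul_mem_smul_top_left _ (hx n)
  have hc : ∀ m j, s (m + j) - s m ∈ J ^ m • (⊤ : Submodule T A) := by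
    intro m j
    induction j with
    | zero => rw [add_zero, sub_self]; exact zero_mem _
    | succ j ih =>
      have h1 : s (m + (j + 1)) - s m = (s (m + j + 1) - s (m + j)) + (s (m + j) - s m) := by
        rw [sub_add_sub_cancel, add_assoc]
      rw [h1]
      exact add_mem (Submodule.smul_mono (Ideal.pow_le_pow_right (by omega)) le_rfl (hd _)) ih
  -- The limit is taken in each of the k coordinates, where completeness of T itself suffices.
  have hlim : ∀ i, ∃ L : T, ∀ n, e (s n) i - L ∈ J ^ n := by
    intro i
    obtain ⟨L, hL⟩ := IsPrecomplete.prec (I := J) (M := T) inferInstance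
      (f := fun n => e (s n) i) (fun {m n} hmn => by
        obtain ⟨j, rfl⟩ := Nat.exists_eq_add_of_le hmn
        have := (mem_smul_top_iff_coord e).mp (hc m j) i
        rw [map_sub, Pi.sub_apply] at this
        rw [SModEq.comm, SModEq.sub_mem, smul_eq_mul, Ideal.mul_top]
        exact this)
    refine ⟨L, fun n => ?_⟩
    have := hL n
    rwa [SModEq.sub_mem, smul_eq_mul, Ideal.mul_top] at this
  choose L hL using hlim
  let b : A := e.symm L
  have hb : ∀ n, s n - b ∈ J ^ n • (⊤ : Submodule T A) := fun n => by
    rw [mem_smul_top_iff_coord e]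
    intro i
    rw [map_sub, Pi.sub_apply, LinearEquiv.apply_symm_apply]
    exact hL i n
  refine ⟨b, ?_, ?_⟩
  · have h1 : ∀ n, b * b - b ∈ J ^ n • (⊤ : Submodule T A) := fun n => by
      have h2 : b * b - b = (s n * s n - s n) - s n * (s n - b) - (s n - b) * b + (s n - b) := by
        noncomm_ring
      rw [h2]
      exact add_mem (sub_mem (sub_mem
        (Submodule.smul_mono (Ideal.pow_le_pow_right (by omega)) le_rfl (hx n))
        (mul_mem_smul_top_left _ (hb n))) (mul_mem_smul_top_right (hb n) _)) (hb n)
    rw [← sub_eq_zero]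
    apply e.injective
    rw [map_zero]
    funext i
    refine IsHausdorff.haus (I := J) (M := T) inferInstance _ fun n => ?_
    rw [SModEq.sub_mem, sub_zero, smul_eq_mul, Ideal.mul_top]
    exact (mem_smul_top_iff_coord e).mp (h1 n) i
  · have h1 : b - a = (s 1 - s 0) - (s 1 - b) := by rw [hs0]; abel
    rw [h1]
    have h2 := hd 0
    have h3 := hb 1
    rw [zero_add, pow_one] at h2
    rw [pow_one] at h3
    exact sub_mem h2 h3

end Algebras

/-! ### Lifting morphisms and summands -/

namespace Bimod

variable {𝔤 : Type u} [LieRing 𝔤] [LieAlgebra ℂ 𝔤] {T : Type v} [CommRing T] [Algebra ℂ T]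

/-- The endomorphism algebra of a bimodule. -/
def endAlgebra (M : Bimod.{u, v, w} 𝔤 T) : Subalgebra T (Module.End T M.carrier) where
  carrier := homModule M M
  mul_mem' {f g} hf hg x m := by
    rw [Module.End.mul_apply, hg, hf, Module.End.mul_apply]
  add_mem' := (homModule M M).add_mem
  algebraMap_mem' t x m := by simp [Module.algebraMap_end_apply]

variable [Algebra T ℂ] [IsScalarTower ℂ T ℂ] {M N P Q : Bimod.{u, v, w} 𝔤 T}

/-- Extend θ to the ambient modules by the projection of P and the inclusion into Q, lift there, and
cut back down. -/
lemma FreeHom.exists_lift (h : FreeHom P Q) (hM : IsSummand M P) (hN : IsSummand N Q)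
    (θ : Hom (M.baseChange ℂ) (N.baseChange ℂ)) :
    ∃ f : Hom M N, ∀ m, N.red (f.1 m) = θ.1 (M.red m) := by
  obtain ⟨i, p, hip⟩ := hM
  obtain ⟨j, q, hjq⟩ := hN
  obtain ⟨k, e, -, hl⟩ := h
  let Θ := (j.reduce.comp θ).comp p.reduce
  obtain ⟨F, hF⟩ := hl (Θ.1.toAddMonoidHom.comp P.red)
    (fun t m => by simp [red_smul]) (fun x m => by simp [red_act, Θ.2])
  have hF' : ∀ m, Q.red (F.1 m) = j.reduce.1 (θ.1 (p.reduce.1 (P.red m))) := hF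
  have hjq' : ∀ z, q.reduce.1 (j.reduce.1 z) = z := fun z => by
    obtain ⟨n, rfl⟩ := red_surjective z
    rw [Hom.reduce_red, Hom.reduce_red, hjq]
  refine ⟨(q.comp (⟨F.1, F.2⟩ : Hom P Q)).comp i, fun m => ?_⟩
  change N.red (q.1 (F.1 (i.1 m))) = _
  rw [← Hom.reduce_red, hF', Hom.reduce_red, hip, hjq']

lemma FreeHom.mem_smul_top (h : FreeHom P P) {f : endAlgebra P} (hf : ∀ m, P.red (f.1 m) = 0) :
    f ∈ RingHom.ker (algebraMap T ℂ) • (⊤ : Submodule T (endAlgebra P)) := by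
  obtain ⟨k, e, he, -⟩ := h
  let e' : endAlgebra P ≃ₗ[T] (Fin k → T) := e
  rw [mem_smul_top_iff_coord e']
  exact he f hf

lemma red_eq_zero_of_mem_smul_top {f : endAlgebra P}
    (hf : f ∈ RingHom.ker (algebraMap T ℂ) • (⊤ : Submodule T (endAlgebra P))) (m : P.carrier) :
    P.red (f.1 m) = 0 := by
  rw [red_eq_zero]
  induction hf using Submodule.smul_induction_on' with
  | smul t ht f _ => exact Submodule.smul_mem_smul ht trivial
  | add a _ b _ ha hb => exact add_mem ha hb

/-- An endomorphism that reduces to the identity is bijective. -/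
lemma FreeHom.bijective_of_reduce (h : FreeHom P P) (hM : IsSummand M P)
    (hJ : RingHom.ker (algebraMap T ℂ) ≤ Ideal.jacobson ⊥) (u : Hom M M)
    (hu : ∀ m, M.red (u.1 m) = M.red m) : Function.Bijective u.1 := by
  obtain ⟨i, p, hip⟩ := hM
  -- Compression to the summand is linear and onto, with section `Γ`. So End M is finite over T, and
  -- smallness of an endomorphism can be tested in the free module End P.
  let Φ : endAlgebra P →ₗ[T] endAlgebra M :=
    { toFun := fun f => ⟨p.1 ∘ₗ f.1 ∘ₗ i.1, fun x m => by
        simp only [LinearMap.comp_apply]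
        rw [i.2, f.2, p.2]⟩
      map_add' := fun f g => Subtype.ext (LinearMap.ext fun m => map_add p.1 _ _)
      map_smul' := fun t f => Subtype.ext (LinearMap.ext fun m => map_smul p.1 _ _) }
  have hΦ : ∀ f m, (Φ f).1 m = p.1 (f.1 (i.1 m)) := fun f m => rfl
  let Γ : endAlgebra M → endAlgebra P := fun f => ⟨i.1 ∘ₗ f.1 ∘ₗ p.1, fun x m => by
    simp only [LinearMap.comp_apply]
    rw [p.2, f.2, i.2]⟩
  have hΓ : ∀ f m, (Γ f).1 m = i.1 (f.1 (p.1 m)) := fun f m => rfl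
  have hΦΓ : ∀ f, Φ (Γ f) = f := fun f => Subtype.ext (LinearMap.ext fun m => by
    rw [hΦ, hΓ, hip, hip])
  have hfinP : Module.Finite T (endAlgebra P) := by
    obtain ⟨k, e, -, -⟩ := h
    let e' : endAlgebra P ≃ₗ[T] (Fin k → T) := e
    exact Module.Finite.equiv e'.symm
  have hfin : Module.Finite T (endAlgebra M) :=
    Module.Finite.of_surjective Φ fun f => ⟨Γ f, hΦΓ f⟩
  let U : endAlgebra M := ⟨u.1, u.2⟩
  have hU : ∀ m, U.1 m = u.1 m := fun m => rfl
  have hd : U - 1 ∈ RingHom.ker (algebraMap T ℂ) • (⊤ : Submodule T (endAlgebra M)) := by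
    have h1 : Γ (U - 1) ∈ RingHom.ker (algebraMap T ℂ) • (⊤ : Submodule T (endAlgebra P)) := by
      refine h.mem_smul_top fun m => ?_
      have h2 : (U - 1).1 (p.1 m) = u.1 (p.1 m) - p.1 m := rfl
      rw [hΓ, h2, ← Hom.reduce_red, map_sub, hu, sub_self, map_zero]
    have h3 := Submodule.mem_map_of_mem (f := Φ) h1
    rw [Submodule.map_smul'', hΦΓ] at h3
    exact Submodule.smul_mono le_rfl le_top h3
  obtain ⟨w, hw⟩ := isUnit_of_sub_one_mem hJ hd
  have h1 : ∀ m, u.1 ((w⁻¹ : (endAlgebra M)ˣ).1.1 m) = m := fun m => by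
    have := w.mul_inv
    rw [hw] at this
    exact LinearMap.congr_fun (congrArg Subtype.val this) m
  have h2 : ∀ m, (w⁻¹ : (endAlgebra M)ˣ).1.1 (u.1 m) = m := fun m => by
    have := w.inv_mul
    rw [hw] at this
    exact LinearMap.congr_fun (congrArg Subtype.val this) m
  exact ⟨Function.LeftInverse.injective h2, Function.RightInverse.surjective h1⟩

/-- Isomorphisms lift along reduction. -/
theorem nonempty_iso_of_reduce (hJ : RingHom.ker (algebraMap T ℂ) ≤ Ideal.jacobson ⊥)
    (hM : IsSummand M P) (hN : IsSummand N Q) (hPP : FreeHom P P) (hPQ : FreeHom P Q)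
    (hQP : FreeHom Q P) (hQQ : FreeHom Q Q) (θ : Iso (M.baseChange ℂ) (N.baseChange ℂ)) :
    Nonempty (Iso M N) := by
  obtain ⟨f, hf⟩ := hPQ.exists_lift hM hN θ.toHom
  obtain ⟨g, hg⟩ := hQP.exists_lift hN hM θ.symm.toHom
  have h1 : Function.Bijective (g.comp f).1 := hPP.bijective_of_reduce hM hJ _ fun m => by
    rw [Hom.comp_apply, hg, hf, Iso.toHom_apply, Iso.toHom_apply, Iso.symm_apply_apply]
  have h2 : Function.Bijective (f.comp g).1 := hQQ.bijective_of_reduce hN hJ _ fun m => by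
    rw [Hom.comp_apply, hf, hg, Iso.toHom_apply, Iso.toHom_apply, Iso.apply_symm_apply]
  exact ⟨Iso.ofBijective f ⟨Function.Injective.of_comp (f := g.1) h1.1,
    Function.Surjective.of_comp (g := g.1) h2.2⟩⟩

/-- Direct summands lift along reduction. -/
theorem exists_summand_reduce [IsAdicComplete (RingHom.ker (algebraMap T ℂ)) T]
    (h : FreeHom P P) {N₀ : Bimod.{u, 0, w} 𝔤 ℂ} (hN : IsSummand N₀ (P.baseChange ℂ)) :
    ∃ M : Bimod.{u, v, w} 𝔤 T, IsSummand M P ∧ Nonempty (Iso (M.baseChange ℂ) N₀) := by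
  obtain ⟨i, p, hip⟩ := hN
  have h' := h
  obtain ⟨k, e, -, hl⟩ := h'
  let e' : endAlgebra P ≃ₗ[T] (Fin k → T) := e
  -- Lift the idempotent onto the summand to some endomorphism of P. It is idempotent modulo the
  -- kernel, and is then corrected to a true idempotent whose image is the required module.
  obtain ⟨a, ha⟩ := hl ((i.comp p).1.toAddMonoidHom.comp P.red)
    (fun t m => by simp [red_smul]) (fun x m => by simp [red_act, (i.comp p).2])
  replace ha : ∀ m, P.red (a.1 m) = i.1 (p.1 (P.red m)) := ha
  let a' : endAlgebra P := a
  have ha2 : a' * a' - a' ∈ RingHom.ker (algebraMap T ℂ) • (⊤ : Submodule T (endAlgebra P)) := by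
    refine h.mem_smul_top fun m => ?_
    have h2 : (a' * a' - a').1 m = a.1 (a.1 m) - a.1 m := rfl
    rw [h2, map_sub, ha, ha, hip, sub_self]
  obtain ⟨L, hL, hLa⟩ := exists_isIdempotentElem_sub_mem e' ha2
  have hLL : ∀ m, L.1 (L.1 m) = L.1 m := fun m =>
    LinearMap.congr_fun (congrArg Subtype.val hL) m
  have hLr : ∀ m, P.red (L.1 m) = i.1 (p.1 (P.red m)) := fun m => by
    have h2 := red_eq_zero_of_mem_smul_top hLa m
    have h3 : (L - a').1 m = L.1 m - a.1 m := rfl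
    rw [h3, map_sub, sub_eq_zero] at h2
    rw [h2, ha]
  let M := P.sub (LinearMap.range L.1) (by
    rintro x _ ⟨m, rfl⟩
    exact ⟨P.act x m, L.2 x m⟩)
  let j : Hom M P := ⟨(LinearMap.range L.1).subtype, fun _ _ => rfl⟩
  let q : Hom P M := ⟨L.1.rangeRestrict, fun x m => Subtype.ext (L.2 x m)⟩
  have hjq : ∀ m, j.1 (q.1 m) = L.1 m := fun m => rfl
  have hqj : ∀ m, q.1 (j.1 m) = m := fun m => by
    obtain ⟨m', hm'⟩ := m.2
    refine Subtype.ext ?_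
    change L.1 m.1 = m.1
    rw [← hm', hLL]
  refine ⟨M, ⟨j, q, hqj⟩, ⟨Iso.ofInverse (p.comp j.reduce) (q.reduce.comp i) (fun z => ?_)
    (fun n => ?_)⟩⟩
  · obtain ⟨m, rfl⟩ := red_surjective z
    rw [Hom.comp_apply, Hom.comp_apply, Hom.reduce_red, ← hLr, Hom.reduce_red, ← hjq, hqj, hqj]
  · obtain ⟨z, hz⟩ := red_surjective (i.1 n)
    rw [Hom.comp_apply, Hom.comp_apply, ← hz, Hom.reduce_red, Hom.reduce_red, hjq, hLr, hz, hip,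
      hip]

end Bimod

/-! ### The structure of tilting modules -/

section Tilting

variable {𝔤 : Type u} [LieRing 𝔤] [LieAlgebra ℂ 𝔤] [FiniteDimensional ℂ 𝔤]
  [LieAlgebra.IsSemisimple ℂ 𝔤] {𝔥 𝔟 𝔟' : LieSubalgebra ℂ 𝔤} [𝔥.IsCartanSubalgebra]

/-- Every tilting module is a direct summand of some `Δ(μ) ⊗ E`. -/
lemma IsTilting.exists_isSummand {T : Type v} [CommRing T] [Algebra ℂ T]
    {φ : SymmetricAlgebra ℂ 𝔥 →ₐ[ℂ] T} {M : Bimod.{u, v, max u v} 𝔤 T}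
    (hM : IsTilting 𝔟 𝔟' φ M) :
    ∃ (μ : Module.Dual ℂ 𝔥) (_ : CanonicalIsIso 𝔟 𝔟' φ μ) (E : Type (max u v))
      (_ : AddCommGroup E) (_ : Module ℂ E) (_ : LieRingModule 𝔤 E) (_ : LieModule ℂ 𝔤 E)
      (_ : FiniteDimensional ℂ E), Bimod.IsSummand M ((DeformedO.verma 𝔟 φ μ).tensor E) := by
  induction hM with
  | verma μ hμ =>
    -- Δ(μ) itself is Δ(μ) tensored with the trivial representation, placed in the universe of the
    -- other factors.
    let E := ULift.{max u v} ℂ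
    let i1 : LieRingModule 𝔤 E :=
      { bracket := fun _ _ => 0
        add_lie := fun _ _ _ => (add_zero 0).symm
        lie_add := fun _ _ _ => (add_zero 0).symm
        leibniz_lie := fun _ _ _ => (add_zero 0).symm }
    let i2 : LieModule ℂ 𝔤 E :=
      { smul_lie := fun _ _ _ => (smul_zero _).symm
        lie_smul := fun _ _ _ => (smul_zero _).symm }
    have i3 : FiniteDimensional ℂ E := Module.Finite.equiv (ULift.moduleEquiv (R := ℂ)).symm
    refine ⟨μ, hμ, E, inferInstance, inferInstance, i1, i2, i3, ?_⟩
    obtain ⟨e⟩ := Bimod.nonempty_iso_tensor_trivial (DeformedO.verma 𝔟 φ μ) (E := E) ⟨1⟩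
      (fun e => ⟨e.down, ULift.down_injective (mul_one e.down).symm, fun c hc =>
        ((congrArg ULift.down hc).trans (mul_one c)).symm⟩) (fun _ _ => rfl)
    exact Bimod.IsSummand.of_iso e
  | tensor M _ F ih =>
    obtain ⟨μ, hμ, E, _, _, _, _, _, h⟩ := ih
    obtain ⟨e⟩ := Bimod.nonempty_iso_tensor_assoc (E := E) (F := F) (DeformedO.verma 𝔟 φ μ)
    exact ⟨μ, hμ, E ⊗[ℂ] F, inferInstance, inferInstance, inferInstance, inferInstance,
      inferInstance, h.tensor.trans (Bimod.IsSummand.of_iso e)⟩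
  | summand M N _ hN ih =>
    obtain ⟨μ, hμ, E, _, _, _, _, _, h⟩ := ih
    exact ⟨μ, hμ, E, inferInstance, inferInstance, inferInstance, inferInstance, inferInstance,
      hN.trans h⟩
  | iso M N _ e ih =>
    obtain ⟨μ, hμ, E, _, _, _, _, _, h⟩ := ih
    exact ⟨μ, hμ, E, inferInstance, inferInstance, inferInstance, inferInstance, inferInstance,
      (Bimod.IsSummand.of_iso e.symm).trans h⟩

variable {T : Type u} [CommRing T] [Algebra ℂ T] [Algebra T ℂ] [IsScalarTower ℂ T ℂ]
  {φ : SymmetricAlgebra ℂ 𝔥 →ₐ[ℂ] T}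

/-- The reduction of a tilting module is a tilting module. -/
lemma IsTilting.reduce (D : Triangular 𝔥 𝔟 𝔟')
    (hφ : ∀ H, algebraMap T ℂ (φ (SymmetricAlgebra.ι ℂ 𝔥 H)) = 0) {M : Bimod.{u, u, u} 𝔤 T}
    (hM : IsTilting 𝔟 𝔟' φ M) : IsTilting 𝔟 𝔟' (evalZero 𝔥) (M.baseChange ℂ) := by
  induction hM with
  | verma μ hμ =>
    obtain ⟨e, -⟩ := exists_iso_reduce_verma (𝔟 := 𝔟) hφ μ
    exact .iso _ _ (.verma μ (hμ.reduce D hφ)) e.symm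
  | tensor M _ E ih =>
    obtain ⟨e⟩ := Bimod.nonempty_iso_reduce_tensor M E
    exact .iso _ _ (.tensor _ ih E) e.symm
  | summand M N _ hN ih => exact .summand _ _ ih hN.reduce
  | iso M N _ e ih => exact .iso _ _ ih e.reduce

/-- Tilting modules with isomorphic reductions are isomorphic. -/
theorem IsTilting.nonempty_iso_of_reduce (D : Triangular 𝔥 𝔟 𝔟')
    (hφ : ∀ H, algebraMap T ℂ (φ (SymmetricAlgebra.ι ℂ 𝔥 H)) = 0)
    (hJ : RingHom.ker (algebraMap T ℂ) ≤ Ideal.jacobson ⊥) {M N : Bimod.{u, u, u} 𝔤 T}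
    (hM : IsTilting 𝔟 𝔟' φ M) (hN : IsTilting 𝔟 𝔟' φ N)
    (θ : Bimod.Iso (M.baseChange ℂ) (N.baseChange ℂ)) : Nonempty (Bimod.Iso M N) := by
  obtain ⟨μ, hμ, E, _, _, _, _, _, h⟩ := hM.exists_isSummand
  obtain ⟨ν, hν, F, _, _, _, _, _, h'⟩ := hN.exists_isSummand
  exact Bimod.nonempty_iso_of_reduce hJ h h' (freeHom_tensor_tensor D hφ E E hμ)
    (freeHom_tensor_tensor D hφ E F hν) (freeHom_tensor_tensor D hφ F E hμ)
    (freeHom_tensor_tensor D hφ F F hν) θ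

/-- Every tilting module over `ℂ` is a reduction. -/
theorem IsTilting.exists_reduce (D : Triangular 𝔥 𝔟 𝔟')
    (hφ : ∀ H, algebraMap T ℂ (φ (SymmetricAlgebra.ι ℂ 𝔥 H)) = 0)
    (hJ : RingHom.ker (algebraMap T ℂ) ≤ Ideal.jacobson ⊥)
    [IsAdicComplete (RingHom.ker (algebraMap T ℂ)) T] {N : Bimod.{u, 0, u} 𝔤 ℂ}
    (hN : IsTilting 𝔟 𝔟' (evalZero 𝔥) N) :
    ∃ M : Bimod.{u, u, u} 𝔤 T, IsTilting 𝔟 𝔟' φ M ∧ Nonempty (Bimod.Iso (M.baseChange ℂ) N) := by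
  obtain ⟨μ, hμ, E, _, _, _, _, _, h⟩ := hN.exists_isSummand
  have hμ' : CanonicalIsIso 𝔟 𝔟' φ μ := hμ.of_reduce D hφ hJ
  obtain ⟨e, -⟩ := exists_iso_reduce_verma (𝔟 := 𝔟) hφ μ
  obtain ⟨a⟩ := Bimod.nonempty_iso_reduce_tensor (DeformedO.verma 𝔟 φ μ) E
  obtain ⟨M, hM, hMN⟩ := Bimod.exists_summand_reduce (freeHom_tensor_tensor D hφ E E hμ')
    (h.trans (Bimod.IsSummand.of_iso (a.trans (e.tensor E)).symm))
  exact ⟨M, .summand _ _ (.tensor _ (.verma μ hμ') E) hM, hMN⟩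

end Tilting

end DeformedO

end

/-! ### The bijection on isomorphism classes. -/

theorem mainTheorem8
    {𝔤 : Type u} [LieRing 𝔤] [LieAlgebra ℂ 𝔤] [FiniteDimensional ℂ 𝔤]
    [LieAlgebra.IsSemisimple ℂ 𝔤]
    (𝔥 𝔟 𝔟' : LieSubalgebra ℂ 𝔤) [𝔥.IsCartanSubalgebra]
    (h𝔟 : DeformedO.IsBorel 𝔟) (h𝔥𝔟 : 𝔥 ≤ 𝔟) (h𝔟' : DeformedO.IsOppositeBorel 𝔥 𝔟 𝔟')
    {T : Type u} [CommRing T] [Algebra ℂ T] [IsLocalRing T]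
    [IsAdicComplete (IsLocalRing.maximalIdeal T) T]
    (φ : SymmetricAlgebra ℂ 𝔥 →ₐ[ℂ] T)
    (hφ : (IsLocalRing.maximalIdeal T).comap φ = RingHom.ker (DeformedO.evalZero 𝔥))
    [Algebra T ℂ] [IsScalarTower ℂ T ℂ] :
    ∃ F : DeformedO.Bimod.IsoClass (DeformedO.IsTilting 𝔟 𝔟' φ) →
        DeformedO.Bimod.IsoClass (DeformedO.IsTilting 𝔟 𝔟' (DeformedO.evalZero 𝔥)),
      (∀ (M : DeformedO.Bimod 𝔤 T) (hM : DeformedO.IsTilting 𝔟 𝔟' φ M),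
        ∃ hM' : DeformedO.IsTilting 𝔟 𝔟' (DeformedO.evalZero 𝔥) (M.baseChange ℂ),
          F (DeformedO.Bimod.isoClass M hM) = DeformedO.Bimod.isoClass (M.baseChange ℂ) hM') ∧
      Function.Bijective F := by

  obtain ⟨D⟩ := DeformedO.exists_triangular h𝔟 h𝔥𝔟 h𝔟'
  -- The composite ℂ → T → ℂ is the identity, so T → ℂ is onto and its kernel is the maximal ideal
  -- of the local ring T.
  have hker : RingHom.ker (algebraMap T ℂ) = IsLocalRing.maximalIdeal T :=
    IsLocalRing.eq_maximalIdeal (RingHom.ker_isMaximal_of_surjective _ fun c =>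
      ⟨algebraMap ℂ T c, DeformedO.Bimod.residue_algebraMap c⟩)
  have hJ : RingHom.ker (algebraMap T ℂ) ≤ Ideal.jacobson ⊥ := by
    rw [hker, IsLocalRing.jacobson_eq_maximalIdeal ⊥ bot_ne_top]
  have hcomplete : IsAdicComplete (RingHom.ker (algebraMap T ℂ)) T := by
    rw [hker]
    infer_instance
  -- The linear functions on 𝔥* vanish at the origin, hence φ sends them into the maximal ideal.
  have hφ₀ : ∀ H, algebraMap T ℂ (φ (SymmetricAlgebra.ι ℂ 𝔥 H)) = 0 := fun H => by
    rw [← RingHom.mem_ker, hker]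
    change SymmetricAlgebra.ι ℂ 𝔥 H ∈ (IsLocalRing.maximalIdeal T).comap φ
    rw [hφ, RingHom.mem_ker]
    exact SymmetricAlgebra.lift_ι_apply 0 H
  refine ⟨Quotient.lift (fun M => DeformedO.Bimod.isoClass (M.1.baseChange ℂ) (M.2.reduce D hφ₀))
    fun M N ⟨e⟩ => Quotient.sound ⟨e.reduce⟩, fun M hM => ⟨hM.reduce D hφ₀, rfl⟩, ?_, ?_⟩
  · rintro ⟨M⟩ ⟨N⟩ h
    obtain ⟨e⟩ := Quotient.exact h
    exact Quotient.sound (M.2.nonempty_iso_of_reduce D hφ₀ hJ N.2 e)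
  · rintro ⟨N⟩
    obtain ⟨M, hM, e⟩ := N.2.exists_reduce D hφ₀ hJ
    exact ⟨DeformedO.Bimod.isoClass M hM, Quotient.sound e⟩
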